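/- **Setting.** Let $\Bbbk$ be a field of characteristic $0$, $\mathfrak g$ a Lie algebra over $\Bbbk$ with a symmetric invariant bilinear form $\langle\cdot|\cdot\rangle$, and $X_1$ a linear basis of $\mathfrak g$ equipped with a well-order. Let $K(\mathfrak g)=(\Bbbk[\partial]\otimes\mathfrak g)\oplus\Bbbk e$, $\partial e=0$, be the Kac–Moody Lie conformal algebra with $$[a_{(\lambda)}b]=[a,b]+\lambda\langle a|b\rangle e\quad(a,b\in\mathfrak g),\qquad e \text{ central},$$ and let $X=X_1\cup\{e\}$. Let $U=U(K(\mathfrak g);X,2)$ be the universal enveloping associative conformal algebra relative to locality $N=2$: it carries a homomorphism of Lie conformal algebras $\tau:K(\mathfrak g)\to U^{(-)}$ with $\tau(x)_{(n)}\tau(y)=0$ for $x,y\in X$, $n\ge2$, and is universal among associative conformal algebras with such a map. Here the bracket of $C^{(-)}$ is $[a_{(n)}b]=a_{(n)}b-\{b_{(n)}a\}$, where $\{u_{(n)}a\}=\sum_{s\ge0}\frac{(-1)^{n+s}}{s!}\partial^s(u_{(n+s)}a)$. Let $B=\{\partial,L_n^a,R_n^a\mid a\in X_1,\ n\ge0\}$.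 The free associative algebra $\Bbbk\langle B\rangle$ acts on $U$ by $\partial$, $L_n^au=\tau(a)_{(n)}u$ and $R_n^au=\{u_{(n)}\tau(a)\}$. Order $B$ by $L_0^a<L_1^a<\partial<L_2^a<\cdots<R_0^a<R_1^a<\cdots$ (for equal letter and lower index compare the upper indices), order words in $B$ by deg-lex, put $e<X_1$, and order the monomials $ux$ ($u\in B^*$, $x\in X$) of the free $\Bbbk\langle B\rangle$-module generated by $X$ by comparing first $u$, then $x$. For $y\in\mathfrak g$, the symbols $L_n^y$ and $uy$ are expanded linearly in the basis $X_1$. **Theorem.** The following rules form a Gröbner–Shirshov basis of $U$. Rules of the algebra $A$ (for $a,b\in X_1$, $n,m\ge0$ unless restricted): $$\partial L_0^a\to L_0^a\partial,\quad \partial L_1^a\to L_1^a\partial-L_0^a,\quad L_n^a\partial\to\partial L_n^a+nL_{n-1}^a\ (n\ge2),\quad R_n^a\partial\to\partial R_n^a+nR_{n-1}^a,$$ $$R_m^aL_n^b\to L_n^bR_m^a,\qquad L_n^aL_m^b\to L_m^bL_n^a+L_{n+m}^{[a,b]}\ \ ((n,a)>_{lex}(m,b)).$$ Rules of the module (for $a,b,c\in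 X_1$): $$\partial e\to0,\qquad L_n^ae\to0,\qquad R_n^ae\to0\quad(n\ge0),$$ $$L_n^ab\to0,\qquad R_n^ab\to0\quad(n\ge2),$$ $$R_1^ab\to L_1^ab-\langle a|b\rangle e,\qquad R_0^ab\to L_0^ab-[a,b],$$ $$L_1^ab\to-L_1^ba+\langle a|b\rangle e\quad(b<a),\qquad L_1^aa\to\tfrac12\langle a|a\rangle e,$$ $$L_1^a\partial^sb\to(s+1)L_0^a\partial^{s-1}b-L_0^b\partial^{s-1}a-\partial^{s-1}[a,b]\quad(s\ge1),$$ $$L_1^aL_1^bc\to0\quad(a\le b<c),$$ $$L_0^aL_1^bc\to L_0^cL_1^ba-L_0^bL_1^ca+L_1^a[c,b]+L_1^c[b,a]+L_1^b[a,c]+2\langle a|[b,c]\rangle e\quad(b<c<a).$$ That these rules form a Gröbner–Shirshov basis means: the order is a well-founded order in which each application of a rule replaces a monomial by a linear combination of smaller ones; $U$ is generated by $\tau(X)$ as a $\Bbbk\langle B\rangle$-module; the kernel of the homomorphism from the free $\Bbbk\langle B\rangle$-module generated by $X$ onto $U$, $x\mapsto\tau(x)$, is the linear span of all differences $uwvx-ufvx$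 (for rules $w\to f$ of $A$) and $uwx-uf$ (for rules $wx\to f$ of the module), where $u,v\in B^*$, $x\in X$; and the rewriting system on the free module is confluent. -/

import Mathlib

universe u v w

/-- A conformal algebra over a field `k` (of characteristic zero): a space with a linear map
`∂ = D` and bilinear products `a ₍ₙ₎ b = nprod n a b`, `n ≥ 0`, subject to locality and
sesquilinearity. The λ-product is `a ₍λ₎ b = ∑ n, λ ^ n / n! • (a ₍ₙ₎ b)`. -/
class ConformalAlgebra (k : Type*) (C : Type*) [Field k] [AddCommGroup C] [Module k C] where
  D : C →ₗ[k] C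
  nprod : ℕ → C →ₗ[k] C →ₗ[k] C
  locality : ∀ a b : C, ∃ N : ℕ, ∀ n, N ≤ n → nprod n a b = 0
  nprod_D_left : ∀ (n : ℕ) (a b : C), nprod n (D a) b = -((n : k) • nprod (n - 1) a b)
  nprod_D_right : ∀ (n : ℕ) (a b : C),
    nprod n a (D b) = D (nprod n a b) + (n : k) • nprod (n - 1) a b

namespace ConformalAlgebra

variable (k : Type*) {C : Type*} [Field k] [AddCommGroup C] [Module k C] [ConformalAlgebra k C]

/-- The summands of `{u ₍ₙ₎ v}` vanish from some point on, so their sum is finite. -/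
theorem finite_support_rev (n : ℕ) (v x : C) :
    (Function.support fun s : ℕ =>
      ((-1) ^ (n + s) / (Nat.factorial s : k)) • ((D (k := k)) ^ s) (nprod (k := k) (n + s) x v)
      ).Finite := by
  obtain ⟨N, hN⟩ := locality (k := k) x v
  refine (Set.finite_Iio N).subset fun s hs => ?_
  by_contra h
  exact hs (by simp [hN (n + s) (by simp at h; omega)])

/-- The opposite product `{x ₍ₙ₎ v} = ∑ s ≥ 0, (-1) ^ (n + s) ∂ ^ s / s! (x ₍ₙ₊ₛ₎ v)`
(that is, `{x ₍λ₎ v} = x ₍-∂-λ₎ v`), as a linear operator in `x`. -/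
noncomputable def rev (n : ℕ) (v : C) : C →ₗ[k] C where
  toFun x := ∑ᶠ s : ℕ,
    ((-1) ^ (n + s) / (Nat.factorial s : k)) • ((D (k := k)) ^ s) (nprod (k := k) (n + s) x v)
  map_add' x y := by
    rw [← finsum_add_distrib (finite_support_rev k n v x) (finite_support_rev k n v y)]
    simp
  map_smul' c x := by
    rw [RingHom.id_apply, smul_finsum' c (finite_support_rev k n v x)]
    refine finsum_congr fun s => ?_
    simp [smul_comm c]

variable (C) in
/-- Associativity `a ₍λ₎ (b ₍μ₎ c) = (a ₍λ₎ b) ₍λ+μ₎ c`. -/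
def IsAssociative : Prop :=
  ∀ (n m : ℕ) (a b c : C), nprod (k := k) n a (nprod (k := k) m b c) =
    ∑ s ∈ Finset.range (n + 1),
      (n.choose s : k) • nprod (k := k) (m + s) (nprod (k := k) (n - s) a b) c

/-- The commutator `[a ₍ₙ₎ b] = a ₍ₙ₎ b - {b ₍ₙ₎ a}`. -/
noncomputable def comm (n : ℕ) (a b : C) : C := nprod (k := k) n a b - rev k n a b

/-- Homomorphisms of conformal algebras. -/
def IsHom {C' : Type*} [AddCommGroup C'] [Module k C'] [ConformalAlgebra k C']
    (ψ : C →ₗ[k] C') : Prop :=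
  (∀ x, ψ (D (k := k) x) = D (k := k) (ψ x)) ∧
  ∀ n x y, ψ (nprod (k := k) n x y) = nprod (k := k) n (ψ x) (ψ y)

/-- `φ : L → C` is a homomorphism from the Lie conformal algebra `L` into the commutator
algebra `C⁽⁻⁾` of an associative conformal algebra `C` such that the locality of the images
of any two elements of `X` does not exceed `N`. -/
def IsEnvelopeMap {L : Type*} [AddCommGroup L] [Module k L] [ConformalAlgebra k L]
    (X : Set L) (N : ℕ) (φ : L →ₗ[k] C) : Prop :=
  IsAssociative k C ∧
  (∀ x, φ (D (k := k) x) = D (k := k) (φ x)) ∧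
  (∀ n x y, φ (nprod (k := k) n x y) = comm k n (φ x) (φ y)) ∧
  ∀ x ∈ X, ∀ y ∈ X, ∀ n, N ≤ n → nprod (k := k) n (φ x) (φ y) = 0

end ConformalAlgebra

open ConformalAlgebra in
/-- `τ : L → U` exhibits `U` as the universal enveloping associative conformal algebra
`U(L; X, N)` of the Lie conformal algebra `L` relative to the locality bound `N` on the
generating set `X`. -/
structure IsUniversalEnvelope (k : Type*) [Field k]
    {L : Type*} [AddCommGroup L] [Module k L] [ConformalAlgebra k L]
    (X : Set L) (N : ℕ) {U : Type w} [AddCommGroup U] [Module k U] [ConformalAlgebra k U]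
    (τ : L →ₗ[k] U) : Prop where
  isEnvelopeMap : IsEnvelopeMap k X N τ
  universal : ∀ (C : Type w) [AddCommGroup C] [Module k C] [ConformalAlgebra k C]
    (φ : L →ₗ[k] C), IsEnvelopeMap k X N φ → ∃! ψ : U →ₗ[k] C, IsHom k ψ ∧ ψ ∘ₗ τ = φ

section KacMoody

variable {k : Type u} {g : Type v} [Field k] [LieRing g] [LieAlgebra k g]

/-- The space `K(g) = (k[∂] ⊗ g) ⊕ k e` of the Kac--Moody conformal algebra of the Lie algebra
`g` with the bilinear form `Φ`. An element of `k[∂] ⊗ g` is a polynomial in `∂` with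
coefficients in `g`: `Finsupp.single i a` is `∂ ^ i a`. -/
@[nolint unusedArguments]
def KacMoody (_Φ : LinearMap.BilinForm k g) : Type (max u v) := (ℕ →₀ g) × k

namespace KacMoody

variable (Φ : LinearMap.BilinForm k g)

noncomputable instance : AddCommGroup (KacMoody Φ) := inferInstanceAs (AddCommGroup ((ℕ →₀ g) × k))
noncomputable instance : Module k (KacMoody Φ) := inferInstanceAs (Module k ((ℕ →₀ g) × k))

/-- The torsion element `e`. -/
def e : KacMoody Φ := ((0 : ℕ →₀ g), (1 : k))

/-- The embedding of `k[∂] ⊗ g` into `K(g)`. -/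
noncomputable def incl : (ℕ →₀ g) →ₗ[k] KacMoody Φ := LinearMap.inl k (ℕ →₀ g) k

/-- The projection of `K(g)` onto `k[∂] ⊗ g`. -/
noncomputable def proj : KacMoody Φ →ₗ[k] (ℕ →₀ g) := LinearMap.fst k (ℕ →₀ g) k

/-- The element `∂ ^ i a`. -/
noncomputable def dmon (i : ℕ) : g →ₗ[k] KacMoody Φ := incl Φ ∘ₗ Finsupp.lsingle i

/-- The operator `∂`: `∂ (∂ ^ i a) = ∂ ^ (i + 1) a`, `∂ e = 0`. -/
noncomputable def der : KacMoody Φ →ₗ[k] KacMoody Φ :=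
  (Finsupp.lsum k fun i => dmon Φ (i + 1)) ∘ₗ proj Φ

/-- The `n`-th product `[∂ ^ i a ₍ₙ₎ ∂ ^ j b]`, i.e. `n!` times the coefficient at `λ ^ n` of
`(-λ) ^ i (λ + ∂) ^ j ([a, b] + λ ⟨a|b⟩ e)`, where `∂ e = 0`. -/
noncomputable def monBracket (n i j : ℕ) : g →ₗ[k] g →ₗ[k] KacMoody Φ :=
  LinearMap.mk₂ k
    (fun a b =>
      (if i ≤ n then (-1 : k) ^ i * (n.factorial : k) * (j.choose (n - i) : k) else 0) •
          dmon Φ (i + j - n) ⁅a, b⁆ +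
        (if n = i + j + 1 then (-1 : k) ^ i * (n.factorial : k) * Φ a b else 0) • e Φ)
    (by intro a a' b; split_ifs <;> simp <;> module)
    (by intro c a b; split_ifs <;> simp <;> module)
    (by intro a b b'; split_ifs <;> simp <;> module)
    (by intro c a b; split_ifs <;> simp <;> module)

/-- The `n`-th product on `K(g)`; the element `e` is central. -/
noncomputable def bracket (n : ℕ) : KacMoody Φ →ₗ[k] KacMoody Φ →ₗ[k] KacMoody Φ :=
  (Finsupp.lsum k fun i => LinearMap.flip
    (Finsupp.lsum k fun j => LinearMap.flip (monBracket Φ n i j))).compl₁₂ (proj Φ) (proj Φ)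

theorem proj_e : proj Φ (e Φ) = 0 := rfl

theorem proj_dmon (i : ℕ) (a : g) : proj Φ (dmon Φ i a) = Finsupp.single i a := rfl

theorem ext_dmon {V : Type*} [AddCommGroup V] [Module k V] {f f' : KacMoody Φ →ₗ[k] V}
    (h : ∀ i a, f (dmon Φ i a) = f' (dmon Φ i a)) (he : f (e Φ) = f' (e Φ)) : f = f' := by
  refine LinearMap.prod_ext (Finsupp.lhom_ext fun i a => h i a) (LinearMap.ext_ring he)

theorem der_dmon (i : ℕ) (a : g) : der Φ (dmon Φ i a) = dmon Φ (i + 1) a := by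
  simp [der, proj_dmon]

theorem der_e : der Φ (e Φ) = 0 := by
  simp [der, proj_e]

theorem bracket_dmon (n i j : ℕ) (a b : g) :
    bracket Φ n (dmon Φ i a) (dmon Φ j b) = monBracket Φ n i j a b := by
  simp [bracket, proj_dmon]

theorem bracket_e_left (n : ℕ) (x : KacMoody Φ) : bracket Φ n (e Φ) x = 0 := by
  simp [bracket, proj_e]

theorem bracket_e_right (n : ℕ) (x : KacMoody Φ) : bracket Φ n x (e Φ) = 0 := by
  simp [bracket, proj_e]

/-- Sesquilinearity in the first argument. -/
theorem bracket_der_left (n : ℕ) (x y : KacMoody Φ) :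
    bracket Φ n (der Φ x) y = -((n : k) • bracket Φ (n - 1) x y) := by
  suffices h : (bracket Φ n) ∘ₗ der Φ = -((n : k) • bracket Φ (n - 1)) by
    simpa using LinearMap.congr_fun₂ h x y
  refine ext_dmon Φ (fun i a => ext_dmon Φ (fun j b => ?_) ?_) ?_
  · rcases n with _ | n
    · simp [der_dmon, bracket_dmon, monBracket]
    · have hc : ((n + 1).factorial : k) = (n + 1) * (n.factorial : k) := by
        rw [Nat.factorial_succ]; push_cast; ring
      have h1 : i + 1 + j - (n + 1) = i + j - n := by omega
      have h2 : n + 1 - (i + 1) = n - i := by omega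
      have h3 : (n + 1 = i + 1 + j + 1) ↔ (n = i + j + 1) := by omega
      simp only [LinearMap.comp_apply, der_dmon, LinearMap.neg_apply, LinearMap.smul_apply,
        bracket_dmon, Nat.add_sub_cancel, monBracket, LinearMap.mk₂_apply, h1, h2, h3, hc,
        Nat.add_le_add_iff_right]
      split_ifs <;> push_cast <;> module
  · simp [bracket_e_right]
  · ext1 y
    simp [bracket_e_left, der_e]

/-- Sesquilinearity in the second argument. -/
theorem bracket_der_right (n : ℕ) (x y : KacMoody Φ) :
    bracket Φ n x (der Φ y) = der Φ (bracket Φ n x y) + (n : k) • bracket Φ (n - 1) x y := by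
  suffices h : (bracket Φ n).compl₂ (der Φ) =
      (bracket Φ n).compr₂ (der Φ) + (n : k) • bracket Φ (n - 1) by
    simpa using LinearMap.congr_fun₂ h x y
  refine ext_dmon Φ (fun i a => ext_dmon Φ (fun j b => ?_) ?_) ?_
  · simp only [LinearMap.compl₂_apply, LinearMap.compr₂_apply, LinearMap.add_apply,
      LinearMap.smul_apply, der_dmon, bracket_dmon, monBracket, LinearMap.mk₂_apply, map_add,
      map_smul, der_e, smul_zero, add_zero]
    rcases n with _ | n
    · rcases Nat.eq_zero_or_pos i with rfl | hi
      · simp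
      · simp [Nat.not_le.2 hi]
    · have hc : ((n + 1).factorial : k) = (n + 1) * (n.factorial : k) := by
        rw [Nat.factorial_succ]; push_cast; ring
      have h3 : (n + 1 = i + (j + 1) + 1) ↔ (n = i + j + 1) := by omega
      have h1 : i + (j + 1) - (n + 1) = i + j - n := by omega
      simp only [Nat.add_sub_cancel, h1, h3, hc]
      rcases lt_trichotomy i (n + 1) with h | h | h
      · have h4 : n + 1 - i = (n - i) + 1 := by omega
        have h5 : i ≤ n := by omega
        rw [if_pos h.le, if_pos h.le, if_pos h5, h4, Nat.choose_succ_succ]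
        rcases le_or_gt (n + 1) (i + j) with h6 | h6
        · have h7 : i + j - n = i + j - (n + 1) + 1 := by omega
          rw [h7]
          split_ifs <;> push_cast <;> module
        · have h8 : j.choose (n - i + 1) = 0 := Nat.choose_eq_zero_of_lt (by omega)
          rw [h8]
          split_ifs <;> push_cast <;> module
      · have h4 : i + j - n = i + j - (n + 1) + 1 := by omega
        rw [if_pos h.le, if_pos h.le, if_neg (by omega), if_neg (by omega), if_neg (by omega),
          h, Nat.sub_self, Nat.choose_zero_right, Nat.choose_zero_right]
        have h5 : n + 1 + j - n = n + 1 + j - (n + 1) + 1 := by omega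
        rw [h5]
        module
      · rw [if_neg (by omega), if_neg (by omega), if_neg (by omega), if_neg (by omega),
          if_neg (by omega)]
        simp
  · simp [bracket_e_right, der_e]
  · ext1 y
    simp [bracket_e_left]

/-- Locality of the products on `K(g)`. -/
theorem bracket_locality (x y : KacMoody Φ) :
    ∃ N : ℕ, ∀ n, N ≤ n → bracket Φ n x y = 0 := by
  have key : ∀ p q : ℕ →₀ g, ∃ N : ℕ, ∀ n, N ≤ n → bracket Φ n (incl Φ p) (incl Φ q) = 0 := by
    intro p q
    induction p using Finsupp.induction_linear with
    | zero => exact ⟨0, fun n _ => by simp⟩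
    | add p p' hp hp' =>
      obtain ⟨N, hN⟩ := hp
      obtain ⟨N', hN'⟩ := hp'
      exact ⟨max N N', fun n hn => by
        simp [hN n (le_trans (le_max_left _ _) hn), hN' n (le_trans (le_max_right _ _) hn)]⟩
    | single i a =>
      induction q using Finsupp.induction_linear with
      | zero => exact ⟨0, fun n _ => by simp⟩
      | add q q' hq hq' =>
        obtain ⟨N, hN⟩ := hq
        obtain ⟨N', hN'⟩ := hq'
        exact ⟨max N N', fun n hn => by
          simp [hN n (le_trans (le_max_left _ _) hn), hN' n (le_trans (le_max_right _ _) hn)]⟩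
      | single j b =>
        refine ⟨i + j + 2, fun n hn => ?_⟩
        change bracket Φ n (dmon Φ i a) (dmon Φ j b) = 0
        have h : j.choose (n - i) = 0 := Nat.choose_eq_zero_of_lt (by omega)
        have h' : n ≠ i + j + 1 := by omega
        simp [bracket_dmon, monBracket, h, h']
  exact key (proj Φ x) (proj Φ y)

/-- The Kac--Moody conformal algebra `K(g)`. By sesquilinearity, its products are determined by
those of `a, b ∈ g`: `a ₍₀₎ b = [a, b]`, `a ₍₁₎ b = ⟨a|b⟩ e`, and `a ₍ₙ₎ b = 0` for `n ≥ 2`. -/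
noncomputable instance : ConformalAlgebra k (KacMoody Φ) where
  D := der Φ
  nprod := bracket Φ
  locality := bracket_locality Φ
  nprod_D_left := bracket_der_left Φ
  nprod_D_right := bracket_der_right Φ

end KacMoody
end KacMoody

section Rewriting

/-- Rewriting rules for a module, generated by the set `X`, over an associative algebra generated
by the set `B`. Monomials of the free associative algebra `k⟨B⟩` are words `w : List B`; monomials
`w x` of the free `k⟨B⟩`-module generated by `X` are pairs `(w, x)`. `alg w f` is the rule `w → f`
of the algebra, `mod (w, x) f` is the rule `w x → f` of the module. -/
structure RewritingRules (k B X : Type*) [Field k] where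
  alg : List B → (List B →₀ k) → Prop
  mod : List B × X → (List B × X →₀ k) → Prop

namespace RewritingRules

variable {k B X : Type*} [Field k] (S : RewritingRules k B X)

/-- `S.Rewrites m r`: one application of a rule takes the monomial `m` to `r`: either
`u w v x ↦ u f v x` for a rule `w → f` of the algebra, or `u w x ↦ u f` for a rule `w x → f`
of the module. -/
inductive Rewrites : List B × X → (List B × X →₀ k) → Prop
  | alg {w : List B} {f : List B →₀ k} (h : S.alg w f) (u v : List B) (x : X) :
      Rewrites (u ++ w ++ v, x) (f.mapDomain fun w' => (u ++ w' ++ v, x))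
  | mod {w : List B} {x : X} {f : List B × X →₀ k} (h : S.mod (w, x) f) (u : List B) :
      Rewrites (u ++ w, x) (f.mapDomain fun m => (u ++ m.1, m.2))

/-- One step of rewriting in the free module: a monomial that occurs in `f` is rewritten. -/
def Step (f f' : List B × X →₀ k) : Prop :=
  ∃ m r, S.Rewrites m r ∧ f m ≠ 0 ∧ f' = f - f m • (Finsupp.single m 1 - r)

/-- Confluence of the rewriting graph on the free module. -/
def Confluent : Prop :=
  ∀ f g h, Relation.ReflTransGen S.Step f g → Relation.ReflTransGen S.Step f h →
    Relation.Join (Relation.ReflTransGen S.Step) g h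

/-- The homomorphism of the free `k⟨B⟩`-module generated by `X` to a `k⟨B⟩`-module `M` (given by
the action of the generators) that takes `x` to `gen x`. -/
noncomputable def eval {M : Type*} [AddCommGroup M] [Module k M] (act : B → Module.End k M)
    (gen : X → M) : (List B × X →₀ k) →ₗ[k] M :=
  Finsupp.linearCombination k fun m => m.1.foldr (fun b y => act b y) (gen m.2)

/-- `S` is a Gröbner--Shirshov basis, relative to the order `lt` on the monomials, of the module `M`
generated by the elements `gen x`: the order is well-founded and the left-hand sides of the
rules are leading monomials, the rules are defining relations of `M`, and the rewriting
system is confluent. -/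
structure IsGroebnerShirshovBasis (lt : List B × X → List B × X → Prop)
    {M : Type*} [AddCommGroup M] [Module k M] (act : B → Module.End k M) (gen : X → M) :
    Prop where
  wellFounded : WellFounded lt
  leading : ∀ m r, S.Rewrites m r → ∀ m' ∈ r.support, lt m' m
  generates : LinearMap.range (eval act gen) = ⊤
  defining : LinearMap.ker (eval act gen) =
    Submodule.span k {f | ∃ m r, S.Rewrites m r ∧ f = Finsupp.single m 1 - r}
  confluent : S.Confluent

end RewritingRules

end Rewriting

section KacMoodyRules

/-- The generators `∂`, `L_n^a`, `R_n^a` of the algebra `A`, where `a` runs over the index set of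
a basis of the Lie algebra. -/
inductive Gen (ι : Type*)
  | D : Gen ι
  | L (n : ℕ) (a : ι) : Gen ι
  | R (n : ℕ) (a : ι) : Gen ι

namespace Gen

/-- The order `L_0^a < L_1^a < ∂ < L_2^a < ⋯ < R_0^a < R_1^a < ⋯`; generators `L_n^a`, `L_n^b`
(and likewise `R_n^a`, `R_n^b`) are compared by their upper indices. -/
def lt {ι : Type*} [LT ι] : Gen ι → Gen ι → Prop
  | L n a, L m b => n < m ∨ n = m ∧ a < b
  | L n _, D => n ≤ 1
  | D, L n _ => 2 ≤ n
  | D, D => False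
  | R n a, R m b => n < m ∨ n = m ∧ a < b
  | R _ _, _ => False
  | _, R _ _ => True

/-- The order on the monomials `u x`: first compare `u` by the deg-lex order, then `x`. -/
def monLT {ι : Type*} [LinearOrder ι] : List (Gen ι) × WithBot ι →
    List (Gen ι) × WithBot ι → Prop :=
  Prod.Lex (List.Shortlex lt) (· < ·)

end Gen

namespace KacMoody

variable {k : Type u} {g : Type v} {ι : Type w} [Field k] [LieRing g] [LieAlgebra k g]

/-- The generators of the module: `X = X₁ ∪ {e}` with `e < X₁` is modelled by `WithBot ι`, where
`ι` indexes the basis `X₁` of `g`, and the bottom element stands for `e`. -/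
noncomputable def gen (Φ : LinearMap.BilinForm k g) (b : Module.Basis ι k g) :
    WithBot ι → KacMoody Φ
  | ⊥ => e Φ
  | (a : ι) => dmon Φ 0 (b a)

/-- The action of the generators of `A` on an associative envelope `U` of `K(g)`:
`L_n^a u = a ₍ₙ₎ u` and `R_n^a u = {u ₍ₙ₎ a}`. -/
noncomputable def act {U : Type*} [AddCommGroup U] [Module k U] [ConformalAlgebra k U]
    (Φ : LinearMap.BilinForm k g) (b : Module.Basis ι k g) (τ : KacMoody Φ →ₗ[k] U) :
    Gen ι → Module.End k U
  | .D => ConformalAlgebra.D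
  | .L n a => ConformalAlgebra.nprod n (τ (dmon Φ 0 (b a)))
  | .R n a => ConformalAlgebra.rev k n (τ (dmon Φ 0 (b a)))

/-- A word as an element of the free associative algebra. -/
noncomputable def wd (u : List (Gen ι)) : List (Gen ι) →₀ k := Finsupp.single u 1

/-- The monomial `u a`, with `a` in the basis of `g`, as an element of the free module. -/
noncomputable def mon (u : List (Gen ι)) (a : ι) : List (Gen ι) × WithBot ι →₀ k :=
  Finsupp.single (u, (a : WithBot ι)) 1

/-- The element `e` of the free module. -/
noncomputable def monE : List (Gen ι) × WithBot ι →₀ k := Finsupp.single ([], ⊥) 1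

/-- The element `u y` of the free module for `y ∈ g`, expanded linearly in the basis. -/
noncomputable def monLin (b : Module.Basis ι k g) (u : List (Gen ι)) (y : g) :
    List (Gen ι) × WithBot ι →₀ k :=
  (b.repr y).mapDomain fun c : ι => (u, (c : WithBot ι))

/-- The element `L_n^y` for `y ∈ g`, expanded linearly in the basis. -/
noncomputable def genLin (b : Module.Basis ι k g) (n : ℕ) (y : g) : List (Gen ι) →₀ k :=
  (b.repr y).mapDomain fun c => [Gen.L n c]

open Gen in
/-- The rules of the algebra `A`. -/
inductive AlgRule [LinearOrder ι] (b : Module.Basis ι k g) :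
    List (Gen ι) → (List (Gen ι) →₀ k) → Prop
  | D_L0 (a : ι) : AlgRule b [D, L 0 a] (wd [L 0 a, D])
  | D_L1 (a : ι) : AlgRule b [D, L 1 a] (wd [L 1 a, D] - wd [L 0 a])
  | L_D (n : ℕ) (hn : 2 ≤ n) (a : ι) :
      AlgRule b [L n a, D] (wd [D, L n a] + (n : k) • wd [L (n - 1) a])
  | R_D (n : ℕ) (a : ι) :
      AlgRule b [R n a, D] (wd [D, R n a] + (n : k) • wd [R (n - 1) a])
  | R_L (m n : ℕ) (a c : ι) : AlgRule b [R m a, L n c] (wd [L n c, R m a])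
  | L_L (n m : ℕ) (a c : ι) (h : m < n ∨ m = n ∧ c < a) :
      AlgRule b [L n a, L m c] (wd [L m c, L n a] + genLin b (n + m) ⁅b a, b c⁆)

open Gen in
/-- The rules of the module `U(K(g); X, 2)`. -/
inductive ModRule [LinearOrder ι] (Φ : LinearMap.BilinForm k g) (b : Module.Basis ι k g) :
    List (Gen ι) × WithBot ι → (List (Gen ι) × WithBot ι →₀ k) → Prop
  | D_e : ModRule Φ b ([D], ⊥) 0
  | L_e (n : ℕ) (x : ι) : ModRule Φ b ([L n x], ⊥) 0
  | R_e (n : ℕ) (x : ι) : ModRule Φ b ([R n x], ⊥) 0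
  | L_loc (n : ℕ) (hn : 2 ≤ n) (x y : ι) : ModRule Φ b ([L n x], y) 0
  | R_loc (n : ℕ) (hn : 2 ≤ n) (x y : ι) : ModRule Φ b ([R n x], y) 0
  | R1 (x y : ι) : ModRule Φ b ([R 1 x], y) (mon [L 1 x] y - Φ (b x) (b y) • monE)
  | R0 (x y : ι) : ModRule Φ b ([R 0 x], y) (mon [L 0 x] y - monLin b [] ⁅b x, b y⁆)
  | L1_skew (x y : ι) (h : y < x) :
      ModRule Φ b ([L 1 x], y) (-mon [L 1 y] x + Φ (b x) (b y) • monE)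
  | L1_diag (x : ι) : ModRule Φ b ([L 1 x], x) ((1 / 2 * Φ (b x) (b x)) • monE)
  | L1_D (s : ℕ) (hs : 1 ≤ s) (x y : ι) :
      ModRule Φ b (L 1 x :: List.replicate s D, y)
        ((s + 1 : k) • mon (L 0 x :: List.replicate (s - 1) D) y
          - mon (L 0 y :: List.replicate (s - 1) D) x
          - monLin b (List.replicate (s - 1) D) ⁅b x, b y⁆)
  | L1_L1 (x y z : ι) (h : x ≤ y) (h' : y < z) : ModRule Φ b ([L 1 x, L 1 y], z) 0
  | L0_L1 (x y z : ι) (h : y < z) (h' : z < x) :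
      ModRule Φ b ([L 0 x, L 1 y], z)
        (mon [L 0 z, L 1 y] x - mon [L 0 y, L 1 z] x
          + monLin b [L 1 x] ⁅b z, b y⁆ + monLin b [L 1 z] ⁅b y, b x⁆
          + monLin b [L 1 y] ⁅b x, b z⁆ + (2 * Φ (b x) ⁅b y, b z⁆) • monE)

/-- The rewriting system for `U(K(g); X, 2)`. -/
def rules [LinearOrder ι] (Φ : LinearMap.BilinForm k g) (b : Module.Basis ι k g) :
    RewritingRules k (Gen ι) (WithBot ι) where
  alg := AlgRule b
  mod := ModRule Φ b

end KacMoody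

end KacMoodyRules

/-! Every rule holds in every envelope. Locality `2` leaves at most two terms in the opposite
products of generators, so the commutator relations say that `a ₍₁₎ b` is skew-symmetric modulo `e`,
and they compute `∂ (a ₍₁₎ b)`. With associativity and `∂ e = 0` this gives the commutators of the
operators `L` (`nprod_comm`), the vanishing of `a ₍₁₎ (b ₍₁₎ c)` (`nprod_one_nprod_one`) and, by
applying `∂` to the latter, the cyclic rule for `L_0 L_1` (`nprod_zero_nprod_one`).

The rules lower the deg-lex order, so everything reduces to combinations of normal monomials. These
are among `e`, `L_0^u ∂^s x` with `u` nondecreasing, and `L_0^u L_1^x y` with `u` nondecreasing, `x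
< y` and all entries of `u` at most `y` (`normalForm_of_normal`). If the images of such monomials in
`U` are independent, the rules span all relations and confluence is automatic: two normal
descendants of one element have the same image (`isGroebnerShirshovBasis_of_retraction`).

Independence is seen in a concrete envelope. Let `P` be the free `U(g)`-module on a copy of the
basis of `g` (`FreeEnv`); it is an associative algebra in which the generator of `a` multiplies as
`a` acts. Let `Q` be the `U(g)`-module generated by `e` and symbols `x ∧ y`, `x < y`, with `g e = 0`
and the cyclic relation (`SkewEnv`). The equivariant map `δ : Q → P` sends `x ∧ y` to the commutator
of the generators of `x` and `y` minus the generator of `[x, y]`. Then `k[∂] ⊗ P ⊕ Q`, with `∂ = δ`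
on `Q`, is an associative conformal algebra (`TorsionExtension`) and an envelope of `K(g)`, so `U`
maps to it. The monomials above go to `e`, to `∂^s (u x)`, and to `u (x ∧ y)`.

Their independence in `P` is of Poincaré–Birkhoff–Witt type. In `Q` it comes from the diamond lemma;
the essential overlap is `a c (x ∧ y)` with `x < y < c < a`, resolved by the Jacobi identity and
invariance of the form (`cyclicRelation_overlap`). Finally, `τ(X)` generates `U` as a module since
the submodule it generates is closed under all products (`nprod_mem_evalRange`). -/

namespace ConformalAlgebra

/-! ### Opposite products, and associativity under the derivation. -/

section General

variable {k : Type*} {C : Type*} [Field k] [AddCommGroup C] [Module k C] [ConformalAlgebra k C]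

theorem rev_eq_sum {n N : ℕ} {v x : C} (h : ∀ j, n + N ≤ j → nprod (k := k) j x v = 0) :
    rev k n v x = ∑ s ∈ Finset.range N, ((-1) ^ (n + s) / (Nat.factorial s : k)) •
      ((D (k := k)) ^ s) (nprod (k := k) (n + s) x v) := by
  refine finsum_eq_finsetSum_of_support_subset _ fun s hs => ?_
  by_contra hN
  exact hs (by simp [h (n + s) (by simp at hN; omega)])

theorem rev_eq_zero {n : ℕ} {v x : C} (h : ∀ j, n ≤ j → nprod (k := k) j x v = 0) :
    rev k n v x = 0 := by
  simpa using rev_eq_sum (n := n) (N := 0) (by simpa using h)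

theorem factorial_succ_inv_smul [CharZero k] (s : ℕ) :
    ((s + 1 : ℕ) : k) * (1 / ((s + 1).factorial : k)) = 1 / (s.factorial : k) := by
  rw [Nat.factorial_succ]
  have h : (s.factorial : k) ≠ 0 := Nat.cast_ne_zero.2 s.factorial_ne_zero
  have h' : ((s + 1 : ℕ) : k) ≠ 0 := Nat.cast_ne_zero.2 s.succ_ne_zero
  push_cast at *
  field_simp

/-- The factor `n + s` produced by `∂ x ₍ₙ₊ₛ₎ v` splits: the part `n` gives the second term, while
`s / s! = 1 / (s - 1)!` shifts the sum by one and releases a `∂`. -/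
theorem rev_D [CharZero k] (n : ℕ) (v x : C) :
    rev k n v (D (k := k) x) = D (k := k) (rev k n v x) + (n : k) • rev k (n - 1) v x := by
  obtain ⟨N, hN⟩ := locality (k := k) x v
  rw [rev_eq_sum (n := n) (N := N + 1) (x := D (k := k) x), rev_eq_sum (n := n) (N := N),
    rev_eq_sum (n := n - 1) (N := N + 1)]
  rotate_left
  · intro j hj; exact hN j (by omega)
  · intro j hj; exact hN j (by omega)
  · intro j hj; rw [nprod_D_left, hN (j - 1) (by omega)]; simp
  have h1 : ∀ s : ℕ, ((-1) ^ (n + s) / (Nat.factorial s : k)) •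
      ((D (k := k)) ^ s) (nprod (k := k) (n + s) (D (k := k) x) v) =
      (n : k) • (((-1) ^ (n - 1 + s) / (Nat.factorial s : k)) •
        ((D (k := k)) ^ s) (nprod (k := k) (n - 1 + s) x v)) -
      (((-1) ^ (n + s) * (s * (1 / (Nat.factorial s : k)))) •
        ((D (k := k)) ^ s) (nprod (k := k) (n + s - 1) x v)) := by
    intro s
    rw [nprod_D_left]
    rcases n with _ | n
    · rw [map_neg, map_smul, zero_add]
      push_cast
      module
    · rw [show n + 1 + s - 1 = n + s by omega, show n + 1 - 1 + s = n + s by omega,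
        map_neg, map_smul, ← sub_eq_zero]
      push_cast
      module
  rw [Finset.sum_congr rfl fun s _ => h1 s, Finset.sum_sub_distrib, ← Finset.smul_sum,
    add_comm (D (k := k) _), sub_eq_add_neg]
  congr 1
  rw [Finset.sum_range_succ', map_sum]
  simp only [factorial_succ_inv_smul, map_smul]
  simp only [Nat.cast_zero, zero_mul, mul_zero, zero_smul, add_zero, ← Finset.sum_neg_distrib]
  refine Finset.sum_congr rfl fun s _ => ?_
  rw [pow_succ' (D (k := k)) s, Module.End.mul_apply, show n + (s + 1) - 1 = n + s by omega,
    ← neg_smul]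
  congr 1
  ring

/-- Apart from the terms with factor `n`, the expansion of `x ₍ₙ₊ₛ₎ ∂ v` consists of `∂^(s+1)` terms
that cancel against the `s / s!` terms of the next index. -/
theorem rev_D_left [CharZero k] (n : ℕ) (v x : C) :
    rev k n (D (k := k) v) x = -((n : k) • rev k (n - 1) v x) := by
  obtain ⟨N, hN⟩ := locality (k := k) x v
  rw [rev_eq_sum (n := n) (N := N + 1) (x := x), rev_eq_sum (n := n - 1) (N := N + 1)]
  rotate_left
  · intro j hj; exact hN j (by omega)
  · intro j hj; rw [nprod_D_right, hN (j - 1) (by omega), hN j (by omega)]; simp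
  have h1 : ∀ s : ℕ, ((-1) ^ (n + s) / (Nat.factorial s : k)) •
      ((D (k := k)) ^ s) (nprod (k := k) (n + s) x (D (k := k) v)) =
      -((n : k) • (((-1) ^ (n - 1 + s) / (Nat.factorial s : k)) •
        ((D (k := k)) ^ s) (nprod (k := k) (n - 1 + s) x v))) +
      ((((-1) ^ (n + s) * (s * (1 / (Nat.factorial s : k)))) •
        ((D (k := k)) ^ s) (nprod (k := k) (n + s - 1) x v)) +
      ((-1) ^ (n + s) * (1 / (Nat.factorial s : k))) •
        ((D (k := k)) ^ (s + 1)) (nprod (k := k) (n + s) x v)) := by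
    intro s
    rw [nprod_D_right, pow_succ (D (k := k)) s, Module.End.mul_apply]
    rcases n with _ | n
    · simp only [map_add, map_smul, smul_smul, smul_add]
      rw [← sub_eq_zero]
      push_cast
      module
    · rw [show n + 1 + s - 1 = n + s by omega, show n + 1 - 1 + s = n + s by omega,
        map_add, map_smul, ← sub_eq_zero]
      push_cast
      module
  rw [Finset.sum_congr rfl fun s _ => h1 s, Finset.sum_add_distrib, Finset.sum_neg_distrib,
    ← Finset.smul_sum, add_eq_left, Finset.sum_add_distrib, Finset.sum_range_succ',
    Finset.sum_range_succ _ N]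
  simp only [factorial_succ_inv_smul, hN (n + N) (by omega), map_zero, smul_zero, add_zero,
    Nat.cast_zero, zero_mul, mul_zero, zero_smul]
  rw [← Finset.sum_add_distrib]
  refine Finset.sum_eq_zero fun s _ => ?_
  rw [show n + (s + 1) - 1 = n + s by omega]
  module

theorem comm_D_left [CharZero k] (n : ℕ) (a b : C) :
    comm k n (D (k := k) a) b = -((n : k) • comm k (n - 1) a b) := by
  rw [comm, comm, nprod_D_left, rev_D_left]
  module

theorem comm_D_right [CharZero k] (n : ℕ) (a b : C) :
    comm k n a (D (k := k) b) = D (k := k) (comm k n a b) + (n : k) • comm k (n - 1) a b := by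
  rw [comm, comm, comm, nprod_D_right, rev_D, map_sub]
  module

variable (k) in
/-- The associativity identities for a triple of elements. -/
def AssocAt (a b c : C) : Prop :=
  ∀ n m : ℕ, nprod (k := k) n a (nprod (k := k) m b c) =
    ∑ s ∈ Finset.range (n + 1),
      (n.choose s : k) • nprod (k := k) (m + s) (nprod (k := k) (n - s) a b) c

theorem succ_choose_mul {k : Type*} [Field k] (n s : ℕ) :
    ((n + 1).choose (s + 1) : k) * ((s : k) + 1) = ((n : k) + 1) * (n.choose s : k) := by
  have h := congrArg (Nat.cast (R := k)) (Nat.add_one_mul_choose_eq n s)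
  push_cast at h
  exact h.symm

theorem succ_choose_mul_sub {k : Type*} [Field k] {n s : ℕ} (h : s ≤ n) :
    ((n + 1).choose s : k) * ((n + 1 - s : ℕ) : k) = ((n : k) + 1) * (n.choose s : k) := by
  have h' := congrArg (Nat.cast (R := k)) (Nat.choose_mul_succ_eq n s)
  push_cast at h'
  rw [mul_comm ((n : k) + 1), h', Nat.cast_sub (by omega), Nat.cast_succ]

/-- Together with `AssocAt.D_mid` and `AssocAt.D_right` this reduces associativity to elements that
generate the algebra over `k[∂]`. -/
theorem AssocAt.D_left {a b c : C} (h : AssocAt k a b c) : AssocAt k (D (k := k) a) b c := by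
  intro n m
  rw [nprod_D_left]
  rcases n with _ | n
  · simp [nprod_D_left]
  rw [Finset.sum_range_succ, Nat.sub_self, nprod_D_left 0]
  simp only [Nat.cast_zero, zero_smul, neg_zero, map_zero, LinearMap.zero_apply, smul_zero,
    add_zero, Nat.add_sub_cancel]
  rw [h, Finset.smul_sum, ← Finset.sum_neg_distrib]
  refine Finset.sum_congr rfl fun s hs => ?_
  have hs' : s ≤ n := by simpa [Nat.lt_succ_iff] using hs
  rw [nprod_D_left, show n + 1 - s - 1 = n - s by omega]
  simp only [map_neg, map_smul, LinearMap.neg_apply, LinearMap.smul_apply, smul_neg, smul_smul]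
  rw [succ_choose_mul_sub hs']
  push_cast
  rfl

/-- The weight `m + s` splits, and the part `s` is absorbed by `s * choose n s = n * choose (n - 1)
(s - 1)`. This is the bookkeeping of `∂` acting in the middle or right argument. -/
theorem sum_choose_mul_shift {k C : Type*} [Field k] [AddCommGroup C] [Module k C]
    (n m : ℕ) (f : ℕ → C) :
    ∑ s ∈ Finset.range (n + 1), ((n.choose s : k) * ((m + s : ℕ) : k)) • f s =
      (m : k) • ∑ s ∈ Finset.range (n + 1), (n.choose s : k) • f s +
      (n : k) • ∑ s ∈ Finset.range n, ((n - 1).choose s : k) • f (s + 1) := by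
  have h : ∑ s ∈ Finset.range (n + 1), ((n.choose s : k) * (s : k)) • f s =
      (n : k) • ∑ s ∈ Finset.range n, ((n - 1).choose s : k) • f (s + 1) := by
    rw [Finset.sum_range_succ', Finset.smul_sum]
    simp only [Nat.cast_zero, mul_zero, zero_smul, add_zero]
    refine Finset.sum_congr rfl fun s hs => ?_
    rcases n with _ | n
    · simp at hs
    rw [smul_smul, Nat.add_sub_cancel]
    push_cast
    rw [succ_choose_mul]
  rw [← h, Finset.smul_sum, ← Finset.sum_add_distrib]
  refine Finset.sum_congr rfl fun s _ => ?_
  push_cast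
  module

theorem AssocAt.D_mid {a b c : C} (h : AssocAt k a b c) : AssocAt k a (D (k := k) b) c := by
  intro n m
  have h1 : ∀ s ∈ Finset.range (n + 1), (n.choose s : k) •
      nprod (k := k) (m + s) (nprod (k := k) (n - s) a (D (k := k) b)) c =
      (n.choose s : k) • ((n - s : ℕ) : k) •
        nprod (k := k) (m + s) (nprod (k := k) (n - s - 1) a b) c -
      ((n.choose s : k) * ((m + s : ℕ) : k)) •
        nprod (k := k) (m + s - 1) (nprod (k := k) (n - s) a b) c := by
    intro s _
    rw [nprod_D_right, map_add, LinearMap.add_apply, nprod_D_left, map_smul,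
      LinearMap.smul_apply]
    module
  rw [Finset.sum_congr rfl h1, Finset.sum_sub_distrib, sum_choose_mul_shift, nprod_D_left,
    map_neg, map_smul]
  have h2 : ∑ s ∈ Finset.range (n + 1), (n.choose s : k) • ((n - s : ℕ) : k) •
        nprod (k := k) (m + s) (nprod (k := k) (n - s - 1) a b) c =
      (n : k) • ∑ s ∈ Finset.range n, ((n - 1).choose s : k) •
        nprod (k := k) (m + (s + 1) - 1) (nprod (k := k) (n - (s + 1)) a b) c := by
    rw [Finset.sum_range_succ, Nat.sub_self, Nat.cast_zero, zero_smul, smul_zero, add_zero,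
      Finset.smul_sum]
    refine Finset.sum_congr rfl fun s hs => ?_
    rcases n with _ | n
    · simp at hs
    have hs' : s ≤ n := by simpa [Nat.lt_succ_iff] using hs
    rw [smul_smul, succ_choose_mul_sub hs', smul_smul, Nat.add_sub_cancel,
      show m + (s + 1) - 1 = m + s by omega, show n + 1 - s - 1 = n + 1 - (s + 1) by omega]
    push_cast
    rfl
  rw [h2, sub_add_eq_sub_sub, sub_right_comm, sub_self, zero_sub]
  rcases m with _ | m
  · simp
  · rw [h, Nat.add_sub_cancel]
    congr 2
    refine Finset.sum_congr rfl fun s _ => ?_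
    rw [show m + 1 + s - 1 = m + s by omega]

theorem AssocAt.D_right {a b c : C} (h : AssocAt k a b c) : AssocAt k a b (D (k := k) c) := by
  intro n m
  have h1 : ∀ s ∈ Finset.range (n + 1), (n.choose s : k) •
      nprod (k := k) (m + s) (nprod (k := k) (n - s) a b) (D (k := k) c) =
      D (k := k) ((n.choose s : k) • nprod (k := k) (m + s) (nprod (k := k) (n - s) a b) c) +
      ((n.choose s : k) * ((m + s : ℕ) : k)) •
        nprod (k := k) (m + s - 1) (nprod (k := k) (n - s) a b) c := by
    intro s _
    rw [nprod_D_right, map_smul]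
    module
  rw [Finset.sum_congr rfl h1, Finset.sum_add_distrib, ← map_sum, ← h, sum_choose_mul_shift,
    nprod_D_right, map_add, nprod_D_right, map_smul, add_assoc,
    add_comm ((n : k) • nprod (k := k) (n - 1) a (nprod (k := k) m b c))]
  congr 2
  · rcases m with _ | m
    · simp
    · rw [h, Nat.add_sub_cancel]
      congr 1
      refine Finset.sum_congr rfl fun s _ => ?_
      rw [show m + 1 + s - 1 = m + s by omega]
  · rcases n with _ | n
    · simp
    · rw [h, Nat.add_sub_cancel]
      congr 1
      refine Finset.sum_congr rfl fun s _ => ?_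
      rw [show m + (s + 1) - 1 = m + s by omega, show n + 1 - (s + 1) = n - s by omega]

end General

end ConformalAlgebra

/-! ### Left and right multiplications in associative conformal algebras. -/

namespace ConformalAlgebra

section Associative

variable {k : Type*} {C : Type*} [Field k] [AddCommGroup C] [Module k C] [ConformalAlgebra k C]

/-- On sequences indexed by `n`, replacing `y` by `∂ y` applies the sum of two commuting operators:
`∂` itself (`Δ`) and the weighted shift `E`. The formula is the binomial theorem for `E + Δ`; powers
of `E` produce the falling factorials. -/
theorem nprod_D_pow_right (n s : ℕ) (a y : C) :
    nprod (k := k) n a (((D (k := k)) ^ s) y) = ∑ t ∈ Finset.range (s + 1),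
      ((s.choose t : k) * (n.descFactorial t : k)) •
        ((D (k := k)) ^ (s - t)) (nprod (k := k) (n - t) a y) := by
  let E : Module.End k (ℕ → C) :=
    { toFun := fun f n => (n : k) • f (n - 1)
      map_add' := fun f g => by ext; simp
      map_smul' := fun c f => by ext; simp [smul_comm c] }
  let Δ : Module.End k (ℕ → C) :=
    { toFun := fun f n => D (k := k) (f n)
      map_add' := fun f g => by ext; simp
      map_smul' := fun c f => by ext; simp }
  have hc : Commute E Δ := by ext f n; simp [E, Δ]
  have hE : ∀ (t : ℕ) (f : ℕ → C) (n : ℕ), (E ^ t) f n = (n.descFactorial t : k) • f (n - t) := by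
    intro t
    induction t with
    | zero => simp
    | succ t ih =>
      intro f n
      rw [pow_succ, Module.End.mul_apply, ih]
      simp only [E, LinearMap.coe_mk, AddHom.coe_mk, smul_smul, Nat.descFactorial_succ]
      rw [Nat.sub_sub]
      push_cast
      rw [mul_comm]
  have hΔ : ∀ (t : ℕ) (f : ℕ → C) (n : ℕ), (Δ ^ t) f n = ((D (k := k)) ^ t) (f n) := by
    intro t
    induction t with
    | zero => simp
    | succ t ih =>
      intro f n
      rw [pow_succ, Module.End.mul_apply, ih, pow_succ, Module.End.mul_apply]
      rfl
  have h : ∀ s : ℕ, (fun n => nprod (k := k) n a (((D (k := k)) ^ s) y)) =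
      ((E + Δ) ^ s) (fun n => nprod (k := k) n a y) := by
    intro s
    induction s with
    | zero => simp
    | succ s ih =>
      rw [pow_succ' (E + Δ), Module.End.mul_apply, ← ih]
      ext n
      rw [pow_succ' (D (k := k)), Module.End.mul_apply, nprod_D_right]
      simp [E, Δ, add_comm]
  have h2 := congrFun (h s) n
  rw [h2, hc.add_pow, LinearMap.sum_apply, Finset.sum_apply]
  refine Finset.sum_congr rfl fun t _ => ?_
  rw [← nsmul_eq_mul', LinearMap.smul_apply, Pi.smul_apply, Module.End.mul_apply, hE, hΔ,
    mul_smul, ← Nat.cast_smul_eq_nsmul k]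

variable (hC : IsAssociative k C)
include hC

/-- Binomial inversion of associativity: substituted into the right-hand side, the terms with total
shift `r` carry the factor `∑ (-1)^t * choose r t`, which vanishes unless `r = 0`. -/
theorem nprod_nprod_left (n m : ℕ) (a b c : C) :
    nprod (k := k) m (nprod (k := k) n a b) c = ∑ t ∈ Finset.range (n + 1),
      ((-1) ^ t * (n.choose t : k)) •
        nprod (k := k) (n - t) a (nprod (k := k) (m + t) b c) := by
  have h1 : ∀ t ∈ Finset.range (n + 1), ((-1) ^ t * (n.choose t : k)) •
        nprod (k := k) (n - t) a (nprod (k := k) (m + t) b c) =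
      ∑ s ∈ Finset.range (n + 1 - t), (fun t s =>
        ((-1) ^ t * (n.choose t : k) * ((n - t).choose s : k)) •
        nprod (k := k) (m + t + s) (nprod (k := k) (n - t - s) a b) c) t s := by
    intro t ht
    have ht' : t ≤ n := by simpa [Nat.lt_succ_iff] using ht
    rw [hC, Finset.smul_sum, show n - t + 1 = n + 1 - t by omega]
    simp only [smul_smul]
  rw [Finset.sum_congr rfl h1, ← Finset.sum_range_diag_flip, Finset.sum_range_succ',
    Finset.sum_eq_zero]
  · simp
  intro r hr
  have hr' : r + 1 ≤ n := by simp at hr; omega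
  have h2 : ∀ t ∈ Finset.range (r + 1 + 1), ((-1) ^ t * (n.choose t : k) *
      ((n - t).choose (r + 1 - t) : k)) • nprod (k := k) (m + t + (r + 1 - t))
        (nprod (k := k) (n - t - (r + 1 - t)) a b) c =
      ((n.choose (r + 1) : k) * ((-1) ^ t * ((r + 1).choose t : k))) •
        nprod (k := k) (m + (r + 1)) (nprod (k := k) (n - (r + 1)) a b) c := by
    intro t ht
    have ht' : t ≤ r + 1 := by simp at ht; omega
    have h3 := congrArg (Nat.cast (R := k)) (Nat.choose_mul (n := n) ht')
    push_cast at h3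
    rw [show m + t + (r + 1 - t) = m + (r + 1) by omega,
      show n - t - (r + 1 - t) = n - (r + 1) by omega, mul_assoc, ← h3]
    congr 1
    ring
  rw [Finset.sum_congr rfl h2, ← Finset.sum_smul, ← Finset.mul_sum]
  have h4 := congrArg (Int.cast (R := k)) (Int.alternating_sum_range_choose (n := r + 1))
  push_cast at h4
  rw [h4]
  simp

/-- Left and right multiplications commute; this is the rule for `R L`. Both sides expand into the
same double sum of `G t r`, where `t` is the amount by which the index of `a` drops and `r` the
power of `∂`. -/
theorem rev_nprod [CharZero k] (n m : ℕ) (a v u : C) :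
    rev k m v (nprod (k := k) n a u) = nprod (k := k) n a (rev k m v u) := by
  obtain ⟨N, hN⟩ := locality (k := k) u v
  let G : ℕ → ℕ → C := fun t r => ((-1) ^ (m + r + t) * (n.choose t : k) / (r.factorial : k)) •
    ((D (k := k)) ^ r) (nprod (k := k) (n - t) a (nprod (k := k) (m + r + t) u v))
  have hG1 : ∀ t r, N ≤ t + r → G t r = 0 := fun t r h => by
    simp [G, hN (m + r + t) (by omega)]
  have hG2 : ∀ t r, n < t → G t r = 0 := fun t r h => by
    simp [G, Nat.choose_eq_zero_of_lt h]
  have h1 : ∀ s, (((-1) ^ (m + s) / (Nat.factorial s : k)) •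
      ((D (k := k)) ^ s) (nprod (k := k) (m + s) (nprod (k := k) n a u) v)) =
      ∑ t ∈ Finset.range (n + 1), G t s := by
    intro s
    rw [nprod_nprod_left hC, map_sum, Finset.smul_sum]
    refine Finset.sum_congr rfl fun t _ => ?_
    rw [map_smul, smul_smul]
    congr 1
    ring
  have h2 : ∀ s, ((-1) ^ (m + s) / (Nat.factorial s : k)) • nprod (k := k) n a
      (((D (k := k)) ^ s) (nprod (k := k) (m + s) u v)) =
      ∑ t ∈ Finset.range (s + 1), G t (s - t) := by
    intro s
    rw [nprod_D_pow_right, Finset.smul_sum]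
    refine Finset.sum_congr rfl fun t ht => ?_
    have ht' : t ≤ s := by simpa [Nat.lt_succ_iff] using ht
    have hs : (s.factorial : k) ≠ 0 := Nat.cast_ne_zero.2 s.factorial_ne_zero
    have hst : ((s - t).factorial : k) ≠ 0 := Nat.cast_ne_zero.2 (s - t).factorial_ne_zero
    have h3 := congrArg (Nat.cast (R := k)) (Nat.choose_mul_factorial_mul_factorial ht')
    -- The coefficients match since `choose s t * descFactorial n t / s! = choose n t / (s - t)!`.
    have h4 := congrArg (Nat.cast (R := k)) (Nat.descFactorial_eq_factorial_mul_choose n t)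
    push_cast at h3 h4
    simp only [G, smul_smul]
    rw [show m + (s - t) + t = m + s by omega, h4]
    congr 1
    field_simp
    rw [← h3]
    ring
  rw [rev_eq_sum (N := N) (x := u), rev_eq_sum (N := N), map_sum]
  rotate_left
  · intro j hj
    rw [nprod_nprod_left hC]
    refine Finset.sum_eq_zero fun t _ => ?_
    rw [hN (j + t) (by omega)]
    simp
  · intro j hj; exact hN j (by omega)
  simp only [map_smul]
  rw [Finset.sum_congr rfl fun s _ => h1 s, Finset.sum_congr rfl fun s _ => h2 s,
    Finset.sum_range_diag_flip, Finset.sum_comm]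
  have h5 : ∀ t ∈ Finset.range N, ∑ r ∈ Finset.range (N - t), G t r =
      ∑ r ∈ Finset.range N, G t r := by
    intro t _
    refine Finset.sum_subset (by simp) fun r _ hr => hG1 t r ?_
    simp at hr; omega
  rw [Finset.sum_congr rfl h5]
  trans ∑ t ∈ Finset.range (max (n + 1) N), ∑ r ∈ Finset.range N, G t r
  · refine Finset.sum_subset (by simp) fun t _ ht => Finset.sum_eq_zero fun r _ => hG2 t r ?_
    simp at ht; omega
  · refine (Finset.sum_subset (by simp) fun t _ ht => Finset.sum_eq_zero fun r _ => hG1 t r ?_).symm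
    simp at ht; omega

end Associative

end ConformalAlgebra

/-! ### Elements killed by the derivation. -/

namespace ConformalAlgebra

section Torsion

variable {k : Type*} {C : Type*} [Field k] [CharZero k] [AddCommGroup C] [Module k C]
  [ConformalAlgebra k C]

theorem nprod_torsion_left {x : C} (hx : D (k := k) x = 0) (n : ℕ) (y : C) :
    nprod (k := k) n x y = 0 := by
  have h := nprod_D_left (k := k) (n + 1) x y
  rw [hx, map_zero, LinearMap.zero_apply, eq_comm, neg_eq_zero, smul_eq_zero] at h
  exact h.resolve_left (Nat.cast_ne_zero.2 n.succ_ne_zero)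

/-- Sesquilinearity determines the `n`-th product from the `(n+1)`-st, up to division by `n + 1`;
descend from the index given by locality. -/
theorem nprod_torsion_right {x : C} (hx : D (k := k) x = 0) (n : ℕ) (y : C) :
    nprod (k := k) n y x = 0 := by
  obtain ⟨N, hN⟩ := locality (k := k) y x
  have key : ∀ j n, N ≤ n + j → nprod (k := k) n y x = 0 := by
    intro j
    induction j with
    | zero => exact hN
    | succ j ih =>
      intro n hn
      have h := nprod_D_right (k := k) (n + 1) y x
      rw [hx, map_zero, ih (n + 1) (by omega), map_zero, zero_add, eq_comm, smul_eq_zero] at h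
      exact h.resolve_left (Nat.cast_ne_zero.2 n.succ_ne_zero)
  exact key N n (by omega)

theorem rev_torsion_left {x : C} (hx : D (k := k) x = 0) (n : ℕ) (v : C) : rev k n v x = 0 :=
  rev_eq_zero fun j _ => nprod_torsion_left hx j v

end Torsion

end ConformalAlgebra

/-! ### Identities valid in every envelope of `K(g)` with locality `2`. -/

namespace KacMoody

open ConformalAlgebra

variable {k : Type u} {g : Type v} {ι : Type w} [Field k] [LieRing g] [LieAlgebra k g]
  {b : Module.Basis ι k g} {Φ : LinearMap.BilinForm k g}
  {U : Type*} [AddCommGroup U] [Module k U] [ConformalAlgebra k U] {τ : KacMoody Φ →ₗ[k] U}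

theorem nprod_zero_dmon (y z : g) :
    nprod (k := k) 0 (dmon Φ 0 y) (dmon Φ 0 z) = dmon Φ 0 ⁅y, z⁆ := by
  change bracket Φ 0 _ _ = _
  simp [bracket_dmon, monBracket]

theorem nprod_one_dmon (y z : g) :
    nprod (k := k) 1 (dmon Φ 0 y) (dmon Φ 0 z) = Φ y z • e Φ := by
  change bracket Φ 1 _ _ = _
  simp [bracket_dmon, monBracket]

theorem nprod_dmon_of_two_le {n : ℕ} (hn : 2 ≤ n) (y z : g) :
    nprod (k := k) n (dmon Φ 0 y) (dmon Φ 0 z) = 0 := by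
  change bracket Φ n _ _ = _
  have h : n ≠ 1 := by omega
  have h' : Nat.choose 0 n = 0 := Nat.choose_eq_zero_of_lt (by omega)
  simp [bracket_dmon, monBracket, h, h']

variable (hτ : IsEnvelopeMap k (Set.range (gen Φ b)) 2 τ)
include hτ

theorem D_e_eq_zero : D (k := k) (τ (e Φ)) = 0 := by
  rw [← hτ.2.1]
  change τ (der Φ (e Φ)) = 0
  rw [der_e, map_zero]

theorem nprod_eq_zero {n : ℕ} (hn : 2 ≤ n) (y z : g) :
    nprod (k := k) n (τ (dmon Φ 0 y)) (τ (dmon Φ 0 z)) = 0 := by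
  suffices h : (nprod (k := k) n).compl₁₂ (τ ∘ₗ dmon Φ 0) (τ ∘ₗ dmon Φ 0) = 0 from
    LinearMap.congr_fun₂ h y z
  refine b.ext fun i => b.ext fun j => ?_
  exact hτ.2.2.2 _ ⟨(i : WithBot ι), rfl⟩ _ ⟨(j : WithBot ι), rfl⟩ n hn

theorem rev_dmon_of_two_le {n : ℕ} (hn : 2 ≤ n) (y z : g) :
    rev k n (τ (dmon Φ 0 y)) (τ (dmon Φ 0 z)) = 0 :=
  rev_eq_zero fun _ hj => nprod_eq_zero hτ (hn.trans hj) z y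

theorem rev_one_dmon (y z : g) : rev k 1 (τ (dmon Φ 0 y)) (τ (dmon Φ 0 z)) =
    nprod (k := k) 1 (τ (dmon Φ 0 y)) (τ (dmon Φ 0 z)) - Φ y z • τ (e Φ) := by
  have h := hτ.2.2.1 1 (dmon Φ 0 y) (dmon Φ 0 z)
  rw [nprod_one_dmon, map_smul] at h
  rw [h, ConformalAlgebra.comm, sub_sub_cancel]

theorem rev_zero_dmon (y z : g) : rev k 0 (τ (dmon Φ 0 y)) (τ (dmon Φ 0 z)) =
    nprod (k := k) 0 (τ (dmon Φ 0 y)) (τ (dmon Φ 0 z)) - τ (dmon Φ 0 ⁅y, z⁆) := by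
  have h := hτ.2.2.1 0 (dmon Φ 0 y) (dmon Φ 0 z)
  rw [nprod_zero_dmon] at h
  rw [h, ConformalAlgebra.comm, sub_sub_cancel]

/-- By locality the opposite first product has the single term `-z ₍₁₎ y`; compare with `[y ₍₁₎ z] =
⟨y|z⟩ e`. -/
theorem nprod_one_swap (y z : g) : nprod (k := k) 1 (τ (dmon Φ 0 y)) (τ (dmon Φ 0 z)) =
    -nprod (k := k) 1 (τ (dmon Φ 0 z)) (τ (dmon Φ 0 y)) + Φ y z • τ (e Φ) := by
  have h : rev k 1 (τ (dmon Φ 0 y)) (τ (dmon Φ 0 z)) =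
      -nprod (k := k) 1 (τ (dmon Φ 0 z)) (τ (dmon Φ 0 y)) := by
    rw [rev_eq_sum (N := 1) fun j hj => nprod_eq_zero hτ hj z y]
    simp
  rw [← h, rev_one_dmon hτ, sub_add_cancel]

/-- By locality the opposite zeroth product is `y ₍₀₎ z - ∂ (y ₍₁₎ z)`; compare with `[z ₍₀₎ y] =
[z, y]`. -/
theorem D_nprod_one (y z : g) :
    D (k := k) (nprod (k := k) 1 (τ (dmon Φ 0 y)) (τ (dmon Φ 0 z))) =
      nprod (k := k) 0 (τ (dmon Φ 0 y)) (τ (dmon Φ 0 z)) -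
        nprod (k := k) 0 (τ (dmon Φ 0 z)) (τ (dmon Φ 0 y)) - τ (dmon Φ 0 ⁅y, z⁆) := by
  have h : rev k 0 (τ (dmon Φ 0 z)) (τ (dmon Φ 0 y)) =
      nprod (k := k) 0 (τ (dmon Φ 0 y)) (τ (dmon Φ 0 z)) -
        D (k := k) (nprod (k := k) 1 (τ (dmon Φ 0 y)) (τ (dmon Φ 0 z))) := by
    rw [rev_eq_sum (N := 2) fun j hj => nprod_eq_zero hτ (by omega) y z]
    simp [Finset.sum_range_succ, sub_eq_add_neg]
  rw [rev_zero_dmon hτ, ← lie_skew, map_neg, map_neg] at h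
  rw [eq_sub_iff_add_eq, add_comm, ← eq_sub_iff_add_eq, sub_neg_eq_add] at h
  rw [h, sub_add_eq_sub_sub]

variable [CharZero k]

theorem nprod_comm (n m : ℕ) (y z : g) (x : U) :
    nprod (k := k) n (τ (dmon Φ 0 y)) (nprod (k := k) m (τ (dmon Φ 0 z)) x) =
      nprod (k := k) m (τ (dmon Φ 0 z)) (nprod (k := k) n (τ (dmon Φ 0 y)) x) +
        nprod (k := k) (n + m) (τ (dmon Φ 0 ⁅y, z⁆)) x := by
  -- Locality leaves two terms of the associativity sum, with `y ₍₀₎ z` and `y ₍₁₎ z`. In the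
  -- commutator the first products combine by skew symmetry (`e` acts by zero) into the action of `∂
  -- (y ₍₁₎ z)`, which leaves only `[y, z]`.
  have expand : ∀ (n m : ℕ) (y z : g),
      nprod (k := k) n (τ (dmon Φ 0 y)) (nprod (k := k) m (τ (dmon Φ 0 z)) x) =
      nprod (k := k) (n + m) (nprod (k := k) 0 (τ (dmon Φ 0 y)) (τ (dmon Φ 0 z))) x +
      (n : k) • nprod (k := k) (n + m - 1)
        (nprod (k := k) 1 (τ (dmon Φ 0 y)) (τ (dmon Φ 0 z))) x := by
    intro n m y z
    rw [hτ.1, Finset.sum_range_succ, Nat.sub_self, Nat.choose_self, Nat.cast_one, one_smul,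
      add_comm n m, add_comm]
    congr 1
    rcases n with _ | n
    · simp
    rw [Finset.sum_range_succ, Finset.sum_eq_zero]
    · simp [show m + (n + 1) - 1 = m + n by omega]
    · intro s hs
      rw [nprod_eq_zero hτ (by simp at hs; omega)]
      simp
  have hD := congrArg (fun u => nprod (k := k) (n + m) u x) (D_nprod_one hτ y z)
  simp only [nprod_D_left, map_sub, LinearMap.sub_apply] at hD
  have hs := congrArg (fun u => nprod (k := k) (n + m - 1) u x) (nprod_one_swap hτ z y)
  simp only [map_add, map_neg, map_smul, LinearMap.add_apply, LinearMap.neg_apply,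
    LinearMap.smul_apply, nprod_torsion_left (D_e_eq_zero hτ), smul_zero, add_zero] at hs
  rw [expand, expand, add_comm m n, hs]
  push_cast at hD
  rw [eq_sub_iff_add_eq, eq_sub_iff_add_eq] at hD
  rw [← hD]
  module

theorem nprod_one_D_pow {s : ℕ} (hs : 1 ≤ s) (y z : g) :
    nprod (k := k) 1 (τ (dmon Φ 0 y)) (((D (k := k)) ^ s) (τ (dmon Φ 0 z))) =
      ((s : k) + 1) • nprod (k := k) 0 (τ (dmon Φ 0 y))
          (((D (k := k)) ^ (s - 1)) (τ (dmon Φ 0 z))) -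
        nprod (k := k) 0 (τ (dmon Φ 0 z)) (((D (k := k)) ^ (s - 1)) (τ (dmon Φ 0 y))) -
        ((D (k := k)) ^ (s - 1)) (τ (dmon Φ 0 ⁅y, z⁆)) := by
  obtain ⟨s, rfl⟩ : ∃ t, s = t + 1 := ⟨s - 1, by omega⟩
  have h0 : ∀ (s : ℕ) (y z : U), nprod (k := k) 0 y (((D (k := k)) ^ s) z) =
      ((D (k := k)) ^ s) (nprod (k := k) 0 y z) := by
    intro s y z
    rw [nprod_D_pow_right, Finset.sum_range_succ', Finset.sum_eq_zero]
    · simp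
    · intro t _
      simp
  rw [nprod_D_pow_right, Finset.sum_range_succ', Finset.sum_range_succ', Finset.sum_eq_zero]
  · simp only [Nat.add_sub_cancel, h0, zero_add, Nat.choose_one_right, Nat.descFactorial_one,
      Nat.cast_one, mul_one, Nat.sub_self, Nat.choose_zero_right, Nat.descFactorial_zero,
      one_smul, Nat.sub_zero]
    rw [pow_succ (D (k := k)) s, Module.End.mul_apply, D_nprod_one hτ, map_sub, map_sub]
    push_cast
    module
  · intro t _
    simp

/-- The expression is symmetric in `x, y`, because `[x, y] ₍₂₎ z = 0`, and skew in `y, z`, because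
products with `e` vanish. A function with both symmetries is zero in characteristic `0`. -/
theorem nprod_one_nprod_one (x y z : g) : nprod (k := k) 1 (τ (dmon Φ 0 x))
    (nprod (k := k) 1 (τ (dmon Φ 0 y)) (τ (dmon Φ 0 z))) = 0 := by
  have h1 : ∀ x y z : g, nprod (k := k) 1 (τ (dmon Φ 0 x))
      (nprod (k := k) 1 (τ (dmon Φ 0 y)) (τ (dmon Φ 0 z))) = nprod (k := k) 1 (τ (dmon Φ 0 y))
      (nprod (k := k) 1 (τ (dmon Φ 0 x)) (τ (dmon Φ 0 z))) := by
    intro x y z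
    rw [nprod_comm hτ, nprod_eq_zero hτ le_rfl ⁅x, y⁆, add_zero]
  have h2 : ∀ x y z : g, nprod (k := k) 1 (τ (dmon Φ 0 x))
      (nprod (k := k) 1 (τ (dmon Φ 0 y)) (τ (dmon Φ 0 z))) = -nprod (k := k) 1 (τ (dmon Φ 0 x))
      (nprod (k := k) 1 (τ (dmon Φ 0 z)) (τ (dmon Φ 0 y))) := by
    intro x y z
    rw [nprod_one_swap hτ, map_add, map_neg, map_smul, nprod_torsion_right (D_e_eq_zero hτ),
      smul_zero, add_zero]
  have h3 : nprod (k := k) 1 (τ (dmon Φ 0 x))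
      (nprod (k := k) 1 (τ (dmon Φ 0 y)) (τ (dmon Φ 0 z))) = -nprod (k := k) 1 (τ (dmon Φ 0 x))
      (nprod (k := k) 1 (τ (dmon Φ 0 y)) (τ (dmon Φ 0 z))) := by
    -- The product of the two transpositions has order three, and three sign changes leave a minus
    -- sign.
    conv_lhs => rw [h1, h2, h1, h2, h1, h2, neg_neg]
  rw [eq_neg_iff_add_eq_zero, ← two_smul k] at h3
  exact (smul_eq_zero.1 h3).resolve_left two_ne_zero

/-- Obtained by applying `∂` to `x ₍₁₎ (y ₍₁₎ z) = 0`: the Leibniz rule leaves `x ₍₁₎ ∂ (y ₍₁₎ z) =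
x ₍₀₎ (y ₍₁₎ z)`, and `∂ (y ₍₁₎ z)` is known. -/
theorem nprod_zero_nprod_one (x y z : g) : nprod (k := k) 0 (τ (dmon Φ 0 x))
    (nprod (k := k) 1 (τ (dmon Φ 0 y)) (τ (dmon Φ 0 z))) =
      nprod (k := k) 0 (τ (dmon Φ 0 y)) (nprod (k := k) 1 (τ (dmon Φ 0 x)) (τ (dmon Φ 0 z))) +
      nprod (k := k) 1 (τ (dmon Φ 0 ⁅x, y⁆)) (τ (dmon Φ 0 z)) -
      nprod (k := k) 0 (τ (dmon Φ 0 z)) (nprod (k := k) 1 (τ (dmon Φ 0 x)) (τ (dmon Φ 0 y))) -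
      nprod (k := k) 1 (τ (dmon Φ 0 ⁅x, z⁆)) (τ (dmon Φ 0 y)) -
      nprod (k := k) 1 (τ (dmon Φ 0 x)) (τ (dmon Φ 0 ⁅y, z⁆)) := by
  have h := nprod_D_right (k := k) 1 (τ (dmon Φ 0 x))
    (nprod (k := k) 1 (τ (dmon Φ 0 y)) (τ (dmon Φ 0 z)))
  rw [nprod_one_nprod_one hτ, map_zero, zero_add, Nat.cast_one, one_smul, Nat.sub_self,
    D_nprod_one hτ, map_sub, map_sub, nprod_comm hτ, nprod_comm hτ 1 0 x z] at h
  rw [← h]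
  abel

end KacMoody

/-! ### Rewriting: reduction to normal monomials and the diamond lemma. -/

/-- A failure of transitivity is a cycle of length at most three, which has no minimal element. -/
theorem WellFounded.trans_of_trichotomous {α : Type*} {r : α → α → Prop} (hr : WellFounded r)
    (ht : ∀ a b, r a b ∨ a = b ∨ r b a) {a b c : α} (hab : r a b) (hbc : r b c) : r a c := by
  rcases ht a c with h | rfl | h
  · exact h
  · exact (hr.asymmetric _ _ hab hbc).elim
  · obtain ⟨x, hx, hmin⟩ := hr.has_min {a, b, c} ⟨a, by simp⟩
    rcases hx with rfl | rfl | rfl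
    · exact (hmin c (by simp) h).elim
    · exact (hmin a (by simp) hab).elim
    · exact (hmin b (by simp) hbc).elim

theorem Finset.exists_max_of_trichotomous {α : Type*} {r : α → α → Prop} (hr : WellFounded r)
    (ht : ∀ a b, r a b ∨ a = b ∨ r b a) {s : Finset α} (hs : s.Nonempty) :
    ∃ m ∈ s, ∀ x ∈ s, x = m ∨ r x m := by
  induction hs using Finset.Nonempty.cons_induction with
  | singleton a => exact ⟨a, by simp, by simp⟩
  | cons a s ha hs ih =>
    obtain ⟨m, hm, hmax⟩ := ih
    rcases ht a m with h | h | h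
    · refine ⟨m, by simp [hm], fun x hx => ?_⟩
      rcases Finset.mem_cons.1 hx with rfl | hx
      · exact Or.inr h
      · exact hmax x hx
    · refine ⟨m, by simp [hm], fun x hx => ?_⟩
      rcases Finset.mem_cons.1 hx with rfl | hx
      · exact Or.inl h
      · exact hmax x hx
    · refine ⟨a, by simp, fun x hx => ?_⟩
      rcases Finset.mem_cons.1 hx with rfl | hx
      · exact Or.inl rfl
      · rcases hmax x hx with rfl | hx
        · exact Or.inr h
        · exact Or.inr (hr.trans_of_trichotomous ht hx h)

namespace RewritingRules

variable {k B X : Type*} [Field k] (S : RewritingRules k B X)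

/-- A monomial is normal if no rule applies to it. -/
def Normal (m : List B × X) : Prop := ∀ r, ¬ S.Rewrites m r

/-- The span of all differences of the two sides of a rewriting. -/
noncomputable def relations : Submodule k (List B × X →₀ k) :=
  Submodule.span k {f | ∃ m r, S.Rewrites m r ∧ f = Finsupp.single m 1 - r}

variable {S}

theorem single_sub_mem_relations {m : List B × X} {r : List B × X →₀ k} (h : S.Rewrites m r) :
    Finsupp.single m 1 - r ∈ S.relations :=
  Submodule.subset_span ⟨m, r, h, rfl⟩

theorem sub_mem_relations_of_step {f f' : List B × X →₀ k} (h : S.Step f f') :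
    f - f' ∈ S.relations := by
  obtain ⟨m, r, hr, -, rfl⟩ := h
  rw [sub_sub_cancel]
  exact Submodule.smul_mem _ _ (single_sub_mem_relations hr)

theorem sub_mem_relations_of_steps {f f' : List B × X →₀ k}
    (h : Relation.ReflTransGen S.Step f f') : f - f' ∈ S.relations := by
  induction h with
  | refl => simp
  | tail _ h ih => simpa using add_mem ih (sub_mem_relations_of_step h)

variable {lt : List B × X → List B × X → Prop}

/-- Every element of the free module can be rewritten to a combination of normal monomials. -/
theorem exists_steps_normal (wf : WellFounded lt) (ht : ∀ a b, lt a b ∨ a = b ∨ lt b a)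
    (leading : ∀ m r, S.Rewrites m r → ∀ m' ∈ r.support, lt m' m) (f : List B × X →₀ k) :
    ∃ f', Relation.ReflTransGen S.Step f f' ∧ ∀ m ∈ f'.support, S.Normal m := by
  classical
  -- Well-founded induction on a bound `m` for the non-normal monomials of `f`. If `m` itself occurs
  -- and is not normal, one step removes it and introduces only smaller monomials.
  have key : ∀ (m : List B × X) (f : List B × X →₀ k),
      (∀ m' ∈ f.support, ¬ S.Normal m' → m' = m ∨ lt m' m) →
      ∃ f', Relation.ReflTransGen S.Step f f' ∧ ∀ m ∈ f'.support, S.Normal m := by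
    intro m
    induction m using wf.induction with
    | _ m ih =>
    intro f hf
    have below : ∀ f₁ : List B × X →₀ k, (∀ m' ∈ f₁.support, ¬ S.Normal m' → lt m' m) →
        ∃ f', Relation.ReflTransGen S.Step f₁ f' ∧ ∀ m ∈ f'.support, S.Normal m := by
      intro f₁ hf₁
      by_cases hne : (f₁.support.filter fun m' => ¬ S.Normal m').Nonempty
      · obtain ⟨m₁, hm₁, hmax⟩ := Finset.exists_max_of_trichotomous wf ht hne
        rw [Finset.mem_filter] at hm₁
        exact ih m₁ (hf₁ m₁ hm₁.1 hm₁.2) f₁ fun m' hm' hn =>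
          hmax m' (Finset.mem_filter.2 ⟨hm', hn⟩)
      · refine ⟨f₁, .refl, fun m' hm' => ?_⟩
        by_contra hn
        exact hne ⟨m', Finset.mem_filter.2 ⟨hm', hn⟩⟩
    by_cases hm : m ∈ f.support ∧ ¬ S.Normal m
    · obtain ⟨hm, hn⟩ := hm
      simp only [Normal, not_forall, not_not] at hn
      obtain ⟨r, hr⟩ := hn
      have hrm : r m = 0 := by
        by_contra h
        exact wf.irrefl.irrefl _ (leading m r hr m (Finsupp.mem_support_iff.2 h))
      obtain ⟨f', h1, h2⟩ := below (f - f m • (Finsupp.single m 1 - r)) (by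
        intro m' hm' hn'
        have hne : m' ≠ m := by
          rintro rfl
          simp [hrm] at hm'
        by_cases hr' : m' ∈ r.support
        · exact leading m r hr m' hr'
        · refine (hf m' ?_ hn').resolve_left hne
          simpa [Finsupp.notMem_support_iff.1 hr', Finsupp.single_eq_of_ne hne] using hm')
      exact ⟨f', .head ⟨m, r, hr, Finsupp.mem_support_iff.1 hm, rfl⟩ h1, h2⟩
    · refine below f fun m' hm' hn => (hf m' hm' hn).resolve_left ?_
      rintro rfl
      exact hm ⟨hm', hn⟩
  by_cases hne : f.support.Nonempty
  · obtain ⟨m, -, hmax⟩ := Finset.exists_max_of_trichotomous wf ht hne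
    exact key m f fun m' hm' _ => hmax m' hm'
  · rw [Finset.not_nonempty_iff_eq_empty, Finsupp.support_eq_empty] at hne
    exact ⟨f, .refl, by simp [hne]⟩

theorem eval_single {M : Type*} [AddCommGroup M] [Module k M] (act : B → Module.End k M)
    (gen : X → M) (u : List B) (x : X) (c : k) :
    eval act gen (Finsupp.single (u, x) c) = c • u.foldr (fun b y => act b y) (gen x) := by
  simp [eval]

/-- A criterion for a Gröbner--Shirshov basis: the normal monomials can be recovered from their
images in the module. -/
theorem isGroebnerShirshovBasis_of_retraction {M : Type*} [AddCommGroup M] [Module k M]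
    {act : B → Module.End k M} {gen : X → M} (wf : WellFounded lt)
    (ht : ∀ a b, lt a b ∨ a = b ∨ lt b a)
    (leading : ∀ m r, S.Rewrites m r → ∀ m' ∈ r.support, lt m' m)
    (generates : LinearMap.range (eval act gen) = ⊤)
    (hker : ∀ m r, S.Rewrites m r → eval act gen (Finsupp.single m 1) = eval act gen r)
    (θ : M →ₗ[k] (List B × X →₀ k))
    (hθ : ∀ m, S.Normal m → θ (eval act gen (Finsupp.single m 1)) = Finsupp.single m 1) :
    S.IsGroebnerShirshovBasis lt act gen := by
  have hle : S.relations ≤ LinearMap.ker (eval act gen) := by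
    refine Submodule.span_le.2 ?_
    rintro _ ⟨m, r, h, rfl⟩
    simp [hker m r h]
  have hnormal : ∀ f : List B × X →₀ k, (∀ m ∈ f.support, S.Normal m) →
      θ (eval act gen f) = f := by
    intro f hf
    conv_lhs => rw [← Finsupp.sum_single f, Finsupp.sum, map_sum, map_sum]
    conv_rhs => rw [← Finsupp.sum_single f, Finsupp.sum]
    refine Finset.sum_congr rfl fun m hm => ?_
    rw [← mul_one (f m), ← smul_eq_mul, ← Finsupp.smul_single, map_smul, map_smul,
      hθ m (hf m hm)]
  refine ⟨wf, leading, generates, le_antisymm (fun f hf => ?_) hle, fun f g h hg hh => ?_⟩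
  -- An element of the kernel reduces to a normal element of the kernel, which `θ` shows to be zero;
  -- so it is a sum of relations.
  · obtain ⟨f', h1, h2⟩ := exists_steps_normal wf ht leading f
    have h3 := sub_mem_relations_of_steps h1
    have h4 : eval act gen f' = 0 := by
      have h5 := hle h3
      rw [LinearMap.mem_ker, map_sub, LinearMap.mem_ker.1 hf, zero_sub, neg_eq_zero] at h5
      exact h5
    have h5 := hnormal f' h2
    rw [h4, map_zero] at h5
    rwa [← h5, sub_zero] at h3
  · obtain ⟨g', hg1, hg2⟩ := exists_steps_normal wf ht leading g
    obtain ⟨h', hh1, hh2⟩ := exists_steps_normal wf ht leading h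
    refine ⟨g', hg1, ?_⟩
    have hmem : g' - h' ∈ S.relations := by
      have e1 := sub_mem_relations_of_steps (hg.trans hg1)
      have e2 := sub_mem_relations_of_steps (hh.trans hh1)
      simpa using sub_mem e2 e1
    have h0 := hle hmem
    rw [LinearMap.mem_ker, map_sub, sub_eq_zero] at h0
    -- Normal elements with equal images coincide, so any two complete reductions meet.
    have h1 : g' = h' := by rw [← hnormal g' hg2, ← hnormal h' hh2, h0]
    rwa [h1]

/-- The diamond lemma: if any two rewritings of a monomial agree modulo the rules applied to smaller
monomials, then the normal monomials are linearly independent modulo the rules. -/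
theorem exists_normalForm (wf : WellFounded lt)
    (leading : ∀ m r, S.Rewrites m r → ∀ m' ∈ r.support, lt m' m)
    (hloc : ∀ m r r', S.Rewrites m r → S.Rewrites m r' →
      ∀ E : (List B × X →₀ k) →ₗ[k] (List B × X →₀ k),
        (∀ m' r'', lt m' m → S.Rewrites m' r'' → E (Finsupp.single m' 1) = E r'') → E r = E r') :
    ∃ nf : (List B × X →₀ k) →ₗ[k] (List B × X →₀ k),
      (∀ m r, S.Rewrites m r → nf (Finsupp.single m 1) = nf r) ∧
      ∀ m, S.Normal m → nf (Finsupp.single m 1) = Finsupp.single m 1 := by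
  classical
  -- The normal form follows an arbitrarily chosen rewriting of each reducible monomial. That the
  -- choice does not matter is the hypothesis `hloc` applied to `nf` itself, by induction on the
  -- monomial.
  let nf₀ : List B × X → (List B × X →₀ k) := wf.fix fun m IH =>
    if h : ∃ r, S.Rewrites m r then
      ∑ m' ∈ h.choose.support.attach, h.choose m' • IH m' (leading m _ h.choose_spec m' m'.2)
    else Finsupp.single m 1
  let nf := Finsupp.linearCombination k nf₀
  have hsingle : ∀ m, nf (Finsupp.single m 1) = nf₀ m := fun m => by simp [nf]
  have hchoose : ∀ m (h : ∃ r, S.Rewrites m r), nf₀ m = nf h.choose := by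
    intro m h
    simp only [nf₀]
    rw [wf.fix_eq, dif_pos h, Finset.sum_attach h.choose.support
      fun m' => h.choose m' • nf₀ m']
    rfl
  refine ⟨nf, fun m => ?_, fun m hm => ?_⟩
  · induction m using wf.induction with
    | _ m ih =>
    intro r hr
    have h : ∃ r, S.Rewrites m r := ⟨r, hr⟩
    rw [hsingle, hchoose m h]
    exact hloc m _ _ h.choose_spec hr nf fun m' r'' hm' => ih m' hm' r''
  · rw [hsingle]
    simp only [nf₀]
    rw [wf.fix_eq, dif_neg]
    rintro ⟨r, hr⟩
    exact hm r hr

end RewritingRules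

namespace List

theorem Lex.append_append {α : Type*} {r : α → α → Prop} {s t : List α} (h : Lex r s t)
    (hl : s.length = t.length) (v : List α) : Lex r (s ++ v) (t ++ v) := by
  induction h with
  | nil => simp at hl
  | cons _ ih => exact .cons (ih (by simpa using hl))
  | rel h => exact .rel h

theorem Shortlex.append_append {α : Type*} {r : α → α → Prop} {s t : List α} (h : Shortlex r s t)
    (u v : List α) : Shortlex r (u ++ s ++ v) (u ++ t ++ v) := by
  rw [append_assoc, append_assoc]
  refine Shortlex.append_left ?_ u
  rcases shortlex_def.1 h with h | ⟨h1, h2⟩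
  · exact .of_length_lt (by simpa using h)
  · exact .of_lex (by simpa using h1) (h2.append_append h1 v)

theorem Shortlex.of_head {α : Type*} {r : α → α → Prop} {x y : α} {s t : List α} (h : r x y)
    (hl : s.length ≤ t.length) : Shortlex r (x :: s) (y :: t) := by
  rcases hl.lt_or_eq with hl | hl
  · exact .of_length_lt (by simpa using hl)
  · exact .of_lex (by simpa using hl) (.rel h)

end List

namespace RewritingRules

variable {k B X : Type*} [Field k] {S : RewritingRules k B X}

theorem mapDomain_mem_supported {α β : Type*} {f : α →₀ k} {s : Set α} {t : Set β} {φ : α → β}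
    (hf : f ∈ Finsupp.supported k k s) (h : ∀ a ∈ s, φ a ∈ t) :
    f.mapDomain φ ∈ Finsupp.supported k k t := by
  classical
  rw [Finsupp.mem_supported] at *
  intro y hy
  obtain ⟨x, hx, rfl⟩ := Finset.mem_image.1 (Finsupp.mapDomain_support hy)
  exact h x (hf hx)

/-- Rules that decrease the deg-lex order decrease it in every context. -/
theorem rewrites_leading {r : B → B → Prop} {s : X → X → Prop}
    (halg : ∀ w f, S.alg w f → f ∈ Finsupp.supported k k {w' | List.Shortlex r w' w})
    (hmod : ∀ m f, S.mod m f →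
      f ∈ Finsupp.supported k k {m' | Prod.Lex (List.Shortlex r) s m' m})
    (m : List B × X) (f : List B × X →₀ k) (h : S.Rewrites m f) :
    ∀ m' ∈ f.support, Prod.Lex (List.Shortlex r) s m' m := by
  suffices f ∈ Finsupp.supported k k {m' | Prod.Lex (List.Shortlex r) s m' m} from
    fun m' hm' => (Finsupp.mem_supported k f).1 this hm'
  cases h with
  | alg h u v x =>
    exact mapDomain_mem_supported (halg _ _ h) fun w' hw' =>
      .left _ _ (List.Shortlex.append_append hw' u v)
  | mod h u =>
    refine mapDomain_mem_supported (hmod _ _ h) fun m' hm' => ?_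
    rcases Prod.lex_def.1 hm' with h | ⟨h1, h2⟩
    · exact .left _ _ (List.Shortlex.append_left h u)
    · rw [show m'.1 = _ from h1]
      exact .right _ h2

theorem Rewrites.cons {u : List B} {x : X} {r : List B × X →₀ k} (h : S.Rewrites (u, x) r) (c : B) :
    S.Rewrites (c :: u, x) (r.mapDomain fun m => (c :: m.1, m.2)) := by
  generalize hm : (u, x) = m at h
  cases h with
  | alg h u' v x =>
    obtain ⟨rfl, rfl⟩ := Prod.mk.inj hm
    rw [← Finsupp.mapDomain_comp]
    exact Rewrites.alg h (c :: u') v _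
  | mod h u' =>
    obtain ⟨rfl, rfl⟩ := Prod.mk.inj hm
    rw [← Finsupp.mapDomain_comp]
    exact Rewrites.mod h (c :: u')

theorem Normal.tail {u : List B} {x : X} {c : B} (h : S.Normal (c :: u, x)) : S.Normal (u, x) :=
  fun _ hr => h _ (hr.cons c)

end RewritingRules

/-! ### The order on the monomials, and the shape of the normal ones. -/

namespace Gen

variable {ι : Type*}

/-- The position of a generator in the order on the generators. -/
def key : Gen ι → ℕ ×ₗ (ℕ ×ₗ WithBot ι)
  | D => toLex (1, toLex (0, ⊥))
  | L n a => toLex (if n ≤ 1 then 0 else 2, toLex (n, (a : WithBot ι)))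
  | R n a => toLex (3, toLex (n, (a : WithBot ι)))

theorem key_injective : Function.Injective (key (ι := ι)) := by
  intro x y h
  rcases x with _ | ⟨n, a⟩ | ⟨n, a⟩ <;> rcases y with _ | ⟨m, c⟩ | ⟨m, c⟩ <;>
    simp only [key, toLex_inj, Prod.mk.injEq] at h <;> first | rfl | skip
  all_goals try split_ifs at h
  all_goals simp_all

variable [LinearOrder ι]

theorem lt_iff_key {x y : Gen ι} : lt x y ↔ key x < key y := by
  rcases x with _ | ⟨n, a⟩ | ⟨n, a⟩ <;> rcases y with _ | ⟨m, c⟩ | ⟨m, c⟩ <;>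
    simp only [lt, key, Prod.Lex.toLex_lt_toLex, WithBot.coe_lt_coe, lt_self_iff_false] <;>
    (try split_ifs) <;> simp <;> omega

theorem lt_wf [WellFoundedLT ι] : WellFounded (lt (ι := ι)) :=
  Subrelation.wf (fun h => lt_iff_key.1 h) (InvImage.wf key wellFounded_lt)

theorem lt_trichotomous (x y : Gen ι) : lt x y ∨ x = y ∨ lt y x := by
  rcases lt_trichotomy (key x) (key y) with h | h | h
  · exact Or.inl (lt_iff_key.2 h)
  · exact Or.inr (Or.inl (key_injective h))
  · exact Or.inr (Or.inr (lt_iff_key.2 h))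

theorem monLT_wf [WellFoundedLT ι] : WellFounded (monLT (ι := ι)) :=
  WellFounded.prod_lex (List.Shortlex.wf lt_wf) wellFounded_lt

theorem monLT_trichotomous (x y : List (Gen ι) × WithBot ι) :
    monLT x y ∨ x = y ∨ monLT y x := by
  have : Std.Trichotomous (lt (ι := ι)) :=
    ⟨fun a b h1 h2 => ((lt_trichotomous a b).resolve_left h1).resolve_right h2⟩
  obtain ⟨u, a⟩ := x
  obtain ⟨v, c⟩ := y
  by_cases h1 : List.Shortlex lt u v
  · exact Or.inl (.left _ _ h1)
  by_cases h2 : List.Shortlex lt v u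
  · exact Or.inr (Or.inr (.left _ _ h2))
  obtain rfl : u = v := Std.Trichotomous.trichotomous _ _ h1 h2
  rcases lt_trichotomy a c with h | rfl | h
  · exact Or.inl (.right _ h)
  · exact Or.inr (Or.inl rfl)
  · exact Or.inr (Or.inr (.right _ h))

end Gen

namespace KacMoody

open RewritingRules

variable {k : Type u} {g : Type v} {ι : Type w} [Field k] [LieRing g] [LieAlgebra k g]
  (b : Module.Basis ι k g) (Φ : LinearMap.BilinForm k g)

theorem wd_mem_supported {s : Set (List (Gen ι))} {u : List (Gen ι)} (h : u ∈ s) :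
    (wd u : List (Gen ι) →₀ k) ∈ Finsupp.supported k k s :=
  Finsupp.single_mem_supported k 1 h

theorem mon_mem_supported {s : Set (List (Gen ι) × WithBot ι)} {u : List (Gen ι)} {a : ι}
    (h : (u, (a : WithBot ι)) ∈ s) : (mon u a : _ →₀ k) ∈ Finsupp.supported k k s :=
  Finsupp.single_mem_supported k 1 h

theorem monE_mem_supported {s : Set (List (Gen ι) × WithBot ι)}
    (h : ([], ⊥) ∈ s) : (monE : _ →₀ k) ∈ Finsupp.supported k k s :=
  Finsupp.single_mem_supported k 1 h

theorem monLin_mem_supported {s : Set (List (Gen ι) × WithBot ι)} {u : List (Gen ι)} {y : g}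
    (h : ∀ a : ι, (u, (a : WithBot ι)) ∈ s) : monLin b u y ∈ Finsupp.supported k k s :=
  mapDomain_mem_supported (s := Set.univ) (by simp) fun a _ => h a

theorem genLin_mem_supported {s : Set (List (Gen ι))} {n : ℕ} {y : g}
    (h : ∀ a : ι, [Gen.L n a] ∈ s) : genLin b n y ∈ Finsupp.supported k k s :=
  mapDomain_mem_supported (s := Set.univ) (by simp) fun a _ => h a

variable [LinearOrder ι]

theorem algRule_leading {w : List (Gen ι)} {f : List (Gen ι) →₀ k} (h : AlgRule b w f) :
    f ∈ Finsupp.supported k k {w' | List.Shortlex Gen.lt w' w} := by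
  cases h with
  | D_L0 a => exact wd_mem_supported (.of_head (by simp [Gen.lt]) le_rfl)
  | D_L1 a =>
    exact sub_mem (wd_mem_supported (.of_head (by simp [Gen.lt]) le_rfl))
      (wd_mem_supported (.of_length_lt (by simp)))
  | L_D n hn a =>
    exact add_mem (wd_mem_supported (.of_head (by simpa [Gen.lt]) le_rfl))
      (Submodule.smul_mem _ _ (wd_mem_supported (.of_length_lt (by simp))))
  | R_D n a =>
    exact add_mem (wd_mem_supported (.of_head (by simp [Gen.lt]) le_rfl))
      (Submodule.smul_mem _ _ (wd_mem_supported (.of_length_lt (by simp))))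
  | R_L m n a c => exact wd_mem_supported (.of_head (by simp [Gen.lt]) le_rfl)
  | L_L n m a c h =>
    exact add_mem (wd_mem_supported (.of_head (by simpa [Gen.lt] using h) le_rfl))
      (genLin_mem_supported b fun _ => .of_length_lt (by simp))

theorem modRule_leading {m : List (Gen ι) × WithBot ι} {f : List (Gen ι) × WithBot ι →₀ k}
    (h : ModRule Φ b m f) : f ∈ Finsupp.supported k k {m' | Gen.monLT m' m} := by
  cases h with
  | D_e => exact zero_mem _
  | L_e n x => exact zero_mem _
  | R_e n x => exact zero_mem _
  | L_loc n hn x y => exact zero_mem _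
  | R_loc n hn x y => exact zero_mem _
  | R1 x y =>
    exact sub_mem (mon_mem_supported (.left _ _ (.of_head (by simp [Gen.lt]) le_rfl)))
      (Submodule.smul_mem _ _ (monE_mem_supported (.left _ _ (.of_length_lt (by simp)))))
  | R0 x y =>
    exact sub_mem (mon_mem_supported (.left _ _ (.of_head (by simp [Gen.lt]) le_rfl)))
      (monLin_mem_supported b fun _ => .left _ _ (.of_length_lt (by simp)))
  | L1_skew x y h =>
    exact add_mem (neg_mem (mon_mem_supported (.left _ _ (.of_head (by simpa [Gen.lt]) le_rfl))))
      (Submodule.smul_mem _ _ (monE_mem_supported (.left _ _ (.of_length_lt (by simp)))))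
  | L1_diag x =>
    exact Submodule.smul_mem _ _ (monE_mem_supported (.left _ _ (.of_length_lt (by simp))))
  | L1_D s hs x y =>
    refine sub_mem (sub_mem (Submodule.smul_mem _ _ (mon_mem_supported (.left _ _ ?_)))
      (mon_mem_supported (.left _ _ ?_))) (monLin_mem_supported b fun _ => .left _ _ ?_) <;>
    exact .of_length_lt (by simp; try omega)
  | L1_L1 x y z h h' => exact zero_mem _
  | L0_L1 x y z h h' =>
    refine add_mem (add_mem (add_mem (add_mem (sub_mem (mon_mem_supported (.left _ _ ?_))
      (mon_mem_supported (.left _ _ ?_))) (monLin_mem_supported b fun _ => .left _ _ ?_))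
      (monLin_mem_supported b fun _ => .left _ _ ?_))
      (monLin_mem_supported b fun _ => .left _ _ ?_))
      (Submodule.smul_mem _ _ (monE_mem_supported (.left _ _ ?_)))
    · exact .of_head (by simpa [Gen.lt]) le_rfl
    · exact .of_head (by simpa [Gen.lt] using h.trans h') le_rfl
    all_goals exact .of_length_lt (by simp)

theorem rules_leading (m : List (Gen ι) × WithBot ι) (r : List (Gen ι) × WithBot ι →₀ k)
    (h : (rules Φ b).Rewrites m r) : ∀ m' ∈ r.support, Gen.monLT m' m :=
  rewrites_leading (fun _ _ h => algRule_leading b h) (fun _ _ h => modRule_leading b Φ h) m r h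

/-- The normal monomials of the rules. -/
inductive NormalForm : List (Gen ι) × WithBot ι → Prop
  | e : NormalForm ([], ⊥)
  | D (u : List ι) (s : ℕ) (x : ι) (hu : u.Pairwise (· ≤ ·)) :
      NormalForm (u.map (Gen.L 0) ++ List.replicate s Gen.D, (x : WithBot ι))
  | L1 (u : List ι) (x y : ι) (hu : u.Pairwise (· ≤ ·)) (hxy : x < y) (hy : ∀ z ∈ u, z ≤ y) :
      NormalForm (u.map (Gen.L 0) ++ [Gen.L 1 x], (y : WithBot ι))

theorem not_normal_of_alg {w : List (Gen ι)} {f} (h : AlgRule b w f)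
    (v : List (Gen ι)) (x : WithBot ι) : ¬ (rules Φ b).Normal (w ++ v, x) :=
  fun hn => hn _ (by simpa using Rewrites.alg (S := rules Φ b) h [] v x)

theorem not_normal_of_mod {w : List (Gen ι)} {x : WithBot ι} {f} (h : ModRule Φ b (w, x) f) :
    ¬ (rules Φ b).Normal (w, x) :=
  fun hn => hn _ (by simpa using Rewrites.mod (S := rules Φ b) h [])

/-- The tail of a normal monomial is normal, hence of a listed form; each letter that may be put in
front either gives a listed form again or creates the left-hand side of a rule. The converse is not
needed, since the retraction constructed below works for all listed monomials. -/
theorem normalForm_of_normal {m : List (Gen ι) × WithBot ι} (h : (rules Φ b).Normal m) :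
    NormalForm m := by
  obtain ⟨w, x⟩ := m
  induction w with
  | nil =>
    induction x using WithBot.recBotCoe with
    | bot => exact .e
    | coe x => exact .D [] 0 x .nil
  | cons c w ih =>
    have hw := ih h.tail
    cases hw with
    | e =>
      cases c with
      | D => exact (not_normal_of_mod b Φ .D_e h).elim
      | L n a => exact (not_normal_of_mod b Φ (.L_e n a) h).elim
      | R n a => exact (not_normal_of_mod b Φ (.R_e n a) h).elim
    | D u s x hu =>
      rcases u with _ | ⟨d, u⟩
      · rw [List.map_nil, List.nil_append] at *
        rcases s with _ | s
        · rw [List.replicate_zero] at *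
          cases c with
          | D => exact .D [] 1 x .nil
          | L n a =>
            rcases n with _ | _ | n
            · exact .D [a] 0 x (by simp)
            · rcases lt_trichotomy a x with hax | rfl | hax
              · exact .L1 [] a x .nil hax (by simp)
              · exact (not_normal_of_mod b Φ (.L1_diag a) h).elim
              · exact (not_normal_of_mod b Φ (.L1_skew a x hax) h).elim
            · exact (not_normal_of_mod b Φ (.L_loc (n + 2) (by omega) a x) h).elim
          | R n a =>
            rcases n with _ | _ | n
            · exact (not_normal_of_mod b Φ (.R0 a x) h).elim
            · exact (not_normal_of_mod b Φ (.R1 a x) h).elim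
            · exact (not_normal_of_mod b Φ (.R_loc (n + 2) (by omega) a x) h).elim
        · cases c with
          | D => exact .D [] (s + 2) x .nil
          | L n a =>
            rcases n with _ | _ | n
            · exact .D [a] (s + 1) x (by simp)
            · exact (not_normal_of_mod b Φ (.L1_D (s + 1) (by omega) a x) h).elim
            · exact (not_normal_of_alg b Φ (.L_D (n + 2) (by omega) a) (List.replicate s .D) x
                h).elim
          | R n a => exact (not_normal_of_alg b Φ (.R_D n a) (List.replicate s .D) x h).elim
      · cases c with
        | D => exact (not_normal_of_alg b Φ (.D_L0 d) _ _ h).elim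
        | L n a =>
          by_cases hn : 0 < n ∨ 0 = n ∧ d < a
          · exact (not_normal_of_alg b Φ (.L_L n 0 a d hn) _ _ h).elim
          · simp only [not_or, not_lt, not_and, nonpos_iff_eq_zero] at hn
            obtain ⟨rfl, hn⟩ := hn
            refine .D (a :: d :: u) s x (List.pairwise_cons.2 ⟨fun z hz => ?_, hu⟩)
            rcases List.mem_cons.1 hz with rfl | hz
            · exact hn rfl
            · exact (hn rfl).trans (List.rel_of_pairwise_cons hu hz)
        | R n a => exact (not_normal_of_alg b Φ (.R_L n 0 a d) _ _ h).elim
    | L1 u x y hu hxy hy =>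
      rcases u with _ | ⟨d, u⟩
      · rw [List.map_nil, List.nil_append] at *
        cases c with
        | D => exact (not_normal_of_alg b Φ (.D_L1 x) _ _ h).elim
        | L n a =>
          rcases n with _ | _ | n
          · rcases lt_or_ge y a with hya | hya
            -- The cyclic rule is what bounds the `L_0` letters by the last generator `y`.
            · exact (not_normal_of_mod b Φ (.L0_L1 a x y hxy hya) h).elim
            · exact .L1 [a] x y (by simp) hxy (by simpa)
          · rcases lt_or_ge x a with hxa | hxa
            · exact (not_normal_of_alg b Φ (.L_L 1 1 a x (by simpa)) _ _ h).elim
            · exact (not_normal_of_mod b Φ (.L1_L1 a x y hxa hxy) h).elim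
          · exact (not_normal_of_alg b Φ (.L_L (n + 2) 1 a x (by omega)) _ _ h).elim
        | R n a => exact (not_normal_of_alg b Φ (.R_L n 1 a x) _ _ h).elim
      · cases c with
        | D => exact (not_normal_of_alg b Φ (.D_L0 d) _ _ h).elim
        | L n a =>
          by_cases hn : 0 < n ∨ 0 = n ∧ d < a
          · exact (not_normal_of_alg b Φ (.L_L n 0 a d hn) _ _ h).elim
          · simp only [not_or, not_lt, not_and, nonpos_iff_eq_zero] at hn
            obtain ⟨rfl, hn⟩ := hn
            have had : a ≤ d := hn rfl
            refine .L1 (a :: d :: u) x y (List.pairwise_cons.2 ⟨fun z hz => ?_, hu⟩) hxy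
              fun z hz => ?_
            · rcases List.mem_cons.1 hz with rfl | hz
              · exact had
              · exact had.trans (List.rel_of_pairwise_cons hu hz)
            · rcases List.mem_cons.1 hz with rfl | hz
              · exact had.trans (hy d (by simp))
              · exact hy z hz
        | R n a => exact (not_normal_of_alg b Φ (.R_L n 0 a d) _ _ h).elim

end KacMoody

/-! ### Critical pairs for modules over the universal enveloping algebra. -/

section EnvelopingRules

variable {k : Type*} {g : Type*} {ι : Type*} {X : Type*} [Field k] [LieRing g] [LieAlgebra k g]
  (b : Module.Basis ι k g)

/-- The rules `a c → c a + [a, c]`, `c < a`, of the universal enveloping algebra. -/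
inductive SwapRule [LinearOrder ι] : List ι → (List ι →₀ k) → Prop
  | swap (a c : ι) (h : c < a) : SwapRule [a, c]
      (Finsupp.single [c, a] 1 + (b.repr ⁅b a, b c⁆).mapDomain fun i => [i])

/-- The rules of the universal enveloping algebra together with rules for one of its modules. -/
def envRules [LinearOrder ι] (mod : List ι × X → (List ι × X →₀ k) → Prop) :
    RewritingRules k ι X where
  alg := SwapRule b
  mod := mod

namespace FreeWords

variable (k ι X) in
/-- Multiplication of monomials by a word. -/
noncomputable def pre (u : List ι) : Module.End k (List ι × X →₀ k) :=
  Finsupp.lmapDomain k k fun m => (u ++ m.1, m.2)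

theorem pre_single (u v : List ι) (x : X) (c : k) :
    pre k ι X u (Finsupp.single (v, x) c) = Finsupp.single (u ++ v, x) c := by
  simp [pre]

theorem pre_append (u v : List ι) (f : List ι × X →₀ k) :
    pre k ι X (u ++ v) f = pre k ι X u (pre k ι X v f) := by
  simp only [pre, Finsupp.lmapDomain_apply, ← Finsupp.mapDomain_comp]
  congr 1
  ext m <;> simp

theorem pre_cons (a : ι) (v : List ι) (f : List ι × X →₀ k) :
    pre k ι X (a :: v) f = pre k ι X [a] (pre k ι X v f) :=
  pre_append [a] v f

theorem pre_nil (f : List ι × X →₀ k) : pre k ι X [] f = f :=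
  Finsupp.mapDomain_id

variable (X) in
/-- Multiplication by an element of the Lie algebra, expanded in the basis. -/
noncomputable def op : g →ₗ[k] Module.End k (List ι × X →₀ k) :=
  b.constr k fun i => pre k ι X [i]

theorem op_basis (i : ι) : op X b (b i) = pre k ι X [i] := b.constr_basis k _ i

theorem op_single (y : g) (v : List ι) (x : X) : op X b y (Finsupp.single (v, x) 1) =
    (b.repr y).mapDomain fun i => (i :: v, x) := by
  suffices h : (LinearMap.applyₗ (Finsupp.single (v, x) 1)) ∘ₗ op X b =
      (Finsupp.lmapDomain k k fun i => (i :: v, x)) ∘ₗ b.repr.toLinearMap from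
    LinearMap.congr_fun h y
  refine b.ext fun i => ?_
  simp [op_basis, pre_single]

variable [LinearOrder ι]

variable {b} {mod : List ι × X → (List ι × X →₀ k) → Prop}

/-- A rule applied at the beginning of a monomial. -/
inductive HeadRewrites (b : Module.Basis ι k g) (mod : List ι × X → (List ι × X →₀ k) → Prop) :
    List ι × X → (List ι × X →₀ k) → Prop
  | swap (a c : ι) (h : c < a) (v : List ι) (x : X) : HeadRewrites b mod (a :: c :: v, x)
      (pre k ι X [c] (pre k ι X [a] (Finsupp.single (v, x) 1)) +
        op X b ⁅b a, b c⁆ (Finsupp.single (v, x) 1))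
  | mod {m : List ι × X} {r : List ι × X →₀ k} (h : mod m r) : HeadRewrites b mod m r

/-- Separating the untouched prefix `u` from the rule lets two rewritings be compared by the
positions at which they start. -/
theorem rewrites_iff {m : List ι × X} {r : List ι × X →₀ k} :
    (envRules b mod).Rewrites m r ↔
      ∃ u n r₀, HeadRewrites b mod n r₀ ∧ m = (u ++ n.1, n.2) ∧ r = pre k ι X u r₀ := by
  have hswap : ∀ (a c : ι) (u v : List ι) (x : X),
      pre k ι X u (pre k ι X [c] (pre k ι X [a] (Finsupp.single (v, x) 1)) +
        op X b ⁅b a, b c⁆ (Finsupp.single (v, x) 1)) =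
      (Finsupp.single [c, a] 1 + (b.repr ⁅b a, b c⁆).mapDomain fun i => [i]).mapDomain
        fun w' => (u ++ w' ++ v, x) := by
    intro a c u v x
    rw [map_add, Finsupp.mapDomain_add, op_single, ← Finsupp.mapDomain_comp, pre_single,
      pre_single, pre_single, Finsupp.mapDomain_single, pre, Finsupp.lmapDomain_apply,
      ← Finsupp.mapDomain_comp]
    simp [Function.comp_def]
  constructor
  · intro h
    cases h with
    | alg h u v x =>
      cases h with
      | swap a c h =>
        exact ⟨u, _, _, .swap a c h v x, by simp, (hswap a c u v x).symm⟩
    | mod h u => exact ⟨u, _, _, .mod h, rfl, rfl⟩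
  · rintro ⟨u, n, r₀, h, rfl, rfl⟩
    cases h with
    | swap a c h v x =>
      rw [hswap]
      simpa using RewritingRules.Rewrites.alg (S := envRules b mod) (SwapRule.swap a c h) u v x
    | mod h => exact RewritingRules.Rewrites.mod (S := envRules b mod) h u

theorem HeadRewrites.rewrites {n : List ι × X} {r₀ : List ι × X →₀ k}
    (h : HeadRewrites b mod n r₀) (u : List ι) :
    (envRules b mod).Rewrites (u ++ n.1, n.2) (pre k ι X u r₀) :=
  rewrites_iff.2 ⟨u, n, r₀, h, rfl, rfl⟩

/-- The deg-lex order on monomials. -/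
abbrev lt : List ι × X → List ι × X → Prop := Prod.Lex (List.Shortlex (· < ·)) fun _ _ => False

theorem lt_of_length_lt {u v : List ι} {x y : X} (h : u.length < v.length) : lt (u, x) (v, y) :=
  .left _ _ (.of_length_lt h)

theorem lt_of_head {a c : ι} {s t : List ι} {x y : X} (u : List ι) (h : c < a)
    (hl : s.length ≤ t.length) : lt (u ++ c :: s, x) (u ++ a :: t, y) :=
  .left _ _ (List.Shortlex.append_left (.of_head h hl) u)

theorem lt_append {m n : List ι × X} (u : List ι) (h : lt m n) :
    lt (u ++ m.1, m.2) (u ++ n.1, n.2) := by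
  rcases Prod.lex_def.1 h with h | ⟨-, h⟩
  · exact .left _ _ (List.Shortlex.append_left h u)
  · exact h.elim

theorem envRules_leading (hmod : ∀ m f, mod m f → f ∈ Finsupp.supported k k {m' | lt m' m})
    (m : List ι × X) (r : List ι × X →₀ k) (h : (envRules b mod).Rewrites m r) :
    ∀ m' ∈ r.support, lt m' m := by
  refine RewritingRules.rewrites_leading (fun w f h => ?_) hmod m r h
  cases h with
  | swap a c h =>
    exact add_mem (Finsupp.single_mem_supported k 1 (.of_head h le_rfl))
      (RewritingRules.mapDomain_mem_supported (s := Set.univ) (by simp)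
        fun i _ => .of_length_lt (by simp))

/-- The rules applied to monomials smaller than `m` hold under `E`. -/
def HoldsBelow {V : Type*} [AddCommGroup V] [Module k V] (b : Module.Basis ι k g)
    (mod : List ι × X → (List ι × X →₀ k) → Prop)
    (E : (List ι × X →₀ k) →ₗ[k] V) (m : List ι × X) : Prop :=
  ∀ m' r, lt m' m → (envRules b mod).Rewrites m' r → E (Finsupp.single m' 1) = E r

section Local

variable {V : Type*} [AddCommGroup V] [Module k V] {E : (List ι × X →₀ k) →ₗ[k] V}

theorem HoldsBelow.swap {m : List ι × X} (hE : HoldsBelow b mod E m) (u : List ι) {a c : ι}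
    (h : c < a) (v : List ι) (x : X) (hm : lt (u ++ a :: c :: v, x) m) :
    E (pre k ι X u (pre k ι X [a] (pre k ι X [c] (Finsupp.single (v, x) 1)))) =
      E (pre k ι X u (pre k ι X [c] (pre k ι X [a] (Finsupp.single (v, x) 1)))) +
      E (pre k ι X u (op X b ⁅b a, b c⁆ (Finsupp.single (v, x) 1))) := by
  rw [← map_add, ← map_add, ← hE _ _ hm (HeadRewrites.rewrites (.swap a c h v x) u)]
  simp [pre_single]

/-- On words shorter than `m` the order of the letters no longer matters, so the commutation
relation extends bilinearly from ordered pairs of basis elements to all of `g`. -/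
theorem HoldsBelow.swap_op {m : List ι × X} (hE : HoldsBelow b mod E m) (u v : List ι)
    (x : X) (hm : (u ++ v).length + 2 < m.1.length) (y z : g) :
    E (pre k ι X u (op X b y (op X b z (Finsupp.single (v, x) 1)))) =
      E (pre k ι X u (op X b z (op X b y (Finsupp.single (v, x) 1)))) +
      E (pre k ι X u (op X b ⁅y, z⁆ (Finsupp.single (v, x) 1))) := by
  let A : g →ₗ[k] g →ₗ[k] V := LinearMap.mk₂ k
    (fun y z => E (pre k ι X u (op X b y (op X b z (Finsupp.single (v, x) 1)))))
    (by intros; simp) (by intros; simp) (by intros; simp) (by intros; simp)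
  let B : g →ₗ[k] g →ₗ[k] V := LinearMap.mk₂ k
    (fun y z => E (pre k ι X u (op X b ⁅y, z⁆ (Finsupp.single (v, x) 1))))
    (by intros; simp) (by intros; simp) (by intros; simp) (by intros; simp)
  suffices h : A = A.flip + B from LinearMap.congr_fun₂ h y z
  have hlt : ∀ a c : ι, lt (u ++ a :: c :: v, x) m := fun a c => by
    refine lt_of_length_lt ?_
    simp at hm ⊢
    omega
  refine b.ext fun i => b.ext fun j => ?_
  simp only [A, B, LinearMap.mk₂_apply, LinearMap.add_apply, LinearMap.flip_apply, op_basis]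
  rcases lt_trichotomy j i with h | rfl | h
  · exact hE.swap u h v x (hlt _ _)
  · simp
  · rw [hE.swap u h v x (hlt _ _), ← lie_skew (b j) (b i)]
    simp only [map_neg, LinearMap.neg_apply, neg_add_cancel_right]

/-- The overlap `a c d` of the Poincaré–Birkhoff–Witt theorem: both sides are brought to the order
`d c a`, and the remaining bracket terms agree by the Jacobi identity. -/
theorem local_swap_swap (u v : List ι) (x : X) {a c d : ι} (hac : c < a) (hcd : d < c)
    (hE : HoldsBelow b mod E (u ++ a :: c :: d :: v, x)) :
    E (pre k ι X u (pre k ι X [c] (pre k ι X [a] (Finsupp.single (d :: v, x) 1)) +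
        op X b ⁅b a, b c⁆ (Finsupp.single (d :: v, x) 1))) =
    E (pre k ι X (u ++ [a]) (pre k ι X [d] (pre k ι X [c] (Finsupp.single (v, x) 1)) +
        op X b ⁅b c, b d⁆ (Finsupp.single (v, x) 1))) := by
  have hd : (Finsupp.single (d :: v, x) 1 : List ι × X →₀ k) =
      pre k ι X [d] (Finsupp.single (v, x) 1) := by simp [pre_single]
  have hlen : (u ++ v).length + 2 < (u ++ a :: c :: d :: v).length := by
    simp only [List.length_append, List.length_cons]
    omega
  have e1 := hE.swap (u ++ [c]) (hcd.trans hac) v x (by simpa using lt_of_head u hac (by simp))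
  have e2 := hE.swap u hcd (a :: v) x (by simpa using lt_of_head u hac (by simp))
  have e3 := hE.swap u (hcd.trans hac) (c :: v) x
    (by simpa using lt_append u (lt_append [a] (lt_of_head [] hcd (by simp))))
  have e4 := hE.swap (u ++ [d]) hac v x
    (by simpa using lt_of_head u (hcd.trans hac) (by simp))
  have s1 := hE.swap_op u v x hlen ⁅b c, b d⁆ (b a)
  have s2 := hE.swap_op u v x hlen ⁅b a, b c⁆ (b d)
  have s3 := hE.swap_op u v x hlen (b c) ⁅b a, b d⁆
  have hc : ∀ i, (Finsupp.single (i :: v, x) 1 : List ι × X →₀ k) =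
      op X b (b i) (Finsupp.single (v, x) 1) := fun i => by simp [op_basis, pre_single]
  simp only [hc, ← op_basis b, pre_append, map_add] at e1 e2 e3 e4 s1 s2 s3 ⊢
  rw [e1, e2, e3, e4, s1, s2, s3, ← lie_skew ⁅b c, b d⁆ (b a), lie_lie]
  simp only [map_neg, map_sub, LinearMap.neg_apply, LinearMap.sub_apply]
  abel

/-- Rewritings at disjoint places commute: each of the two results can still be rewritten by the
other rule, because all its monomials lie below the original one. -/
theorem local_disjoint (hmod : ∀ m f, mod m f → f ∈ Finsupp.supported k k {m' | lt m' m})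
    (u : List ι) {a c : ι} (hac : c < a) {n : List ι × X} {r : List ι × X →₀ k}
    (hr : (envRules b mod).Rewrites n r)
    (hE : HoldsBelow b mod E (u ++ a :: c :: n.1, n.2)) :
    E (pre k ι X u (pre k ι X [c] (pre k ι X [a] (Finsupp.single n 1)) +
        op X b ⁅b a, b c⁆ (Finsupp.single n 1))) = E (pre k ι X (u ++ [a, c]) r) := by
  obtain ⟨v, x⟩ := n
  have hrw : ∀ w : List ι, (envRules b mod).Rewrites (w ++ v, x) (pre k ι X w r) := by
    intro w
    obtain ⟨u', n', r₀, h, hn, rfl⟩ := rewrites_iff.1 hr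
    obtain ⟨rfl, rfl⟩ := Prod.mk.inj hn
    exact rewrites_iff.2 ⟨w ++ u', n', r₀, h, by simp, (pre_append _ _ _).symm⟩
  have h1 : E (pre k ι X u (pre k ι X [c] (pre k ι X [a] (Finsupp.single (v, x) 1)))) =
      E (pre k ι X u (pre k ι X [c] (pre k ι X [a] r))) := by
    have := hE _ _ (by simpa using lt_of_head u hac (by simp)) (hrw (u ++ [c, a]))
    rw [pre_append, pre_cons] at this
    rw [← this]
    simp [pre_single]
  have h2 : ∀ y : g, E (pre k ι X u (op X b y (Finsupp.single (v, x) 1))) =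
      E (pre k ι X u (op X b y r)) := by
    intro y
    let A : (List ι × X →₀ k) → g →ₗ[k] V := fun f =>
      { toFun := fun y => E (pre k ι X u (op X b y f))
        map_add' := by intros; simp
        map_smul' := by intros; simp }
    suffices h : A (Finsupp.single (v, x) 1) = A r from LinearMap.congr_fun h y
    refine b.ext fun i => ?_
    simp only [A, LinearMap.coe_mk, AddHom.coe_mk, op_basis]
    have := hE _ _ (lt_of_length_lt (by simp)) (hrw (u ++ [i]))
    rw [pre_append] at this
    rw [← this]
    simp [pre_single]
  have h3 : ∀ n' ∈ r.support, E (pre k ι X (u ++ [a, c]) (Finsupp.single n' 1)) =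
      E (pre k ι X u (pre k ι X [c] (pre k ι X [a] (Finsupp.single n' 1)) +
        op X b ⁅b a, b c⁆ (Finsupp.single n' 1))) := by
    intro n' hn'
    have := hE.swap u hac n'.1 n'.2
      (by simpa using lt_append (u ++ [a, c]) (envRules_leading hmod (v, x) r hr n' hn'))
    rw [pre_append, pre_cons, map_add, map_add]
    exact this
  have h4 : E (pre k ι X (u ++ [a, c]) r) =
      E (pre k ι X u (pre k ι X [c] (pre k ι X [a] r) + op X b ⁅b a, b c⁆ r)) := by
    have hsum : r = ∑ n' ∈ r.support, r n' • Finsupp.single n' 1 := by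
      conv_lhs => rw [← Finsupp.sum_single r, Finsupp.sum]
      simp
    rw [hsum]
    simp only [map_sum, map_smul]
    rw [← Finset.sum_add_distrib]
    simp only [map_sum]
    refine Finset.sum_congr rfl fun n' hn' => ?_
    rw [h3 n' hn', ← smul_add, map_smul, map_smul]
  rw [h4, map_add, map_add, map_add, map_add, h1, h2]

/-- Local confluence, up to the overlaps of `a c → c a + [a, c]` with the rules of the module. -/
theorem local_confluence
    (hmod : ∀ m f, mod m f → f ∈ Finsupp.supported k k {m' | lt m' m})
    (hlen : ∀ m f, mod m f → ∃ a, m.1 = [a])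
    (huniq : ∀ m f f', mod m f → mod m f' → f = f')
    (hover : ∀ (u : List ι) (a c : ι) (x : X) (f : List ι × X →₀ k), c < a → mod ([c], x) f →
      HoldsBelow b mod E (u ++ [a, c], x) →
      E (pre k ι X u (pre k ι X [c] (pre k ι X [a] (Finsupp.single ([], x) 1)) +
        op X b ⁅b a, b c⁆ (Finsupp.single ([], x) 1))) = E (pre k ι X (u ++ [a]) f))
    (m : List ι × X) (r r' : List ι × X →₀ k) (h : (envRules b mod).Rewrites m r)
    (h' : (envRules b mod).Rewrites m r') (hE : HoldsBelow b mod E m) : E r = E r' := by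
  -- Here `t` is the distance between the starting points of the two rules. Distance `0` is the same
  -- rule, distance `1` an overlap, larger distances are disjoint; rules of the module have one
  -- letter and act only at the end of a word.
  have key : ∀ (u t : List ι) (n₁ n₂ : List ι × X) (r₁ r₂ : List ι × X →₀ k),
      HeadRewrites b mod n₁ r₁ → HeadRewrites b mod n₂ r₂ → n₁ = (t ++ n₂.1, n₂.2) →
      HoldsBelow b mod E (u ++ n₁.1, n₁.2) →
      E (pre k ι X u r₁) = E (pre k ι X (u ++ t) r₂) := by
    intro u t n₁ n₂ r₁ r₂ h₁ h₂ hn hE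
    cases h₁ with
    | swap a c hac v x =>
      rcases t with _ | ⟨a', _ | ⟨c', t⟩⟩
      · cases h₂ with
        | swap a' c' h' v' x' =>
          simp only [List.nil_append, Prod.mk.injEq, List.cons.injEq] at hn
          obtain ⟨⟨rfl, rfl, rfl⟩, rfl⟩ := hn
          rw [List.append_nil]
        | mod h₂ =>
          obtain ⟨d, hd⟩ := hlen _ _ h₂
          simp [hd] at hn
      · cases h₂ with
        | swap a' c' h' v' x' =>
          simp only [List.cons_append, List.nil_append, Prod.mk.injEq, List.cons.injEq] at hn
          obtain ⟨⟨rfl, rfl, rfl⟩, rfl⟩ := hn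
          exact local_swap_swap u v' x hac h' hE
        | mod h₂ =>
          obtain ⟨d, hd⟩ := hlen _ _ h₂
          obtain ⟨w, x'⟩ := n₂
          obtain rfl : w = [d] := hd
          simp only [List.cons_append, List.nil_append, Prod.mk.injEq, List.cons.injEq] at hn
          obtain ⟨⟨rfl, rfl, rfl⟩, rfl⟩ := hn
          exact hover u a c x r₂ hac h₂ hE
      · simp only [List.cons_append, Prod.mk.injEq, List.cons.injEq] at hn
        obtain ⟨⟨rfl, rfl, rfl⟩, rfl⟩ := hn
        have := local_disjoint hmod u hac (h₂.rewrites t) hE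
        rw [this, ← pre_append]
        simp
    | mod h₁ =>
      obtain ⟨d, hd⟩ := hlen _ _ h₁
      rcases t with _ | ⟨a', t⟩
      · obtain rfl : n₁ = n₂ := by simpa using hn
        cases h₂ with
        | swap => simp at hd
        | mod h₂ => rw [huniq _ _ _ h₁ h₂, List.append_nil]
      · rw [hn] at hd
        simp only [List.cons_append, List.cons.injEq, List.append_eq_nil_iff] at hd
        cases h₂ with
        | swap => simp at hd
        | mod h₂ =>
          obtain ⟨d', hd'⟩ := hlen _ _ h₂
          simp [hd'] at hd
  obtain ⟨u₁, n₁, r₁, h₁, rfl, rfl⟩ := rewrites_iff.1 h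
  obtain ⟨u₂, n₂, r₂, h₂, he, rfl⟩ := rewrites_iff.1 h'
  obtain ⟨he, hx⟩ := Prod.mk.inj he
  rcases List.append_eq_append_iff.1 he with ⟨t, rfl, ht⟩ | ⟨t, rfl, ht⟩
  · exact key u₁ t n₁ n₂ r₁ r₂ h₁ h₂ (Prod.ext ht hx) hE
  · refine (key u₂ t n₂ n₁ r₂ r₁ h₂ h₁ (Prod.ext ht hx.symm) ?_).symm
    rwa [he, hx] at hE

end Local

end FreeWords

end EnvelopingRules

/-! ### The cyclic relation as an identity between trilinear maps. -/

section Trilinear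

theorem eq_zero_of_antisymm {k ι V : Type*} [Field k] [CharZero k] [AddCommGroup V] [Module k V]
    [LinearOrder ι] {f : ι → ι → ι → V} (h₁ : ∀ x y z, f x y z = -f y x z)
    (h₂ : ∀ x y z, f x y z = -f x z y) (h : ∀ x y z, y < z → z < x → f x y z = 0) (x y z : ι) :
    f x y z = 0 := by
  have hself : ∀ v : V, v = -v → v = 0 := fun v hv => by
    rw [eq_neg_iff_add_eq_zero, ← two_smul k] at hv
    exact (smul_eq_zero.1 hv).resolve_left two_ne_zero
  have h12 : ∀ x z, f x x z = 0 := fun x z => hself _ (h₁ x x z)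
  have h23 : ∀ x z, f x z z = 0 := fun x z => hself _ (h₂ x z z)
  have h13 : ∀ x z, f x z x = 0 := fun x z => by rw [h₂, h12, neg_zero]
  rcases lt_trichotomy x y with hxy | rfl | hxy
  · rcases lt_trichotomy y z with hyz | rfl | hyz
    · rw [h₂, h₁, h z x y hxy hyz]; simp
    · exact h23 _ _
    · rcases lt_trichotomy x z with hxz | rfl | hxz
      · rw [h₁, h y x z hxz hyz]; simp
      · exact h13 _ _
      · rw [h₁, h₂, h y z x hxz hxy]; simp
  · exact h12 _ _
  · rcases lt_trichotomy y z with hyz | rfl | hyz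
    · rcases lt_trichotomy x z with hxz | rfl | hxz
      · rw [h₂, h₁, h₂, h z y x hxy hxz]; simp
      · exact h13 _ _
      · exact h x y z hyz hxz
    · exact h23 _ _
    · rw [h₂, h x z y hyz hxy]; simp

variable {k : Type*} {g : Type*} {ι : Type*} {V : Type*} [Field k] [LieRing g]
  [LieAlgebra k g] [AddCommGroup V] [Module k V]

/-- The relation that expresses `y (s ∧ t)` through the other cyclic permutations. -/
def CyclicRelation (O : g →ₗ[k] g →ₗ[k] g →ₗ[k] V) (G : g →ₗ[k] g →ₗ[k] V)
    (e : V) (Φ : LinearMap.BilinForm k g) (y s t : g) : Prop :=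
  O y s t = O t s y - O s t y + (G y ⁅t, s⁆ + G t ⁅s, y⁆ + G s ⁅y, t⁆ + (2 * Φ y ⁅s, t⁆) • e)

/-- The difference `f` of the two sides is trilinear and, by `hO` and invariance of the form,
alternating. So it vanishes once it vanishes on triples of basis elements in one prescribed order.
-/
theorem cyclicRelation_of_basis [CharZero k] [LinearOrder ι] {Φ : LinearMap.BilinForm k g}
    {O : g →ₗ[k] g →ₗ[k] g →ₗ[k] V} {G : g →ₗ[k] g →ₗ[k] V} {e : V}
    (hO : ∀ y s t, O y s t = -O y t s)
    (hinv : ∀ x y z : g, Φ ⁅x, y⁆ z = -Φ y ⁅x, z⁆)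
    (b : Module.Basis ι k g)
    (h : ∀ a x y : ι, x < y → y < a → CyclicRelation O G e Φ (b a) (b x) (b y)) (y s t : g) :
    CyclicRelation O G e Φ y s t := by
  let f : g → g → g → V := fun y s t => O y s t - O t s y + O s t y -
    (G y ⁅t, s⁆ + G t ⁅s, y⁆ + G s ⁅y, t⁆ + (2 * Φ y ⁅s, t⁆) • e)
  have hf : ∀ y s t, f y s t = 0 ↔ CyclicRelation O G e Φ y s t := fun y s t => by
    simp only [f, CyclicRelation]
    rw [sub_eq_zero, ← eq_sub_iff_add_eq, sub_eq_iff_eq_add]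
    constructor <;> intro h <;> rw [h] <;> abel
  rw [← hf]
  have l1 : ∀ s t, IsLinearMap k fun y => f y s t := fun s t =>
    ⟨by intros; simp [f, add_lie, lie_add]; module, by intros; simp [f]; module⟩
  have l2 : ∀ y t, IsLinearMap k fun s => f y s t := fun s t =>
    ⟨by intros; simp [f, add_lie, lie_add]; module, by intros; simp [f]; module⟩
  have l3 : ∀ y s, IsLinearMap k fun t => f y s t := fun s t =>
    ⟨by intros; simp [f, add_lie, lie_add]; module, by intros; simp [f]; module⟩
  have ext : ∀ φ : g → V, IsLinearMap k φ → (∀ i, φ (b i) = 0) → ∀ y, φ y = 0 :=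
    fun φ hφ h y => LinearMap.congr_fun (b.ext (f₁ := hφ.mk' φ) (f₂ := 0) h) y
  have hinv' : ∀ x y z, Φ x ⁅y, z⁆ = -Φ y ⁅x, z⁆ := fun x y z => by
    rw [← neg_eq_iff_eq_neg, ← hinv, ← lie_skew, map_neg, LinearMap.neg_apply, hinv, neg_neg]
  refine ext (fun y => f y s t) (l1 s t) (fun i => ?_) y
  refine ext (fun s => f (b i) s t) (l2 _ t) (fun j => ?_) s
  refine ext (fun t => f (b i) (b j) t) (l3 _ _) (fun l => ?_) t
  refine eq_zero_of_antisymm (k := k) (f := fun i j l => f (b i) (b j) (b l)) ?_ ?_ ?_ i j l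
  · intro x y z
    simp only [f]
    rw [hO (b z) (b x), hO (b x) (b z), hO (b y) (b x), ← lie_skew (b x) (b y), hinv' (b x) (b y),
      ← lie_skew (b y) (b z),
      ← lie_skew (b z) (b x)]
    simp only [map_neg]
    module
  · intro x y z
    simp only [f]
    rw [hO (b x) (b y), hO (b z), hO (b y), ← lie_skew (b x) (b y), ← lie_skew (b y) (b z),
      ← lie_skew (b z) (b x)]
    simp only [map_neg]
    module
  · intro x y z hyz hzx
    exact (hf _ _ _).2 (h x y z hyz hzx)

/-- This is what remains of the overlap `a c (x ∧ y)` once its longest terms have cancelled. Moving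
the brackets of `g` into the last argument of `O` by the cyclic relation cancels all values of `O`;
the values of `G` cancel by the Jacobi identity. -/
theorem cyclicRelation_overlap {Φ : LinearMap.BilinForm k g}
    {O : g →ₗ[k] g →ₗ[k] g →ₗ[k] V} {G : g →ₗ[k] g →ₗ[k] V} {e : V}
    (hG : ∀ s t, G s t = -G t s + Φ s t • e)
    (hinv : ∀ x y z : g, Φ ⁅x, y⁆ z = -Φ y ⁅x, z⁆) (hsymm : ∀ x y, Φ x y = Φ y x)
    (hR : ∀ y s t, CyclicRelation O G e Φ y s t) (x a c b : g) :
    O ⁅a, c⁆ b x - O ⁅a, b⁆ c x + O ⁅c, b⁆ a x +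
      (O a x ⁅c, b⁆ + O a c ⁅b, x⁆ + O a b ⁅x, c⁆) - (O c x ⁅a, b⁆ + O c a ⁅b, x⁆ + O c b ⁅x, a⁆) +
      (O b x ⁅a, c⁆ + O b a ⁅c, x⁆ + O b c ⁅x, a⁆) - (O x a ⁅c, b⁆ + O x c ⁅b, a⁆ + O x b ⁅a, c⁆) +
      O ⁅x, a⁆ b c - O ⁅x, c⁆ b a + O ⁅x, b⁆ c a = 0 := by
  rw [hR ⁅a, c⁆ b x, hR ⁅a, b⁆ c x, hR ⁅c, b⁆ a x, hR ⁅x, a⁆ b c, hR ⁅x, c⁆ b a, hR ⁅x, b⁆ c a]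
  have J : ∀ p q r : g, ⁅p, ⁅q, r⁆⁆ = ⁅⁅p, q⁆, r⁆ + ⁅q, ⁅p, r⁆⁆ := leibniz_lie
  -- Skew symmetry of `G` on pairs of brackets leaves a multiple of `e`, whose coefficient is a
  -- multiple of this sum; it vanishes by invariance and the Jacobi identity.
  have W : Φ ⁅x, a⁆ ⁅b, c⁆ - Φ ⁅x, b⁆ ⁅a, c⁆ + Φ ⁅x, c⁆ ⁅a, b⁆ = 0 := by
    rw [hsymm ⁅x, b⁆, hsymm ⁅x, c⁆, ← lie_skew a c, ← lie_skew a b]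
    simp only [map_neg, LinearMap.neg_apply, hinv]
    rw [J x b c, ← lie_skew ⁅x, b⁆ c]
    simp only [map_add, map_neg]
    abel
  simp only [← lie_skew a x, ← lie_skew b x, ← lie_skew c x, ← lie_skew b a, ← lie_skew c a,
    ← lie_skew c b, map_neg, LinearMap.neg_apply, lie_neg, neg_neg]
  rw [hG ⁅b, c⁆ ⁅x, a⁆, hG ⁅a, c⁆ ⁅x, b⁆, hG ⁅a, b⁆ ⁅x, c⁆, hsymm ⁅b, c⁆ ⁅x, a⁆,
    hsymm ⁅a, c⁆ ⁅x, b⁆, hsymm ⁅a, b⁆ ⁅x, c⁆]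
  have j1 := congrArg (G x) (J a b c)
  have j2 := congrArg (G a) (J x b c)
  have j3 := congrArg (G b) (J x a c)
  have j4 := congrArg (G c) (J x a b)
  simp only [← lie_skew ⁅x, a⁆, ← lie_skew ⁅x, b⁆, ← lie_skew ⁅x, c⁆, ← lie_skew ⁅a, b⁆,
    ← lie_skew ⁅a, c⁆, neg_lie, ← lie_skew ⁅b, c⁆, map_add, map_neg] at j1 j2 j3 j4 ⊢
  have W' := congrArg (fun c : k => (3 * c) • e) W
  simp only [mul_zero, zero_smul] at W'
  linear_combination (norm := module) W' - j1 + j2 - j3 + j4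

end Trilinear

/-! ### The module of skew products: its rules and their overlap. -/

/-- Generators of the torsion extension: the central element and the skew products of the elements
of the basis. -/
inductive SkewGen (g : Type v) (ι : Type w) [LT ι] : Type (max v w)
  | e
  | pair (x y : ι) (h : x < y)

namespace SkewGen

open FreeWords

variable {k : Type u} {g : Type v} {ι : Type w} [Field k] [LieRing g] [LieAlgebra k g]
  [LinearOrder ι] (b : Module.Basis ι k g) (Φ : LinearMap.BilinForm k g)

/-- The monomial of length zero given by a generator. -/
noncomputable def mk (x : SkewGen g ι) : List ι × SkewGen g ι →₀ k := Finsupp.single ([], x) 1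

open Classical in
/-- The element of the free module that stands for the first product of two elements of the Lie
algebra. -/
noncomputable def beta : g →ₗ[k] g →ₗ[k] (List ι × SkewGen g ι →₀ k) :=
  b.constr k fun i => b.constr k fun j =>
    if h : i < j then mk (pair i j h) else
      if h : j < i then -mk (pair j i h) + Φ (b i) (b j) • mk e
      -- The diagonal value is forced by skew symmetry modulo `e`.
      else (1 / 2 * Φ (b i) (b j)) • mk e

theorem beta_basis_of_lt {i j : ι} (h : i < j) :
    beta b Φ (b i) (b j) = mk (pair i j h) := by
  simp [beta, h]

theorem beta_basis_of_gt {i j : ι} (h : j < i) :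
    beta b Φ (b i) (b j) = -mk (pair j i h) + Φ (b i) (b j) • mk e := by
  simp [beta, h, h.not_gt]

theorem beta_basis_self (i : ι) :
    beta b Φ (b i) (b i) = (1 / 2 * Φ (b i) (b i)) • mk e := by
  simp [beta]

variable {Φ} in
theorem beta_swap [CharZero k] (hsymm : ∀ x y, Φ x y = Φ y x) (y z : g) :
    beta b Φ y z = -beta b Φ z y + Φ y z • mk e := by
  let A : g →ₗ[k] g →ₗ[k] (List ι × SkewGen g ι →₀ k) :=
    LinearMap.mk₂ k (fun y z => Φ y z • mk e)
      (by intros; simp only [map_add, LinearMap.add_apply, add_smul])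
      (by intros; simp only [map_smul, LinearMap.smul_apply, smul_eq_mul, mul_smul])
      (by intros; simp only [map_add, add_smul])
      (by intros; simp only [map_smul, smul_eq_mul, mul_smul])
  suffices h : beta b Φ + (beta b Φ).flip = A by
    rw [neg_add_eq_sub, eq_sub_iff_add_eq]
    exact LinearMap.congr_fun₂ h y z
  refine b.ext fun i => b.ext fun j => ?_
  simp only [A, LinearMap.add_apply, LinearMap.flip_apply, LinearMap.mk₂_apply]
  rcases lt_trichotomy i j with h | rfl | h
  · rw [beta_basis_of_lt b Φ h, beta_basis_of_gt b Φ h, hsymm (b j) (b i), add_neg_cancel_left]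
  · rw [beta_basis_self, ← add_smul]
    congr 1
    ring
  · rw [beta_basis_of_lt b Φ h, beta_basis_of_gt b Φ h]
    abel

theorem beta_mem_supported (y z : g) : beta b Φ y z ∈ Finsupp.supported k k {m | m.1 = []} := by
  set S := Finsupp.supported k k {m : List ι × SkewGen g ι | m.1 = []} with hS
  have hmk : ∀ x, mk x ∈ S := fun x => Finsupp.single_mem_supported k 1 rfl
  suffices h : (beta b Φ).compr₂ S.mkQ = 0 by
    simpa using LinearMap.congr_fun₂ h y z
  refine b.ext fun i => b.ext fun j => ?_
  simp only [LinearMap.compr₂_apply, LinearMap.zero_apply, Submodule.mkQ_apply,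
    Submodule.Quotient.mk_eq_zero]
  rcases lt_trichotomy i j with h | rfl | h
  · rw [beta_basis_of_lt b Φ h]
    exact hmk _
  · rw [beta_basis_self]
    exact Submodule.smul_mem _ _ (hmk _)
  · rw [beta_basis_of_gt b Φ h]
    exact add_mem (neg_mem (hmk _)) (Submodule.smul_mem _ _ (hmk _))

/-- The terms of length zero in the cyclic relation. -/
noncomputable def lower (y s t : g) : List ι × SkewGen g ι →₀ k :=
  beta b Φ y ⁅t, s⁆ + beta b Φ t ⁅s, y⁆ + beta b Φ s ⁅y, t⁆ + (2 * Φ y ⁅s, t⁆) • mk e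

theorem lower_mem_supported (y s t : g) :
    lower b Φ y s t ∈ Finsupp.supported k k {m | m.1 = []} :=
  add_mem (add_mem (add_mem (beta_mem_supported b Φ _ _) (beta_mem_supported b Φ _ _))
    (beta_mem_supported b Φ _ _)) (Submodule.smul_mem _ _ (Finsupp.single_mem_supported k 1 rfl))

/-- The rules of the torsion extension. -/
inductive Rule : List ι × SkewGen g ι → (List ι × SkewGen g ι →₀ k) → Prop
  | e (a : ι) : Rule ([a], e) 0
  | pair (a x y : ι) (hxy : x < y) (hya : y < a) : Rule ([a], pair x y hxy)
      (pre k ι _ [y] (mk (pair x a (hxy.trans hya))) - pre k ι _ [x] (mk (pair y a hya)) +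
        lower b Φ (b a) (b x) (b y))

variable {b Φ}

theorem rule_leading (m : List ι × SkewGen g ι) (f) (h : Rule b Φ m f) :
    f ∈ Finsupp.supported k k {m' | lt m' m} := by
  cases h with
  | e a => exact zero_mem _
  | pair a x y hxy hya =>
    have hmk : ∀ (i : ι) (p : SkewGen g ι), i < a →
        pre k ι _ [i] (mk p) ∈ Finsupp.supported k k {m' | lt m' ([a], pair x y hxy)} := by
      intro i p hi
      rw [mk, pre_single]
      exact Finsupp.single_mem_supported k 1 (lt_of_head [] hi le_rfl)
    refine add_mem (sub_mem (hmk _ _ hya) (hmk _ _ (hxy.trans hya))) ?_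
    refine Finsupp.supported_mono ?_ (lower_mem_supported b Φ _ _ _)
    rintro ⟨w, p⟩ rfl
    exact lt_of_length_lt (by simp)

theorem rule_length (m : List ι × SkewGen g ι) (f) (h : Rule b Φ m f) : ∃ a, m.1 = [a] := by
  cases h with
  | e a => exact ⟨a, rfl⟩
  | pair a => exact ⟨a, rfl⟩

theorem rule_unique (m : List ι × SkewGen g ι) (f f') (h : Rule b Φ m f) (h' : Rule b Φ m f') :
    f = f' := by
  cases h <;> cases h' <;> rfl

section Local

variable {V : Type*} [AddCommGroup V] [Module k V]
  {E : (List ι × SkewGen g ι →₀ k) →ₗ[k] V}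

theorem holds_e {m : List ι × SkewGen g ι} (hE : HoldsBelow b (Rule b Φ) E m) (u : List ι) (a : ι)
    (hm : lt (u ++ [a], e) m) : E (pre k ι _ u (op _ b (b a) (mk e))) = 0 := by
  have := hE _ _ hm (HeadRewrites.rewrites (.mod (Rule.e a)) u)
  rw [map_zero, map_zero] at this
  rw [← this, op_basis, mk, pre_single, pre_single]
  rfl

theorem holds_e_op {m : List ι × SkewGen g ι} (hE : HoldsBelow b (Rule b Φ) E m) (u : List ι)
    (y : g) (hm : u.length + 1 < m.1.length) : E (pre k ι _ u (op _ b y (mk e))) = 0 := by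
  let A : g →ₗ[k] V :=
    { toFun := fun y => E (pre k ι _ u (op _ b y (mk e)))
      map_add' := by intros; simp
      map_smul' := by intros; simp }
  suffices h : A = 0 from LinearMap.congr_fun h y
  exact b.ext fun i => holds_e hE u i (lt_of_length_lt (by simpa))

theorem holds_pair {m : List ι × SkewGen g ι} (hE : HoldsBelow b (Rule b Φ) E m) (u : List ι)
    {a x y : ι} (hxy : x < y) (hya : y < a) (hm : lt (u ++ [a], pair x y hxy) m) :
    E (pre k ι _ u (op _ b (b a) (beta b Φ (b x) (b y)))) =
      E (pre k ι _ u (op _ b (b y) (beta b Φ (b x) (b a)))) -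
      E (pre k ι _ u (op _ b (b x) (beta b Φ (b y) (b a)))) +
      E (pre k ι _ u (lower b Φ (b a) (b x) (b y))) := by
  have := hE _ _ hm (HeadRewrites.rewrites (.mod (Rule.pair a x y hxy hya)) u)
  rw [beta_basis_of_lt b Φ hxy, beta_basis_of_lt b Φ hya, beta_basis_of_lt b Φ (hxy.trans hya),
    op_basis, op_basis, op_basis, ← map_sub, ← map_add, ← map_sub, ← map_add, ← this]
  simp [mk, pre_single]

/-- For the generator `e` both sides vanish. For `x ∧ y` with `x < y < c < a`, the full cyclic
relation is already available on words with one letter after `u`, and the two-letter words are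
related by the ordered rules alone. -/
theorem local_overlap [CharZero k] (hinv : ∀ x y z : g, Φ ⁅x, y⁆ z = -Φ y ⁅x, z⁆)
    (hsymm : ∀ x y, Φ x y = Φ y x) (u : List ι) (a c : ι) (p : SkewGen g ι)
    (f : List ι × SkewGen g ι →₀ k) (hca : c < a) (hf : Rule b Φ ([c], p) f)
    (hE : HoldsBelow b (Rule b Φ) E (u ++ [a, c], p)) :
    E (pre k ι _ u (pre k ι _ [c] (pre k ι _ [a] (Finsupp.single ([], p) 1)) +
        op _ b ⁅b a, b c⁆ (Finsupp.single ([], p) 1))) = E (pre k ι _ (u ++ [a]) f) := by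
  have hlt : ∀ (i j : ι) (q : SkewGen g ι), i < a → lt (u ++ [i, j], q) (u ++ [a, c], p) :=
    fun i j q h => lt_of_head u h le_rfl
  cases hf with
  | e =>
    have h1 := holds_e hE (u ++ [c]) a (by simpa using hlt c a e hca)
    have h2 := holds_e_op hE u ⁅b a, b c⁆ (by simp)
    rw [pre_append, op_basis] at h1
    rw [map_zero, map_zero, map_add, map_add]
    exact (congrArg₂ (· + ·) h1 h2).trans (add_zero _)
  | pair _ x y hxy hyc =>
    let O : g →ₗ[k] g →ₗ[k] g →ₗ[k] V :=
      { toFun := fun y => (beta b Φ).compr₂ (E ∘ₗ pre k ι _ u ∘ₗ op _ b y)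
        map_add' := by intros; ext; simp
        map_smul' := by intros; ext; simp }
    let G : g →ₗ[k] g →ₗ[k] V := (beta b Φ).compr₂ (E ∘ₗ pre k ι _ u)
    have hO : ∀ y s t, O y s t = E (pre k ι _ u (op _ b y (beta b Φ s t))) := fun _ _ _ => rfl
    have hO' : ∀ y s t, O y s t = -O y t s := fun y s t => by
      rw [hO, hO, beta_swap b hsymm s t]
      simp only [map_add, map_neg, map_smul]
      rw [holds_e_op hE u y (by simp), smul_zero, add_zero]
    have hG : ∀ s t, G s t = -G t s + Φ s t • E (pre k ι _ u (mk e)) := fun s t => by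
      simp only [G, LinearMap.compr₂_apply, LinearMap.comp_apply]
      rw [beta_swap b hsymm s t]
      simp
    have hlow : ∀ y s t, E (pre k ι _ u (lower b Φ y s t)) =
        G y ⁅t, s⁆ + G t ⁅s, y⁆ + G s ⁅y, t⁆ + (2 * Φ y ⁅s, t⁆) • E (pre k ι _ u (mk e)) := by
      intro y s t
      simp [lower, G]
    have hOlow : ∀ z y s t, E (pre k ι _ u (op _ b z (lower b Φ y s t))) =
        O z y ⁅t, s⁆ + O z t ⁅s, y⁆ + O z s ⁅y, t⁆ := by
      intro z y s t
      simp only [lower, map_add, map_smul, hO]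
      rw [holds_e_op hE u z (by simp), smul_zero, add_zero]
    -- Words with one letter after `u` are shorter than the overlap, so every instance of the rule
    -- on them may be used.
    have hR : ∀ y s t, CyclicRelation O G (E (pre k ι _ u (mk e))) Φ y s t := by
      refine cyclicRelation_of_basis hO' hinv b fun a' x y hxy hya => ?_
      rw [CyclicRelation, hO, hO, hO, holds_pair hE u hxy hya (lt_of_length_lt (by simp)), hlow]
    have key := cyclicRelation_overlap hG hinv hsymm hR (b a) (b c) (b y) (b x)
    have sw : ∀ (i j s t : ι), j < i → ∀ hst : s < t,
        lt (u ++ [i, j], (pair s t hst : SkewGen g ι)) (u ++ [a, c], pair x y hxy) →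
        E (pre k ι _ u (op _ b (b i) (op _ b (b j) (beta b Φ (b s) (b t))))) =
        E (pre k ι _ u (op _ b (b j) (op _ b (b i) (beta b Φ (b s) (b t))))) +
        O ⁅b i, b j⁆ (b s) (b t) := by
      intro i j s t hji hst h
      rw [hO, beta_basis_of_lt b Φ hst, op_basis, op_basis]
      exact hE.swap u hji [] _ h
    have pr : ∀ (i s t : ι), i < a → ∀ (hst : s < t) (hta : t < a),
        E (pre k ι _ u (op _ b (b i) (op _ b (b a) (beta b Φ (b s) (b t))))) =
        E (pre k ι _ u (op _ b (b i) (op _ b (b t) (beta b Φ (b s) (b a))))) -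
        E (pre k ι _ u (op _ b (b i) (op _ b (b s) (beta b Φ (b t) (b a))))) +
        (O (b i) (b a) ⁅b t, b s⁆ + O (b i) (b t) ⁅b s, b a⁆ + O (b i) (b s) ⁅b a, b t⁆) := by
      intro i s t hia hst hta
      have := holds_pair hE (u ++ [i]) hst hta (by simpa using hlt i a _ hia)
      simpa only [pre_append, ← op_basis b, hOlow] using this
    have hya := hyc.trans hca
    have hxc := hxy.trans hyc
    have hxa := hxy.trans hya
    have hlt' : ∀ (j : ι) (q : SkewGen g ι), j < c →
        lt (u ++ [a, j], q) (u ++ [a, c], pair x y hxy) := fun j q h =>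
      lt_append u (m := ([a, j], q)) (n := ([a, c], _)) (lt_of_head [a] h le_rfl)
    -- Only rules applied to monomials below `u a c (x ∧ y)` are used. They bring both results to
    -- common two-letter terms; the discrepancy is `key`.
    have e1 := pr c x y hca hxy hya
    have e2 := sw a y x c hya hxc (hlt' _ _ hyc)
    have e3 := pr y x c hya hxc hca
    have e4 := sw a x y c hxa hyc (hlt' _ _ hxc)
    have e5 := pr x y c hxa hyc hca
    have e6 := sw c y x a hyc hxa (hlt _ _ _ hca)
    have e7 := sw c x y a hxc hya (hlt _ _ _ hca)
    have e8 := sw y x c a hxy hca (hlt _ _ _ hya)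
    have hm : (Finsupp.single ([], pair x y hxy) 1 : List ι × SkewGen g ι →₀ k) =
        beta b Φ (b x) (b y) := (beta_basis_of_lt b Φ hxy).symm
    rw [hm, ← beta_basis_of_lt b Φ hyc, ← beta_basis_of_lt b Φ hxc]
    simp only [pre_append, ← op_basis b, map_add, map_sub, hOlow]
    rw [← hO, e1, e2, e3, e4, e5, e6, e7, e8]
    linear_combination (norm := module) key

end Local

end SkewGen

/-! ### Modules over `g` presented by rewriting rules. -/

/-- The bracket is represented by commutators. -/
def IsLieRep {k g M : Type*} [Field k] [LieRing g] [LieAlgebra k g] [AddCommGroup M] [Module k M]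
    (σ : g →ₗ[k] Module.End k M) : Prop :=
  ∀ y z v, σ ⁅y, z⁆ v = σ y (σ z v) - σ z (σ y v)

section EnvModule

open FreeWords RewritingRules

variable {k : Type*} {g : Type*} {ι : Type*} {X : Type*} [Field k] [LieRing g] [LieAlgebra k g]
  [LinearOrder ι]

/-- The module over the Lie algebra defined by generators and rewriting rules. -/
abbrev EnvModule (b : Module.Basis ι k g) (mod : List ι × X → (List ι × X →₀ k) → Prop) : Type _ :=
  (List ι × X →₀ k) ⧸ (envRules b mod).relations

namespace EnvModule

variable {b : Module.Basis ι k g} {mod : List ι × X → (List ι × X →₀ k) → Prop}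

variable (b mod) in
/-- The class of a generator. -/
noncomputable def gen (x : X) : EnvModule b mod :=
  (envRules b mod).relations.mkQ (Finsupp.single ([], x) 1)

theorem op_mem (y : g) {f : List ι × X →₀ k} (hf : f ∈ (envRules b mod).relations) :
    op X b y f ∈ (envRules b mod).relations := by
  let A : g →ₗ[k] EnvModule b mod :=
    { toFun := fun y => (envRules b mod).relations.mkQ (op X b y f)
      map_add' := by intros; simp
      map_smul' := by intros; simp }
  suffices h : A = 0 from (Submodule.Quotient.mk_eq_zero _).1 (LinearMap.congr_fun h y)
  refine b.ext fun i => (Submodule.Quotient.mk_eq_zero _).2 ?_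
  rw [op_basis]
  refine Submodule.span_induction (p := fun f _ => pre k ι X [i] f ∈ (envRules b mod).relations)
    ?_ (by simp) (fun f f' _ _ h h' => by rw [map_add]; exact add_mem h h')
    (fun c f _ h => by rw [map_smul]; exact Submodule.smul_mem _ c h) hf
  rintro _ ⟨⟨u, x⟩, r, hr, rfl⟩
  rw [map_sub, pre_single]
  exact single_sub_mem_relations (hr.cons i)

variable (b mod) in
/-- The action of the Lie algebra. -/
noncomputable def act : g →ₗ[k] Module.End k (EnvModule b mod) where
  toFun y := Submodule.mapQ _ _ (op X b y) fun _ h => op_mem y h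
  map_add' y z := by ext; simp
  map_smul' c y := by ext; simp

theorem act_mk (y : g) (f : List ι × X →₀ k) :
    act b mod y ((envRules b mod).relations.mkQ f) =
      (envRules b mod).relations.mkQ (op X b y f) := rfl

theorem act_basis_mk (i : ι) (u : List ι) (x : X) :
    act b mod (b i) ((envRules b mod).relations.mkQ (Finsupp.single (u, x) 1)) =
      (envRules b mod).relations.mkQ (Finsupp.single (i :: u, x) 1) := by
  rw [act_mk, op_basis, pre_single]
  rfl

theorem mkQ_eq_of_rewrites {m : List ι × X} {r : List ι × X →₀ k}
    (h : (envRules b mod).Rewrites m r) :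
    (envRules b mod).relations.mkQ (Finsupp.single m 1) = (envRules b mod).relations.mkQ r :=
  (Submodule.Quotient.eq _).2 (single_sub_mem_relations h)

theorem induction {p : EnvModule b mod → Prop} (zero : p 0)
    (add : ∀ n n', p n → p n' → p (n + n')) (smul : ∀ (c : k) n, p n → p (c • n))
    (gen : ∀ x, p (gen b mod x)) (act : ∀ y n, p n → p (act b mod y n)) (n : EnvModule b mod) :
    p n := by
  obtain ⟨f, rfl⟩ := Submodule.mkQ_surjective _ n
  have single : ∀ u x, p ((envRules b mod).relations.mkQ (Finsupp.single (u, x) 1)) := by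
    intro u x
    induction u with
    | nil => exact gen x
    | cons i u ih =>
      rw [← act_basis_mk]
      exact act _ _ ih
  induction f using Finsupp.induction_linear with
  | zero => rwa [map_zero]
  | add f f' h h' => rw [map_add]; exact add _ _ h h'
  | single m c =>
    rw [← mul_one c, ← smul_eq_mul, ← Finsupp.smul_single, map_smul]
    exact smul _ _ (single m.1 m.2)

/-- The swap rules say this for basis elements in decreasing order; skew symmetry and bilinearity
give the rest. -/
theorem act_lie : IsLieRep (act b mod) := by
  intro y z v
  let A : g →ₗ[k] g →ₗ[k] EnvModule b mod := LinearMap.mk₂ k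
    (fun y z => act b mod y (act b mod z v))
    (by intros; simp) (by intros; simp) (by intros; simp) (by intros; simp)
  let B : g →ₗ[k] g →ₗ[k] EnvModule b mod := LinearMap.mk₂ k
    (fun y z => act b mod ⁅y, z⁆ v)
    (by intros; simp) (by intros; simp) (by intros; simp) (by intros; simp)
  suffices h : A = A.flip + B by
    rw [eq_sub_iff_add_eq, add_comm]
    exact (LinearMap.congr_fun₂ h y z).symm
  obtain ⟨f, rfl⟩ := Submodule.mkQ_surjective _ v
  have hlt : ∀ i j : ι, j < i → A (b i) (b j) = A (b j) (b i) + B (b i) (b j) := by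
    intro i j hij
    simp only [A, B, LinearMap.mk₂_apply, act_mk, ← map_add]
    induction f using Finsupp.induction_linear with
    | zero => simp
    | add f f' h h' =>
      simp only [map_add] at h h' ⊢
      rw [h, h']
      abel
    | single m c =>
      obtain ⟨u, x⟩ := m
      rw [← mul_one c, ← smul_eq_mul, ← Finsupp.smul_single]
      simp only [map_smul, ← smul_add]
      congr 1
      have := mkQ_eq_of_rewrites (HeadRewrites.rewrites (b := b) (mod := mod)
        (.swap i j hij u x) [])
      rw [pre_nil] at this
      simp only [op_basis, pre_single] at this ⊢
      exact this
  refine b.ext fun i => b.ext fun j => ?_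
  rcases lt_trichotomy j i with h | rfl | h
  · exact hlt i j h
  · simp [A, B]
  · have h1 := hlt j i h
    have h2 : B (b j) (b i) = -B (b i) (b j) := by
      simp only [B, LinearMap.mk₂_apply]
      rw [← lie_skew, map_neg]
      rfl
    rw [LinearMap.add_apply, LinearMap.add_apply, LinearMap.flip_apply, h1, h2,
      neg_add_cancel_right]

section Lift

variable {M : Type*} [AddCommGroup M] [Module k M] (σ : g →ₗ[k] Module.End k M)
  (f : X → M)

omit [LinearOrder ι] in
theorem eval_op (y : g) (φ : List ι × X →₀ k) :
    eval (fun i => σ (b i)) f (op X b y φ) = σ y (eval (fun i => σ (b i)) f φ) := by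
  let A : g →ₗ[k] M :=
    { toFun := fun y => eval (fun i => σ (b i)) f (op X b y φ)
      map_add' := by intros; simp
      map_smul' := by intros; simp }
  let B : g →ₗ[k] M :=
    { toFun := fun y => σ y (eval (fun i => σ (b i)) f φ)
      map_add' := by intros; simp
      map_smul' := by intros; simp }
  suffices h : A = B from LinearMap.congr_fun h y
  refine b.ext fun i => ?_
  simp only [A, B, LinearMap.coe_mk, AddHom.coe_mk, op_basis]
  induction φ using Finsupp.induction_linear with
  | zero => simp
  | add φ φ' h h' => simp only [map_add, h, h']
  | single m c =>
    obtain ⟨u, x⟩ := m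
    rw [pre_single, eval_single, eval_single, map_smul]
    rfl

theorem relations_le_ker_eval (hσ : IsLieRep σ)
    (hf : ∀ m r, mod m r → eval (fun i => σ (b i)) f (Finsupp.single m 1) =
      eval (fun i => σ (b i)) f r) :
    (envRules b mod).relations ≤ LinearMap.ker (eval (fun i => σ (b i)) f) := by
  refine Submodule.span_le.2 ?_
  rintro _ ⟨m, r, h, rfl⟩
  obtain ⟨u, ⟨w, x⟩, r₀, h₀, rfl, rfl⟩ := rewrites_iff.1 h
  clear h
  rw [SetLike.mem_coe, LinearMap.mem_ker, map_sub, sub_eq_zero, ← pre_single]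
  have hpre : ∀ (i : ι) (φ : List ι × X →₀ k), eval (fun i => σ (b i)) f (pre k ι X [i] φ) =
      σ (b i) (eval (fun i => σ (b i)) f φ) := fun i φ => by rw [← op_basis b, eval_op]
  induction u with
  | nil =>
    rw [pre_nil, pre_nil]
    cases h₀ with
    | swap a c hca v x =>
      have : (Finsupp.single (a :: c :: v, x) 1 : List ι × X →₀ k) =
          pre k ι X [a] (pre k ι X [c] (Finsupp.single (v, x) 1)) := by simp [pre_single]
      rw [this, map_add, hpre, hpre, hpre, hpre, eval_op, hσ]
      abel
    | mod h => exact hf _ _ h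
  | cons i u ih => rw [pre_cons, pre_cons i u r₀, hpre, hpre, ih]

/-- The homomorphism given by the images of the generators. -/
noncomputable def lift (hσ : IsLieRep σ)
    (hf : ∀ m r, mod m r → eval (fun i => σ (b i)) f (Finsupp.single m 1) =
      eval (fun i => σ (b i)) f r) : EnvModule b mod →ₗ[k] M :=
  (envRules b mod).relations.liftQ _ (relations_le_ker_eval σ f hσ hf)

variable {σ f} (hσ : IsLieRep σ)
    (hf : ∀ m r, mod m r → eval (fun i => σ (b i)) f (Finsupp.single m 1) =
      eval (fun i => σ (b i)) f r)

theorem lift_gen (x : X) : lift σ f hσ hf (gen b mod x) = f x := by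
  simp [lift, gen, eval_single]

theorem lift_act (y : g) (n : EnvModule b mod) :
    lift σ f hσ hf (act b mod y n) = σ y (lift σ f hσ hf n) := by
  obtain ⟨φ, rfl⟩ := Submodule.mkQ_surjective _ n
  exact eval_op σ f y φ

end Lift

/-- The normal form map on the quotient. -/
theorem exists_normalForm [WellFoundedLT ι]
    (hmod : ∀ m f, mod m f → f ∈ Finsupp.supported k k {m' | lt m' m})
    (hlen : ∀ m f, mod m f → ∃ a, m.1 = [a])
    (huniq : ∀ m f f', mod m f → mod m f' → f = f')
    (hover : ∀ (E : (List ι × X →₀ k) →ₗ[k] (List ι × X →₀ k)) (u : List ι) (a c : ι) (x : X)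
      (f : List ι × X →₀ k), c < a → mod ([c], x) f →
      HoldsBelow b mod E (u ++ [a, c], x) →
      E (pre k ι X u (pre k ι X [c] (pre k ι X [a] (Finsupp.single ([], x) 1)) +
        op X b ⁅b a, b c⁆ (Finsupp.single ([], x) 1))) = E (pre k ι X (u ++ [a]) f)) :
    ∃ nf : EnvModule b mod →ₗ[k] (List ι × X →₀ k), ∀ m, (envRules b mod).Normal m →
      nf ((envRules b mod).relations.mkQ (Finsupp.single m 1)) = Finsupp.single m 1 := by
  have wf : WellFounded (lt (ι := ι) (X := X)) :=
    WellFounded.prod_lex (List.Shortlex.wf wellFounded_lt)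
      ⟨fun _ => ⟨_, fun _ h => h.elim⟩⟩
  obtain ⟨nf, h1, h2⟩ := RewritingRules.exists_normalForm wf (envRules_leading (b := b) hmod)
    fun m r r' h h' E hE => local_confluence hmod hlen huniq (hover E) m r r' h h' hE
  refine ⟨(envRules b mod).relations.liftQ nf (Submodule.span_le.2 ?_), fun m hm => ?_⟩
  · rintro _ ⟨m, r, h, rfl⟩
    rw [SetLike.mem_coe, LinearMap.mem_ker, map_sub, h1 m r h, sub_self]
  · exact h2 m hm

theorem normal_of_sorted {u : List ι} {x : X} (hu : u.Pairwise (· ≤ ·))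
    (hmod : ∀ u' w r, mod (w, x) r → u ≠ u' ++ w) : (envRules b mod).Normal (u, x) := by
  intro r hr
  obtain ⟨u', n, r₀, h, hn, -⟩ := rewrites_iff.1 hr
  obtain ⟨rfl, rfl⟩ := Prod.mk.inj hn
  cases h with
  | swap a c hca v x =>
    have h1 := (List.pairwise_append.1 hu).2.1
    exact absurd (List.rel_of_pairwise_cons h1 (by simp)) hca.not_ge
  | mod h => exact hmod u' _ _ h rfl

end EnvModule

end EnvModule

/-! ### Associative conformal algebras of the form `k[∂] ⊗ P ⊕ Q`. -/

/-- An associative algebra `P` with the maps that make `k[∂] ⊗ P ⊕ Q`, where `∂ w = δ w` for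
`w ∈ Q`, an associative conformal algebra with `p ₍₀₎ q = mul p q` and `p ₍₁₎ q = β p q`. -/
structure TorsionData (k P Q : Type*) [Field k] [AddCommGroup P] [Module k P] [AddCommGroup Q]
    [Module k Q] where
  mul : P →ₗ[k] P →ₗ[k] P
  β : P →ₗ[k] P →ₗ[k] Q
  δ : Q →ₗ[k] P
  mul_assoc : ∀ p q r, mul p (mul q r) = mul (mul p q) r
  δ_mul : ∀ w q, mul (δ w) q = 0
  mul_δ : ∀ p w, mul p (δ w) = δ (β p (δ w))
  β_δβ : ∀ p q r, β p (δ (β q r)) = β (mul p q) r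
  β_mul : ∀ p q r, β p (mul q r) = β (mul p q) r - β (δ (β p q)) r
  β_δ_δ : ∀ w w', β (δ w) (δ w') = 0

section TorsionExtension

variable {k P Q : Type*} [Field k] [AddCommGroup P] [Module k P] [AddCommGroup Q] [Module k Q]

/-- The space `k[∂] ⊗ P ⊕ Q`. -/
@[nolint unusedArguments]
def TorsionExtension (_T : TorsionData k P Q) : Type _ := (ℕ →₀ P) × Q

namespace TorsionExtension

variable (T : TorsionData k P Q)

noncomputable instance : AddCommGroup (TorsionExtension T) :=
  inferInstanceAs (AddCommGroup ((ℕ →₀ P) × Q))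
noncomputable instance : Module k (TorsionExtension T) :=
  inferInstanceAs (Module k ((ℕ →₀ P) × Q))

/-- The map defined by its values on `∂ ^ i p` and on `Q`. -/
noncomputable def desc {V : Type*} [AddCommGroup V] [Module k V] (f : ℕ → P →ₗ[k] V)
    (f' : Q →ₗ[k] V) : TorsionExtension T →ₗ[k] V :=
  LinearMap.coprod (Finsupp.lsum k f) f'

/-- The element `∂ ^ i p`. -/
noncomputable def dp (i : ℕ) : P →ₗ[k] TorsionExtension T :=
  LinearMap.inl k (ℕ →₀ P) Q ∘ₗ Finsupp.lsingle i

/-- The element `∂ ^ i w`. -/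
noncomputable def dq : ℕ → Q →ₗ[k] TorsionExtension T
  | 0 => LinearMap.inr k (ℕ →₀ P) Q
  | i + 1 => dp T i ∘ₗ T.δ

variable {T}

theorem dq_succ (i : ℕ) (w : Q) : dq T (i + 1) w = dp T i (T.δ w) := rfl

section Desc

variable {V : Type*} [AddCommGroup V] [Module k V]

theorem desc_dp (f : ℕ → P →ₗ[k] V) (f' : Q →ₗ[k] V) (i : ℕ) (p : P) :
    desc T f f' (dp T i p) = f i p := by
  change Finsupp.lsum k f (Finsupp.single i p) + f' 0 = f i p
  simp

theorem desc_dq_zero (f : ℕ → P →ₗ[k] V) (f' : Q →ₗ[k] V) (w : Q) :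
    desc T f f' (dq T 0 w) = f' w := by
  change Finsupp.lsum k f 0 + f' w = f' w
  simp

theorem ext {f f' : TorsionExtension T →ₗ[k] V} (h : ∀ i p, f (dp T i p) = f' (dp T i p))
    (h' : ∀ w, f (dq T 0 w) = f' (dq T 0 w)) : f = f' :=
  LinearMap.prod_ext (Finsupp.lhom_ext h) (LinearMap.ext h')

end Desc

variable (T)

/-- The operator `∂`. -/
noncomputable def der : TorsionExtension T →ₗ[k] TorsionExtension T :=
  desc T (fun i => dp T (i + 1)) (dq T 1)

/-- `n!` times the coefficient at `λ ^ n ∂ ^ (i + j - n)` of `(-λ) ^ i (λ + ∂) ^ j`. -/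
noncomputable def coef (k : Type*) [Field k] (n i j : ℕ) : k :=
  if i ≤ n then (-1) ^ i * (n.factorial : k) * (j.choose (n - i) : k) else 0

/-- The products `∂ ^ i p ₍ₙ₎ ∂ ^ j q`. -/
noncomputable def prodPP (n i j : ℕ) : P →ₗ[k] P →ₗ[k] TorsionExtension T :=
  coef k n i j • T.mul.compr₂ (dp T (i + j - n)) -
    coef k n (i + 1) j • T.β.compr₂ (dq T (i + 1 + j - n))

/-- The products `∂ ^ i p ₍ₙ₎ w`. -/
noncomputable def prodPQ (n i : ℕ) : P →ₗ[k] Q →ₗ[k] TorsionExtension T :=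
  coef k n i 0 • (T.β.compl₂ T.δ).compr₂ (dq T (i + 0 - n))

/-- The products `w ₍ₙ₎ ∂ ^ j q`. -/
noncomputable def prodQP (n j : ℕ) : Q →ₗ[k] P →ₗ[k] TorsionExtension T :=
  -coef k n 0 j • (T.β ∘ₗ T.δ).compr₂ (dq T (0 + j - n))

/-- The `n`-th product. -/
noncomputable def prod (n : ℕ) :
    TorsionExtension T →ₗ[k] TorsionExtension T →ₗ[k] TorsionExtension T :=
  desc T (fun i => (desc T (fun j => (prodPP T n i j).flip) (prodPQ T n i).flip).flip)
    (desc T (fun j => (prodQP T n j).flip) 0).flip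

variable {T}

theorem der_dp (i : ℕ) (p : P) : der T (dp T i p) = dp T (i + 1) p := desc_dp _ _ i p

theorem der_dq (i : ℕ) (w : Q) : der T (dq T i w) = dq T (i + 1) w := by
  cases i with
  | zero => exact desc_dq_zero _ _ w
  | succ i => exact der_dp i _

/-- The λ-product of `p` and `q` is `mul p q + λ β p q`, and `λ (-λ)^i = -(-λ)^(i+1)`; hence the
sign and the index `i + 1` of the second term. -/
theorem prod_dp_dp (n i j : ℕ) (p q : P) : prod T n (dp T i p) (dp T j q) =
    coef k n i j • dp T (i + j - n) (T.mul p q) -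
      coef k n (i + 1) j • dq T (i + 1 + j - n) (T.β p q) := by
  simp [prod, desc_dp, prodPP]

/-- Forced by sesquilinearity: as `p ₍₁₎ w = 0`, one has `p ₍₀₎ w = p ₍₁₎ ∂ w = β p (δ w)`. Likewise
`w ₍₀₎ q = -(∂ w ₍₁₎ q) = -β (δ w) q`. -/
theorem prod_dp_dq (n i : ℕ) (p : P) (w : Q) : prod T n (dp T i p) (dq T 0 w) =
    coef k n i 0 • dq T (i + 0 - n) (T.β p (T.δ w)) := by
  simp [prod, desc_dp, desc_dq_zero, prodPQ]

theorem prod_dq_dp (n j : ℕ) (w : Q) (q : P) : prod T n (dq T 0 w) (dp T j q) =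
    -coef k n 0 j • dq T (0 + j - n) (T.β (T.δ w) q) := by
  simp [prod, desc_dp, desc_dq_zero, prodQP]

theorem prod_dq_dq (n : ℕ) (w w' : Q) : prod T n (dq T 0 w) (dq T 0 w') = 0 := by
  simp [prod, desc_dq_zero]

theorem coef_succ_left (n i j : ℕ) {V : Type*} [AddCommGroup V] [Module k V] (f : ℕ → V) :
    coef k n (i + 1) j • f (i + 1 + j - n) =
      -((n : k) • coef k (n - 1) i j • f (i + j - (n - 1))) := by
  rcases n with _ | n
  · simp [coef]
  · have h1 : i + 1 + j - (n + 1) = i + j - n := by omega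
    have h2 : n + 1 - (i + 1) = n - i := by omega
    simp only [coef, h1, h2, Nat.add_sub_cancel, Nat.add_le_add_iff_right, Nat.factorial_succ]
    split_ifs <;> push_cast <;> module

/-- The extra factor `λ + ∂` either raises the power of `∂` or takes a `λ`. Where subtraction
truncates the exponent, that is for `i + j < n`, the coefficient on the left of the `∂` term
vanishes. -/
theorem coef_succ_right (n i j : ℕ) {V : Type*} [AddCommGroup V] [Module k V] (f : ℕ → V) :
    coef k n i (j + 1) • f (i + (j + 1) - n) =
      coef k n i j • f (i + j - n + 1) +
        (n : k) • coef k (n - 1) i j • f (i + j - (n - 1)) := by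
  have hz : ∀ n i j, i + j < n → coef k n i j = 0 := fun n i j h => by
    simp [coef, Nat.choose_eq_zero_of_lt (show j < n - i by omega)]
  have h1 : coef k n i j • f (i + j - n + 1) = coef k n i j • f (i + (j + 1) - n) := by
    rcases lt_or_ge (i + j) n with h | h
    · rw [hz _ _ _ h, zero_smul, zero_smul]
    · congr 2
      omega
  rw [h1]
  rcases n with _ | n
  · rcases Nat.eq_zero_or_pos i with rfl | hi
    · simp [coef]
    · simp [coef, Nat.not_le.2 hi]
  · have h2 : i + j - (n + 1 - 1) = i + (j + 1) - (n + 1) := by omega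
    rw [h2, ← smul_assoc, ← add_smul]
    congr 1
    simp only [coef, Nat.add_sub_cancel, Nat.factorial_succ, smul_eq_mul]
    rcases lt_trichotomy i (n + 1) with h | rfl | h
    · have h4 : n + 1 - i = n - i + 1 := by omega
      rw [if_pos h.le, if_pos h.le, if_pos (by omega), h4, Nat.choose_succ_succ]
      push_cast
      ring
    · simp
    · simp [h.not_ge, show ¬ i ≤ n by omega]

theorem prod_der_left (n : ℕ) (x y : TorsionExtension T) :
    prod T n (der T x) y = -((n : k) • prod T (n - 1) x y) := by
  suffices h : prod T n ∘ₗ der T = -((n : k) • prod T (n - 1)) by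
    simpa using LinearMap.congr_fun₂ h x y
  refine ext (fun i p => ext (fun j q => ?_) fun w => ?_)
    fun w => ext (fun j q => ?_) fun w' => ?_
  · simp only [LinearMap.comp_apply, LinearMap.neg_apply, LinearMap.smul_apply, der_dp, prod_dp_dp,
      coef_succ_left n i j fun t => dp T t (T.mul p q),
      coef_succ_left n (i + 1) j fun t => dq T t (T.β p q)]
    module
  · simp only [LinearMap.comp_apply, LinearMap.neg_apply, LinearMap.smul_apply, der_dp, prod_dp_dq,
      coef_succ_left n i 0 fun t => dq T t (T.β p (T.δ w))]
  · simp only [LinearMap.comp_apply, LinearMap.neg_apply, LinearMap.smul_apply, der_dq, prod_dq_dp,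
      dq_succ, prod_dp_dp, T.δ_mul, map_zero, smul_zero, zero_sub]
    rw [coef_succ_left n 0 j fun t => dq T t (T.β (T.δ w) q)]
    module
  · simp only [LinearMap.comp_apply, LinearMap.neg_apply, LinearMap.smul_apply, der_dq, prod_dq_dq]
    rw [dq_succ, prod_dp_dq, T.β_δ_δ]
    simp

theorem prod_der_right (n : ℕ) (x y : TorsionExtension T) :
    prod T n x (der T y) = der T (prod T n x y) + (n : k) • prod T (n - 1) x y := by
  suffices h : (prod T n).compl₂ (der T) = (prod T n).compr₂ (der T) + (n : k) • prod T (n - 1) by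
    simpa using LinearMap.congr_fun₂ h x y
  refine ext (fun i p => ext (fun j q => ?_) fun w => ?_)
    fun w => ext (fun j q => ?_) fun w' => ?_
  · simp only [LinearMap.compl₂_apply, LinearMap.compr₂_apply, LinearMap.add_apply,
      LinearMap.smul_apply, der_dp, prod_dp_dp, map_sub, map_smul, der_dq,
      coef_succ_right n i j fun t => dp T t (T.mul p q),
      coef_succ_right n (i + 1) j fun t => dq T t (T.β p q)]
    module
  · simp only [LinearMap.compl₂_apply, LinearMap.compr₂_apply, LinearMap.add_apply,
      LinearMap.smul_apply, prod_dp_dq, map_smul, der_dq]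
    rw [dq_succ, prod_dp_dp, T.mul_δ,
      coef_succ_left n i 0 fun t => dq T t (T.β p (T.δ w))]
    rw [dq_succ]
    module
  · simp only [LinearMap.compl₂_apply, LinearMap.compr₂_apply, LinearMap.add_apply,
      LinearMap.smul_apply, der_dp, prod_dq_dp, map_smul, der_dq, neg_smul,
      coef_succ_right n 0 j fun t => dq T t (T.β (T.δ w) q), map_neg]
    module
  · simp only [LinearMap.compl₂_apply, LinearMap.compr₂_apply, LinearMap.add_apply,
      LinearMap.smul_apply, prod_dq_dq, der_dq]
    rw [dq_succ, prod_dq_dp, T.β_δ_δ]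
    simp

theorem induction {p : TorsionExtension T → Prop} (zero : p 0)
    (add : ∀ x y, p x → p y → p (x + y)) (dp : ∀ i q, p (dp T i q)) (dq : ∀ w, p (dq T 0 w))
    (x : TorsionExtension T) : p x := by
  obtain ⟨f, w⟩ := x
  have h : ∀ f : ℕ →₀ P, p (LinearMap.inl k (ℕ →₀ P) Q f) := fun f => by
    induction f using Finsupp.induction_linear with
    | zero => exact zero
    | add f f' h h' => rw [map_add]; exact add _ _ h h'
    | single i q => exact dp i q
  have := add _ _ (h f) (dq w)
  have e : ((f, w) : (ℕ →₀ P) × Q) = (f, 0) + (0, w) := by simp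
  exact Eq.mpr (congrArg p e) this

theorem prod_locality (x y : TorsionExtension T) : ∃ N : ℕ, ∀ n, N ≤ n → prod T n x y = 0 := by
  have hz : ∀ n i j, i + j < n → coef k n i j = 0 := fun n i j h => by
    simp [coef, Nat.choose_eq_zero_of_lt (show j < n - i by omega)]
  have hadd : ∀ f f' : ℕ → TorsionExtension T, (∃ N, ∀ n, N ≤ n → f n = 0) →
      (∃ N, ∀ n, N ≤ n → f' n = 0) → ∃ N, ∀ n, N ≤ n → f n + f' n = 0 := by
    rintro f f' ⟨N, h⟩ ⟨N', h'⟩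
    exact ⟨max N N', fun n hn => by
      rw [h n (le_trans (le_max_left _ _) hn), h' n (le_trans (le_max_right _ _) hn), add_zero]⟩
  induction x using induction with
  | zero => exact ⟨0, fun n _ => by simp⟩
  | add x x' h h' => simpa using hadd _ _ h h'
  | dp i p =>
    induction y using induction with
    | zero => exact ⟨0, fun n _ => by simp⟩
    | add y y' h h' => simpa using hadd _ _ h h'
    | dp j q =>
      refine ⟨i + j + 2, fun n hn => ?_⟩
      rw [prod_dp_dp, hz _ _ _ (by omega), hz _ _ _ (by omega)]
      simp
    | dq w =>
      refine ⟨i + 1, fun n hn => ?_⟩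
      rw [prod_dp_dq, hz _ _ _ (by omega), zero_smul]
  | dq w =>
    induction y using induction with
    | zero => exact ⟨0, fun n _ => by simp⟩
    | add y y' h h' => simpa using hadd _ _ h h'
    | dp j q =>
      refine ⟨j + 1, fun n hn => ?_⟩
      rw [prod_dq_dp, hz _ _ _ (by omega), neg_zero, zero_smul]
    | dq w' => exact ⟨0, fun n _ => prod_dq_dq n w w'⟩

noncomputable instance : ConformalAlgebra k (TorsionExtension T) where
  D := der T
  nprod := prod T
  locality := prod_locality
  nprod_D_left := prod_der_left
  nprod_D_right := prod_der_right

open ConformalAlgebra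

theorem D_dp (i : ℕ) (p : P) : D (k := k) (dp T i p) = dp T (i + 1) p := der_dp i p

theorem D_dq (i : ℕ) (w : Q) : D (k := k) (dq T i w) = dq T (i + 1) w := der_dq i w

theorem nprod_zero_dp_dp (p q : P) :
    nprod (k := k) 0 (dp T 0 p) (dp T 0 q) = dp T 0 (T.mul p q) :=
  (prod_dp_dp 0 0 0 p q).trans (by simp [coef])

theorem nprod_one_dp_dp (p q : P) :
    nprod (k := k) 1 (dp T 0 p) (dp T 0 q) = dq T 0 (T.β p q) :=
  (prod_dp_dp 1 0 0 p q).trans (by simp [coef])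

theorem nprod_dp_dp {n : ℕ} (hn : 2 ≤ n) (p q : P) :
    nprod (k := k) n (dp T 0 p) (dp T 0 q) = 0 := by
  refine (prod_dp_dp n 0 0 p q).trans ?_
  simp [coef, Nat.choose_eq_zero_of_lt (show 0 < n by omega),
    Nat.choose_eq_zero_of_lt (show 0 < n - 1 by omega)]

theorem nprod_zero_dp_dq (p : P) (w : Q) :
    nprod (k := k) 0 (dp T 0 p) (dq T 0 w) = dq T 0 (T.β p (T.δ w)) :=
  (prod_dp_dq 0 0 p w).trans (by simp [coef])

theorem nprod_dp_dq {n : ℕ} (hn : 1 ≤ n) (p : P) (w : Q) :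
    nprod (k := k) n (dp T 0 p) (dq T 0 w) = 0 := by
  refine (prod_dp_dq n 0 p w).trans ?_
  simp [coef, Nat.choose_eq_zero_of_lt (show 0 < n by omega)]

theorem nprod_zero_dq_dp (w : Q) (p : P) :
    nprod (k := k) 0 (dq T 0 w) (dp T 0 p) = -dq T 0 (T.β (T.δ w) p) :=
  (prod_dq_dp 0 0 w p).trans (by simp [coef])

theorem nprod_dq_dp {n : ℕ} (hn : 1 ≤ n) (w : Q) (p : P) :
    nprod (k := k) n (dq T 0 w) (dp T 0 p) = 0 := by
  refine (prod_dq_dp n 0 w p).trans ?_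
  simp [coef, Nat.choose_eq_zero_of_lt (show 0 < n by omega)]

theorem nprod_dq_dq (n : ℕ) (w w' : Q) :
    nprod (k := k) n (dq T 0 w) (dq T 0 w') = 0 := prod_dq_dq n w w'

/-- The elements that generate the algebra over `k[∂]`. -/
def IsDegreeZero (x : TorsionExtension T) : Prop := (∃ p, x = dp T 0 p) ∨ ∃ w, x = dq T 0 w

theorem induction_D {p : TorsionExtension T → Prop} (zero : p 0)
    (add : ∀ x y, p x → p y → p (x + y)) (D : ∀ x, p x → p (D (k := k) x))
    (mem : ∀ x, IsDegreeZero x → p x) (x : TorsionExtension T) : p x := by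
  refine induction zero add (fun i q => ?_) (fun w => mem _ (.inr ⟨w, rfl⟩)) x
  induction i with
  | zero => exact mem _ (.inl ⟨q, rfl⟩)
  | succ i ih => rw [← D_dp]; exact D _ ih

theorem IsDegreeZero.nprod_of_two_le {x y : TorsionExtension T} (hx : IsDegreeZero x)
    (hy : IsDegreeZero y) {n : ℕ} (hn : 2 ≤ n) : nprod (k := k) n x y = 0 := by
  obtain ⟨p, rfl⟩ | ⟨w, rfl⟩ := hx <;> obtain ⟨q, rfl⟩ | ⟨w', rfl⟩ := hy
  · exact nprod_dp_dp hn p q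
  · exact nprod_dp_dq (by omega) p w'
  · exact nprod_dq_dp (by omega) w q
  · exact nprod_dq_dq n w w'

theorem IsDegreeZero.nprod_zero {x y : TorsionExtension T} (hx : IsDegreeZero x)
    (hy : IsDegreeZero y) : IsDegreeZero (nprod (k := k) 0 x y) := by
  obtain ⟨p, rfl⟩ | ⟨w, rfl⟩ := hx <;> obtain ⟨q, rfl⟩ | ⟨w', rfl⟩ := hy
  · exact .inl ⟨_, nprod_zero_dp_dp p q⟩
  · exact .inr ⟨_, nprod_zero_dp_dq p w'⟩
  · exact .inr ⟨_, (nprod_zero_dq_dp w q).trans (map_neg _ _).symm⟩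
  · exact .inr ⟨0, (nprod_dq_dq 0 w w').trans (map_zero _).symm⟩

theorem IsDegreeZero.nprod_one {x y : TorsionExtension T} (hx : IsDegreeZero x)
    (hy : IsDegreeZero y) : ∃ w, nprod (k := k) 1 x y = dq T 0 w := by
  obtain ⟨p, rfl⟩ | ⟨w, rfl⟩ := hx <;> obtain ⟨q, rfl⟩ | ⟨w', rfl⟩ := hy
  · exact ⟨_, nprod_one_dp_dp p q⟩
  · exact ⟨0, (nprod_dp_dq le_rfl p w').trans (map_zero _).symm⟩
  · exact ⟨0, (nprod_dq_dp le_rfl w q).trans (map_zero _).symm⟩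
  · exact ⟨0, (nprod_dq_dq 1 w w').trans (map_zero _).symm⟩

theorem IsDegreeZero.nprod {x y : TorsionExtension T} (hx : IsDegreeZero x)
    (hy : IsDegreeZero y) (n : ℕ) : IsDegreeZero (ConformalAlgebra.nprod (k := k) n x y) := by
  rcases n with _ | _ | n
  · exact hx.nprod_zero hy
  · exact .inr (hx.nprod_one hy)
  · exact .inr ⟨0, (hx.nprod_of_two_le hy (by omega)).trans (map_zero _).symm⟩

theorem IsDegreeZero.nprod_dq {x : TorsionExtension T} (hx : IsDegreeZero x) (w : Q) {n : ℕ}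
    (hn : 1 ≤ n) : ConformalAlgebra.nprod (k := k) n x (dq T 0 w) = 0 := by
  obtain ⟨p, rfl⟩ | ⟨w', rfl⟩ := hx
  · exact nprod_dp_dq hn p w
  · exact nprod_dq_dq n w' w

theorem IsDegreeZero.dq_nprod {x : TorsionExtension T} (hx : IsDegreeZero x) (w : Q) {n : ℕ}
    (hn : 1 ≤ n) : ConformalAlgebra.nprod (k := k) n (dq T 0 w) x = 0 := by
  obtain ⟨p, rfl⟩ | ⟨w', rfl⟩ := hx
  · exact nprod_dq_dp hn w p
  · exact nprod_dq_dq n w w'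

/-- First products of such elements lie in `Q`, products of index at least two vanish, and elements
of `Q` have only zeroth products. So only the indices `(0, 0)`, `(0, 1)` and `(1, 0)` carry content,
and these follow from the axioms of `TorsionData`. -/
theorem assocAt {x y z : TorsionExtension T} (hx : IsDegreeZero x) (hy : IsDegreeZero y)
    (hz : IsDegreeZero z) : AssocAt k x y z := by
  have hδβ : ∀ w q r, T.β (T.δ w) (T.mul q r) = -T.β (T.δ (T.β (T.δ w) q)) r := fun w q r => by
    rw [T.β_mul, T.δ_mul, map_zero, LinearMap.zero_apply, zero_sub]
  intro n m
  rcases n with _ | _ | n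
  · simp only [zero_add, Finset.range_one, Finset.sum_singleton, Nat.choose_self, Nat.cast_one,
      one_smul, add_zero, Nat.sub_self]
    rcases m with _ | _ | m
    · obtain ⟨p, rfl⟩ | ⟨w₁, rfl⟩ := hx <;> obtain ⟨q, rfl⟩ | ⟨w₂, rfl⟩ := hy <;>
        obtain ⟨r, rfl⟩ | ⟨w₃, rfl⟩ := hz <;>
        simp [nprod_zero_dp_dp, nprod_zero_dp_dq, nprod_zero_dq_dp, nprod_dq_dq, T.mul_assoc,
          T.β_δβ, hδβ, T.mul_δ]
    · obtain ⟨w, h⟩ := hy.nprod_one hz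
      obtain ⟨p, rfl⟩ | ⟨w₁, rfl⟩ := hx <;> obtain ⟨q, rfl⟩ | ⟨w₂, rfl⟩ := hy <;>
        obtain ⟨r, rfl⟩ | ⟨w₃, rfl⟩ := hz <;>
        simp [nprod_zero_dp_dp, nprod_zero_dp_dq, nprod_zero_dq_dp, nprod_dq_dq, nprod_one_dp_dp,
          nprod_dp_dq, nprod_dq_dp, T.β_δβ]
    · rw [hy.nprod_of_two_le hz (by omega), (hx.nprod_zero hy).nprod_of_two_le hz (by omega),
        map_zero]
  · simp only [zero_add, Finset.sum_range_succ, Finset.range_zero, Finset.sum_empty,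
      Nat.choose_zero_right, Nat.choose_self, Nat.cast_one, one_smul, add_zero, Nat.sub_zero,
      Nat.sub_self]
    rcases m with _ | m
    · obtain ⟨p, rfl⟩ | ⟨w₁, rfl⟩ := hx <;> obtain ⟨q, rfl⟩ | ⟨w₂, rfl⟩ := hy <;>
        obtain ⟨r, rfl⟩ | ⟨w₃, rfl⟩ := hz <;>
        simp [nprod_zero_dp_dp, nprod_zero_dp_dq, nprod_zero_dq_dp, nprod_dq_dq, nprod_one_dp_dp,
          nprod_dp_dq, nprod_dq_dp, T.β_mul, sub_eq_neg_add]
    · obtain ⟨w, h⟩ := hx.nprod_one hy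
      rw [h, hz.dq_nprod w (by omega), (hx.nprod_zero hy).nprod_of_two_le hz (by omega), add_zero]
      rcases m with _ | m
      · obtain ⟨w', h'⟩ := hy.nprod_one hz
        rw [h', hx.nprod_dq w' le_rfl]
      · rw [hy.nprod_of_two_le hz (by omega), map_zero]
  · rw [hx.nprod_of_two_le (hy.nprod hz m) (by omega), eq_comm]
    refine Finset.sum_eq_zero fun s hs => ?_
    rw [smul_eq_zero]
    right
    rcases lt_trichotomy s (n + 1) with h | rfl | h
    · rw [hx.nprod_of_two_le hy (by omega), map_zero, LinearMap.zero_apply]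
    · obtain ⟨w, h⟩ := hx.nprod_one hy
      rw [show n + 1 + 1 - (n + 1) = 1 by omega, h, hz.dq_nprod w (by omega)]
    · exact (hx.nprod hy _).nprod_of_two_le hz (by omega)

theorem isAssociative : IsAssociative k (TorsionExtension T) := by
  suffices h : ∀ x y z : TorsionExtension T, AssocAt k x y z from fun n m x y z => h x y z n m
  intro x y z
  induction x using induction_D with
  | zero => intro n m; simp
  | add x x' h h' => intro n m; simp [h n m, h' n m, Finset.sum_add_distrib]
  | D x h => exact h.D_left
  | mem x hx =>
  induction y using induction_D with
  | zero => intro n m; simp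
  | add x x' h h' => intro n m; simp [h n m, h' n m, Finset.sum_add_distrib]
  | D x h => exact h.D_mid
  | mem y hy =>
  induction z using induction_D with
  | zero => intro n m; simp
  | add x x' h h' => intro n m; simp [h n m, h' n m, Finset.sum_add_distrib]
  | D x h => exact h.D_right
  | mem z hz => exact assocAt hx hy hz

end TorsionExtension

end TorsionExtension

/-! ### The free part `P`: its product and the first product on it. -/

section LieRep

variable {k g N : Type*} [Field k] [LieRing g] [LieAlgebra k g] [AddCommGroup N] [Module k N]

/-- The action on maps into a representation. -/
noncomputable def postRep (A : Type*) [AddCommGroup A] [Module k A]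
    (σ : g →ₗ[k] Module.End k N) : g →ₗ[k] Module.End k (A →ₗ[k] N) :=
  LinearMap.llcomp k A N N ∘ₗ σ

theorem IsLieRep.postRep {σ : g →ₗ[k] Module.End k N} (hσ : IsLieRep σ) (A : Type*)
    [AddCommGroup A] [Module k A] : IsLieRep (postRep A σ) :=
  fun y z F => LinearMap.ext fun x => hσ y z (F x)

/-- The action on maps from the adjoint representation. -/
noncomputable def homRep (σ : g →ₗ[k] Module.End k N) : g →ₗ[k] Module.End k (g →ₗ[k] N) :=
  postRep g σ - (LinearMap.llcomp k g g N).flip ∘ₗ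
    LinearMap.mk₂ k (fun y a : g => ⁅y, a⁆) add_lie smul_lie lie_add fun c y a => lie_smul c y a

/-- This action models `a ₍₁₎ (y ₍₀₎ q) = y ₍₀₎ (a ₍₁₎ q) + [a, y] ₍₁₎ q`, with `f a` in the role of
`a ₍₁₎ q`; so the first product can be defined by freeness of the module. -/
theorem homRep_apply (σ : g →ₗ[k] Module.End k N) (y : g) (f : g →ₗ[k] N) (a : g) :
    homRep σ y f a = σ y (f a) + f ⁅a, y⁆ := by
  rw [← lie_skew, map_neg, ← sub_eq_add_neg]
  rfl

theorem IsLieRep.homRep {σ : g →ₗ[k] Module.End k N} (hσ : IsLieRep σ) : IsLieRep (homRep σ) := by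
  refine fun y z f => LinearMap.ext fun a => ?_
  simp only [LinearMap.sub_apply, homRep_apply, map_add]
  rw [hσ, leibniz_lie a y z, map_add, ← lie_skew ⁅a, z⁆ y, map_neg]
  abel

end LieRep

section FreeEnv

variable {k : Type*} {g : Type*} {ι : Type*} [Field k] [LieRing g] [LieAlgebra k g]
  [LinearOrder ι]

/-- The free module over the Lie algebra generated by its basis. -/
abbrev FreeEnv (b : Module.Basis ι k g) : Type _ :=
  EnvModule b (fun (_ : List ι × ι) _ => False)

namespace FreeEnv

variable {b : Module.Basis ι k g}

variable (b) in
/-- The action of the Lie algebra. -/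
noncomputable abbrev act : g →ₗ[k] Module.End k (FreeEnv b) :=
  EnvModule.act b (fun (_ : List ι × ι) _ => False)

variable (b) in
/-- The generators corresponding to the elements of the Lie algebra. -/
noncomputable def hat : g →ₗ[k] FreeEnv b := b.constr k (EnvModule.gen b _)

theorem hat_basis (i : ι) : hat b (b i) = EnvModule.gen b _ i := b.constr_basis k _ i

theorem induction {p : FreeEnv b → Prop} (zero : p 0) (add : ∀ n n', p n → p n' → p (n + n'))
    (smul : ∀ (c : k) n, p n → p (c • n)) (hat : ∀ y, p (hat b y))
    (act : ∀ y n, p n → p (act b y n)) (n : FreeEnv b) : p n :=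
  EnvModule.induction zero add smul (fun x => hat_basis (b := b) x ▸ hat (b x)) act n

section Lift

variable {M : Type*} [AddCommGroup M] [Module k M] {σ : g →ₗ[k] Module.End k M}
  (hσ : IsLieRep σ) (f : g →ₗ[k] M)

variable (b) in
/-- The homomorphism given by the images of the generators. -/
noncomputable def lift : FreeEnv b →ₗ[k] M :=
  EnvModule.lift σ (fun i => f (b i)) hσ fun _ _ h => h.elim

theorem lift_hat (y : g) : lift b hσ f (hat b y) = f y := by
  suffices h : lift b hσ f ∘ₗ hat b = f from LinearMap.congr_fun h y
  refine b.ext fun i => ?_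
  rw [LinearMap.comp_apply, hat_basis]
  exact EnvModule.lift_gen hσ _ i

theorem lift_act (y : g) (p : FreeEnv b) :
    lift b hσ f (act b y p) = σ y (lift b hσ f p) := EnvModule.lift_act hσ _ y p

end Lift

section Pi

variable {M : Type*} [AddCommGroup M] [Module k M] {σ : g →ₗ[k] Module.End k M}
  (hσ : IsLieRep σ)

variable (b) in
/-- The operators given by the elements of the free module, a generator acting as the corresponding
element of the Lie algebra. -/
noncomputable def pi : FreeEnv b →ₗ[k] Module.End k M := lift b (hσ.postRep M) σ

theorem pi_hat (y : g) : pi b hσ (hat b y) = σ y := lift_hat _ _ y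

theorem pi_act (y : g) (p : FreeEnv b) (m : M) :
    pi b hσ (act b y p) m = σ y (pi b hσ p m) :=
  LinearMap.congr_fun (lift_act (hσ.postRep M) σ y p) m

theorem map_pi {M' : Type*} [AddCommGroup M'] [Module k M'] {σ' : g →ₗ[k] Module.End k M'}
    (hσ' : IsLieRep σ') (F : M →ₗ[k] M') (hF : ∀ y m, F (σ y m) = σ' y (F m)) (p : FreeEnv b)
    (m : M) : F (pi b hσ p m) = pi b hσ' p (F m) := by
  induction p using induction with
  | zero => simp
  | add p p' h h' => simp [h, h']
  | smul c p h => simp [h]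
  | hat y => rw [pi_hat, pi_hat, hF]
  | act y p h => rw [pi_act, pi_act, hF, h]

variable (b) in
/-- The product of the free module. -/
noncomputable def mul : FreeEnv b →ₗ[k] FreeEnv b →ₗ[k] FreeEnv b := pi b EnvModule.act_lie

theorem mul_hat (y : g) (q : FreeEnv b) : mul b (hat b y) q = act b y q :=
  LinearMap.congr_fun (pi_hat _ y) q

theorem mul_act (y : g) (p q : FreeEnv b) : mul b (act b y p) q = act b y (mul b p q) :=
  pi_act _ y p q

/-- The elements of `P` act on every representation compatibly with the product; for the action of
`P` on itself this is associativity. -/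
theorem pi_mul (p q : FreeEnv b) (m : M) : pi b hσ (mul b p q) m = pi b hσ p (pi b hσ q m) := by
  induction p using induction with
  | zero => simp
  | add p p' h h' => simp [h, h']
  | smul c p h => simp [h]
  | hat y => rw [mul_hat, pi_act, pi_hat]
  | act y p h => rw [mul_act, pi_act, pi_act, h]

theorem mul_assoc (p q r : FreeEnv b) : mul b p (mul b q r) = mul b (mul b p q) r :=
  (pi_mul EnvModule.act_lie p q r).symm

end Pi

section Beta

variable {N : Type*} [AddCommGroup N] [Module k N] {σ : g →ₗ[k] Module.End k N}
  (hσ : IsLieRep σ) (β₀ : g →ₗ[k] g →ₗ[k] N)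

variable (b) in
/-- The product of elements of the Lie algebra with elements of the free module. -/
noncomputable def betaRight : FreeEnv b →ₗ[k] g →ₗ[k] N := lift b hσ.homRep β₀.flip

theorem betaRight_hat (c a : g) : betaRight b hσ β₀ (hat b c) a = β₀ a c :=
  LinearMap.congr_fun (lift_hat hσ.homRep β₀.flip c) a

theorem betaRight_act (y : g) (q : FreeEnv b) (a : g) : betaRight b hσ β₀ (act b y q) a =
    σ y (betaRight b hσ β₀ q a) + betaRight b hσ β₀ q ⁅a, y⁆ :=
  (LinearMap.congr_fun (lift_act hσ.homRep β₀.flip y q) a).trans (homRep_apply σ y _ a)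

variable (b) in
/-- The first product on the free module. -/
noncomputable def beta : FreeEnv b →ₗ[k] FreeEnv b →ₗ[k] N :=
  lift b (hσ.postRep (FreeEnv b)) (betaRight b hσ β₀).flip

theorem beta_hat (a : g) (q : FreeEnv b) : beta b hσ β₀ (hat b a) q = betaRight b hσ β₀ q a :=
  LinearMap.congr_fun (lift_hat (hσ.postRep (FreeEnv b)) (betaRight b hσ β₀).flip a) q

theorem beta_act (y : g) (p q : FreeEnv b) :
    beta b hσ β₀ (act b y p) q = σ y (beta b hσ β₀ p q) :=
  LinearMap.congr_fun (lift_act (hσ.postRep (FreeEnv b)) (betaRight b hσ β₀).flip y p) q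

theorem beta_mul_left (p q r : FreeEnv b) :
    beta b hσ β₀ (mul b p q) r = pi b hσ p (beta b hσ β₀ q r) :=
  map_pi EnvModule.act_lie hσ ((beta b hσ β₀).flip r) (fun y m => beta_act hσ β₀ y m r) p q

variable {δ : N →ₗ[k] FreeEnv b} (hδ : ∀ y n, δ (σ y n) = act b y (δ n))
  (hδβ : ∀ y z, δ (β₀ y z) = act b y (hat b z) - act b z (hat b y) - hat b ⁅y, z⁆)
include hδ hδβ

/-- This is associativity for `a ₍₁₎ (q ₍₀₎ r)`. For a generator `q` the formula for `δ β₀` is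
exactly what is required; equivariance of `δ` carries the identity through the action of `g`. -/
theorem betaRight_mul (q r : FreeEnv b) (a : g) : betaRight b hσ β₀ (mul b q r) a =
    σ a (beta b hσ β₀ q r) - beta b hσ β₀ (δ (betaRight b hσ β₀ q a)) r := by
  induction q using induction generalizing a with
  | zero => simp
  | add q q' h h' => simp only [map_add, LinearMap.add_apply, h, h']; abel
  | smul c q h => simp only [map_smul, LinearMap.smul_apply, h, smul_sub]
  | hat c =>
    rw [mul_hat, betaRight_act, betaRight_hat, hδβ, map_sub, map_sub, LinearMap.sub_apply,
      LinearMap.sub_apply, beta_act, beta_act, beta_hat, beta_hat, beta_hat]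
    abel
  | act y q h =>
    rw [mul_act, betaRight_act, h, h, betaRight_act, beta_act, map_add, map_add, hδ,
      LinearMap.add_apply, beta_act, map_sub, hσ]
    abel

theorem beta_mul_right (p q r : FreeEnv b) : beta b hσ β₀ p (mul b q r) =
    beta b hσ β₀ (mul b p q) r - beta b hσ β₀ (δ (beta b hσ β₀ p q)) r := by
  induction p using induction with
  | zero => simp
  | add q q' h h' => simp only [map_add, LinearMap.add_apply, h, h']; abel
  | smul c q h => simp only [map_smul, LinearMap.smul_apply, h, smul_sub]
  | hat a => rw [beta_hat, betaRight_mul hσ β₀ hδ hδβ, mul_hat, beta_act, beta_hat]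
  | act y p h => rw [beta_act, h, mul_act, beta_act, beta_act, hδ, beta_act, map_sub]

end Beta

end FreeEnv

end FreeEnv

/-! ### The torsion part `Q`, and the data of the conformal algebra. -/

section SkewEnv

open FreeWords

variable {k : Type u} {g : Type v} {ι : Type w} [Field k] [LieRing g] [LieAlgebra k g]
  [LinearOrder ι]

/-- The module over the Lie algebra defined by the rules of the torsion extension. -/
abbrev SkewEnv (b : Module.Basis ι k g) (Φ : LinearMap.BilinForm k g) : Type _ :=
  EnvModule b (SkewGen.Rule b Φ)

namespace SkewEnv

variable (b : Module.Basis ι k g) (Φ : LinearMap.BilinForm k g)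

/-- The action of the Lie algebra. -/
noncomputable abbrev act : g →ₗ[k] Module.End k (SkewEnv b Φ) := EnvModule.act b (SkewGen.Rule b Φ)

/-- The central element. -/
noncomputable def e : SkewEnv b Φ := EnvModule.gen b (SkewGen.Rule b Φ) .e

/-- The first product of two elements of the Lie algebra. -/
noncomputable def skew : g →ₗ[k] g →ₗ[k] SkewEnv b Φ :=
  (SkewGen.beta b Φ).compr₂ (envRules b (SkewGen.Rule b Φ)).relations.mkQ

variable {b Φ}

theorem skew_basis_of_lt {i j : ι} (h : i < j) :
    skew b Φ (b i) (b j) = EnvModule.gen b (SkewGen.Rule b Φ) (.pair i j h) :=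
  congrArg (envRules b (SkewGen.Rule b Φ)).relations.mkQ (SkewGen.beta_basis_of_lt b Φ h)

theorem skew_swap [CharZero k] (hsymm : ∀ x y, Φ x y = Φ y x) (y z : g) :
    skew b Φ y z = -skew b Φ z y + Φ y z • e b Φ := by
  have := congrArg (envRules b (SkewGen.Rule b Φ)).relations.mkQ (SkewGen.beta_swap b hsymm y z)
  simp only [map_add, map_neg, map_smul] at this
  exact this

theorem act_e (y : g) : act b Φ y (e b Φ) = 0 := by
  suffices h : (act b Φ).flip (e b Φ) = 0 from LinearMap.congr_fun h y
  refine b.ext fun i => ?_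
  have := EnvModule.mkQ_eq_of_rewrites (HeadRewrites.rewrites (.mod (SkewGen.Rule.e i)) []
    (b := b) (mod := SkewGen.Rule b Φ))
  rw [map_zero, map_zero] at this
  exact (EnvModule.act_basis_mk i [] _).trans this

variable [CharZero k] (hsymm : ∀ x y, Φ x y = Φ y x)
  (hinv : ∀ x y z : g, Φ ⁅x, y⁆ z = -Φ y ⁅x, z⁆)

include hsymm hinv in
theorem act_skew (y s t : g) : act b Φ y (skew b Φ s t) =
    act b Φ t (skew b Φ s y) - act b Φ s (skew b Φ t y) + (skew b Φ y ⁅t, s⁆ + skew b Φ t ⁅s, y⁆ +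
      skew b Φ s ⁅y, t⁆ + (2 * Φ y ⁅s, t⁆) • e b Φ) := by
  let O : g →ₗ[k] g →ₗ[k] g →ₗ[k] SkewEnv b Φ :=
    { toFun := fun y => (skew b Φ).compr₂ (act b Φ y)
      map_add' := by intros; ext; simp
      map_smul' := by intros; ext; simp }
  refine cyclicRelation_of_basis (O := O) (G := skew b Φ) (e := e b Φ) (fun y s t => ?_) hinv b
    (fun a x y hxy hya => ?_) y s t
  · change act b Φ y (skew b Φ s t) = -act b Φ y (skew b Φ t s)
    rw [skew_swap hsymm s t, map_add, map_neg, map_smul, act_e, smul_zero, add_zero]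
  · have := EnvModule.mkQ_eq_of_rewrites (HeadRewrites.rewrites (.mod (SkewGen.Rule.pair a x y hxy
      hya)) [] (b := b) (mod := SkewGen.Rule b Φ))
    rw [pre_nil, map_add, map_sub] at this
    change act b Φ (b a) (skew b Φ (b x) (b y)) = act b Φ (b y) (skew b Φ (b x) (b a)) -
      act b Φ (b x) (skew b Φ (b y) (b a)) + _
    rw [skew_basis_of_lt hxy, skew_basis_of_lt hya, skew_basis_of_lt (hxy.trans hya)]
    refine ((EnvModule.act_basis_mk _ _ _).trans this).trans ?_
    simp only [SkewGen.mk, pre_single]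
    refine congrArg₂ (· + ·) (congrArg₂ (· - ·) (EnvModule.act_basis_mk _ _ _).symm
      (EnvModule.act_basis_mk _ _ _).symm) ?_
    simp only [SkewGen.lower, map_add, map_smul]
    rfl

variable (b) in
/-- The commutators of the elements of the Lie algebra in the free module. -/
noncomputable def defect : g →ₗ[k] g →ₗ[k] FreeEnv b :=
  LinearMap.mk₂ k (fun y z => FreeEnv.act b y (FreeEnv.hat b z) -
      FreeEnv.act b z (FreeEnv.hat b y) - FreeEnv.hat b ⁅y, z⁆)
    (by intros; simp; abel) (by intros; simp [smul_sub]) (by intros; simp; abel)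
    (by intros; simp [smul_sub])

omit [CharZero k] in
theorem defect_apply (y z : g) : defect b y z = FreeEnv.act b y (FreeEnv.hat b z) -
    FreeEnv.act b z (FreeEnv.hat b y) - FreeEnv.hat b ⁅y, z⁆ := rfl

variable (b) in
/-- The derivatives of the generators. -/
noncomputable def deltaGen : SkewGen g ι → FreeEnv b
  | .e => 0
  | .pair x y _ => defect b (b x) (b y)

omit [CharZero k] in
theorem eval_beta (y z : g) : RewritingRules.eval (fun i => FreeEnv.act b (b i)) (deltaGen b)
    (SkewGen.beta b Φ y z) = defect b y z := by
  suffices h : (SkewGen.beta b Φ).compr₂ (RewritingRules.eval (fun i => FreeEnv.act b (b i))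
      (deltaGen b)) = defect b from LinearMap.congr_fun₂ h y z
  have hmk : ∀ p : SkewGen g ι, RewritingRules.eval (fun i => FreeEnv.act b (b i)) (deltaGen b)
      (SkewGen.mk p) = deltaGen b p := fun p => by
    rw [SkewGen.mk, RewritingRules.eval_single, one_smul]
    rfl
  refine b.ext fun i => b.ext fun j => ?_
  rw [LinearMap.compr₂_apply]
  rcases lt_trichotomy i j with h | rfl | h
  · rw [SkewGen.beta_basis_of_lt b Φ h, hmk]
    rfl
  · rw [SkewGen.beta_basis_self, map_smul, hmk, defect_apply]
    simp [deltaGen]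
  · rw [SkewGen.beta_basis_of_gt b Φ h, map_add, map_neg, map_smul, hmk, hmk, defect_apply,
      ← lie_skew (b i)]
    simp only [deltaGen, defect_apply, smul_zero, map_neg]
    abel

omit [CharZero k] in
-- Makes `δ` well defined: commutator defects satisfy the cyclic relation with `e` sent to `0`, by
-- the Jacobi identity.
theorem eval_rule (m : List ι × SkewGen g ι) (r : List ι × SkewGen g ι →₀ k)
    (h : SkewGen.Rule b Φ m r) :
    RewritingRules.eval (fun i => FreeEnv.act b (b i)) (deltaGen b) (Finsupp.single m 1) =
      RewritingRules.eval (fun i => FreeEnv.act b (b i)) (deltaGen b) r := by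
  cases h with
  | e a => simp [RewritingRules.eval_single, deltaGen]
  | pair a x y hxy hya =>
    have hp : ∀ (i s t : ι) (h : s < t), RewritingRules.eval (fun i => FreeEnv.act b (b i))
        (deltaGen b) (pre k ι _ [i] (SkewGen.mk (SkewGen.pair s t h))) =
        FreeEnv.act b (b i) (defect b (b s) (b t)) := by
      intro i s t h
      rw [SkewGen.mk, pre_single, RewritingRules.eval_single, one_smul]
      rfl
    have he : RewritingRules.eval (fun i => FreeEnv.act b (b i)) (deltaGen b)
        (SkewGen.mk SkewGen.e) = 0 := by
      rw [SkewGen.mk, RewritingRules.eval_single]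
      exact smul_zero _
    rw [map_add, map_sub, hp, hp, SkewGen.lower, map_add, map_add, map_add, map_smul, he,
      eval_beta, eval_beta, eval_beta, RewritingRules.eval_single, one_smul]
    change FreeEnv.act b (b a) (defect b (b x) (b y)) = _
    have hlie : ∀ x y z, FreeEnv.act b ⁅x, y⁆ (FreeEnv.hat b z) =
        FreeEnv.act b x (FreeEnv.act b y (FreeEnv.hat b z)) -
        FreeEnv.act b y (FreeEnv.act b x (FreeEnv.hat b z)) :=
      fun x y z => EnvModule.act_lie x y _
    have J := congrArg (FreeEnv.hat b) (leibniz_lie (b a) (b x) (b y))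
    rw [← lie_skew ⁅b a, b x⁆ (b y)] at J
    simp only [defect_apply, hlie, map_sub, ← lie_skew (b y) (b x), ← lie_skew (b x) (b a),
      ← lie_skew (b y) (b a), map_neg, map_add] at J ⊢
    rw [J, smul_zero]
    abel

variable (b Φ) in
/-- The derivation of the torsion extension. -/
noncomputable def delta : SkewEnv b Φ →ₗ[k] FreeEnv b :=
  EnvModule.lift (FreeEnv.act b) (deltaGen b) EnvModule.act_lie eval_rule

omit [CharZero k] in
theorem delta_act (y : g) (w : SkewEnv b Φ) :
    delta b Φ (act b Φ y w) = FreeEnv.act b y (delta b Φ w) :=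
  EnvModule.lift_act _ _ y w

omit [CharZero k] in
theorem delta_e : delta b Φ (e b Φ) = 0 := EnvModule.lift_gen _ _ _

omit [CharZero k] in
theorem delta_skew (y z : g) : delta b Φ (skew b Φ y z) = defect b y z := eval_beta y z

omit [CharZero k] in
theorem induction {p : SkewEnv b Φ → Prop} (zero : p 0)
    (add : ∀ n n', p n → p n' → p (n + n')) (smul : ∀ (c : k) n, p n → p (c • n))
    (e : p (e b Φ)) (skew : ∀ y z, p (skew b Φ y z)) (act : ∀ y n, p n → p (act b Φ y n))
    (n : SkewEnv b Φ) : p n := by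
  refine EnvModule.induction zero add smul (fun x => ?_) act n
  cases x with
  | e => exact e
  | pair x y h => exact skew_basis_of_lt (Φ := Φ) (b := b) h ▸ skew (b x) (b y)

omit [CharZero k] in
-- The defect of `y, z` acts as `y z - z y - [y, z]`, which is zero in a representation. So
-- derivatives of elements of `Q` multiply by zero from the left.
theorem pi_delta {M : Type*} [AddCommGroup M] [Module k M] {σ : g →ₗ[k] Module.End k M}
    (hσ : IsLieRep σ) (w : SkewEnv b Φ) : FreeEnv.pi b hσ (delta b Φ w) = 0 := by
  refine LinearMap.ext fun m => ?_
  rw [LinearMap.zero_apply]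
  induction w using induction with
  | zero => simp
  | add w w' h h' => rw [map_add, map_add, LinearMap.add_apply, h, h', add_zero]
  | smul c w h => rw [map_smul, map_smul, LinearMap.smul_apply, h, smul_zero]
  | e => rw [delta_e, map_zero, LinearMap.zero_apply]
  | skew y z =>
    rw [delta_skew, defect_apply, map_sub, map_sub, LinearMap.sub_apply, LinearMap.sub_apply,
      FreeEnv.pi_act, FreeEnv.pi_act, FreeEnv.pi_hat, FreeEnv.pi_hat, FreeEnv.pi_hat, hσ]
    simp
  | act y w h => rw [delta_act, FreeEnv.pi_act, h]; simp

variable (b Φ) in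
/-- The first product on the free module. -/
noncomputable def beta : FreeEnv b →ₗ[k] FreeEnv b →ₗ[k] SkewEnv b Φ :=
  FreeEnv.beta b EnvModule.act_lie (skew b Φ)

include hsymm hinv in
-- The consistency condition `a ₍₁₎ ∂ w = a ₍₀₎ w`. On a skew product it amounts to the cyclic
-- relation, which is why `Q` must satisfy it.
theorem betaRight_delta (w : SkewEnv b Φ) (a : g) :
    FreeEnv.betaRight b EnvModule.act_lie (skew b Φ) (delta b Φ w) a = act b Φ a w := by
  induction w using induction generalizing a with
  | zero => simp
  | add w w' h h' => simp only [map_add, LinearMap.add_apply, h, h']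
  | smul c w h => simp only [map_smul, LinearMap.smul_apply, h]
  | e => rw [delta_e, map_zero, act_e, LinearMap.zero_apply]
  | skew s t =>
    rw [delta_skew, defect_apply, map_sub, map_sub, LinearMap.sub_apply, LinearMap.sub_apply,
      FreeEnv.betaRight_act, FreeEnv.betaRight_act, FreeEnv.betaRight_hat, FreeEnv.betaRight_hat,
      FreeEnv.betaRight_hat, FreeEnv.betaRight_hat, FreeEnv.betaRight_hat,
      act_skew hsymm hinv a s t, skew_swap hsymm s a, skew_swap hsymm t a,
      skew_swap hsymm t ⁅s, a⁆, skew_swap hsymm s ⁅a, t⁆]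
    have h1 : Φ t ⁅s, a⁆ = -Φ a ⁅s, t⁆ := by rw [hsymm, hinv]
    have h2 : Φ s ⁅a, t⁆ = -Φ a ⁅s, t⁆ := by
      rw [← neg_eq_iff_eq_neg, ← hinv a s t, ← lie_skew a s, map_neg, LinearMap.neg_apply,
        hinv s a t, neg_neg]
    rw [h1, h2, ← lie_skew s a, ← lie_skew t s]
    simp only [map_add, map_neg, map_smul, act_e, smul_zero, LinearMap.neg_apply]
    module
  | act y w h =>
    rw [delta_act, FreeEnv.betaRight_act, h, h, EnvModule.act_lie]
    abel

include hsymm hinv in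
theorem beta_delta (p : FreeEnv b) (w : SkewEnv b Φ) :
    beta b Φ p (delta b Φ w) = FreeEnv.pi b EnvModule.act_lie p w := by
  induction p using FreeEnv.induction with
  | zero => simp
  | add p p' h h' => simp only [map_add, LinearMap.add_apply, h, h']
  | smul c p h => simp only [map_smul, LinearMap.smul_apply, h]
  | hat y => rw [beta, FreeEnv.beta_hat, betaRight_delta hsymm hinv, FreeEnv.pi_hat]
  | act y p h => rw [FreeEnv.pi_act, ← h, beta, FreeEnv.beta_act]

variable (b Φ) in
/-- The data of the associative envelope of the Kac--Moody conformal algebra. -/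
noncomputable def torsionData : TorsionData k (FreeEnv b) (SkewEnv b Φ) where
  mul := FreeEnv.mul b
  β := beta b Φ
  δ := delta b Φ
  mul_assoc := FreeEnv.mul_assoc
  δ_mul w q := by rw [FreeEnv.mul, pi_delta]; rfl
  mul_δ p w := by
    rw [beta_delta hsymm hinv]
    exact (FreeEnv.map_pi _ _ (delta b Φ) delta_act p w).symm
  β_δβ p q r := by
    rw [beta_delta hsymm hinv]
    exact (FreeEnv.beta_mul_left EnvModule.act_lie (skew b Φ) p q r).symm
  β_mul := FreeEnv.beta_mul_right EnvModule.act_lie (skew b Φ) delta_act delta_skew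
  β_δ_δ w w' := by rw [beta_delta hsymm hinv, pi_delta]; rfl

end SkewEnv

end SkewEnv

/-! ### The torsion extension as an envelope of `K(g)`. -/

namespace ConformalAlgebra

variable {k : Type*} {C : Type*} [Field k] [AddCommGroup C] [Module k C] [ConformalAlgebra k C]

theorem rev_add_left (n : ℕ) (v v' x : C) :
    rev k n (v + v') x = rev k n v x + rev k n v' x := by
  refine Eq.trans ?_ (finsum_add_distrib (finite_support_rev k n v x)
    (finite_support_rev k n v' x))
  exact finsum_congr fun s => by rw [map_add, map_add, smul_add]

theorem comm_add_left (n : ℕ) (a a' b : C) :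
    comm k n (a + a') b = comm k n a b + comm k n a' b := by
  rw [comm, comm, comm, rev_add_left, map_add, LinearMap.add_apply]
  abel

theorem comm_add_right (n : ℕ) (a b b' : C) :
    comm k n a (b + b') = comm k n a b + comm k n a b' := by
  rw [comm, comm, comm, map_add, map_add]
  abel

theorem comm_torsion_left [CharZero k] {x : C} (hx : D (k := k) x = 0) (n : ℕ) (y : C) :
    comm k n x y = 0 := by
  rw [comm, nprod_torsion_left hx, rev_eq_zero fun j _ => nprod_torsion_right hx j y, sub_zero]

theorem comm_torsion_right [CharZero k] {x : C} (hx : D (k := k) x = 0) (n : ℕ) (y : C) :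
    comm k n y x = 0 := by
  rw [comm, nprod_torsion_right hx, rev_torsion_left hx, sub_zero]

end ConformalAlgebra

namespace KacMoody

open ConformalAlgebra TorsionExtension

variable {k : Type u} {g : Type v} {ι : Type w} [Field k] [LieRing g] [LieAlgebra k g]

theorem induction_dmon {Φ : LinearMap.BilinForm k g} {p : KacMoody Φ → Prop}
    (add : ∀ x y, p x → p y → p (x + y)) (D : ∀ x, p x → p (D (k := k) x))
    (dmon : ∀ a, p (dmon Φ 0 a)) (e : ∀ c : k, p (c • e Φ)) (x : KacMoody Φ) : p x := by
  have hdmon : ∀ i a, p (KacMoody.dmon Φ i a) := fun i a => by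
    induction i with
    | zero => exact dmon a
    | succ i ih => rw [← der_dmon]; exact D _ ih
  have hincl : ∀ f, p (incl Φ f) := fun f => by
    induction f using Finsupp.induction_linear with
    | zero => simpa using hdmon 0 0
    | add f f' h h' => rw [map_add]; exact add _ _ h h'
    | single i a => exact hdmon i a
  obtain ⟨f, c⟩ := x
  have h : ((f, c) : (ℕ →₀ g) × k) = (f, 0) + c • ((0 : ℕ →₀ g), (1 : k)) := by simp
  exact Eq.mpr (congrArg p h) (add _ _ (hincl f) (e c))

variable [CharZero k] [LinearOrder ι] {b : Module.Basis ι k g} {Φ : LinearMap.BilinForm k g}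
  (hsymm : ∀ x y, Φ x y = Φ y x) (hinv : ∀ x y z : g, Φ ⁅x, y⁆ z = -Φ y ⁅x, z⁆)

variable (b) in
/-- The map to the associative envelope. -/
noncomputable def toExtension :
    KacMoody Φ →ₗ[k] TorsionExtension (SkewEnv.torsionData b Φ hsymm hinv) :=
  LinearMap.coprod (Finsupp.lsum k fun i => dp _ i ∘ₗ FreeEnv.hat b)
    (LinearMap.toSpanSingleton k _ (dq _ 0 (SkewEnv.e b Φ)))

theorem toExtension_dmon (i : ℕ) (a : g) :
    toExtension b hsymm hinv (dmon Φ i a) = dp _ i (FreeEnv.hat b a) := by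
  change Finsupp.lsum k (fun i => dp _ i ∘ₗ FreeEnv.hat b) (Finsupp.single i a) +
    LinearMap.toSpanSingleton k _ (dq _ 0 (SkewEnv.e b Φ)) 0 = _
  simp

theorem toExtension_e : toExtension b hsymm hinv (e Φ) = dq _ 0 (SkewEnv.e b Φ) := by
  change Finsupp.lsum k (fun i => dp _ i ∘ₗ FreeEnv.hat b) 0 +
    LinearMap.toSpanSingleton k _ (dq _ 0 (SkewEnv.e b Φ)) 1 = _
  simp

theorem toExtension_D (x : KacMoody Φ) : toExtension b hsymm hinv (D (k := k) x) =
    D (k := k) (toExtension b hsymm hinv x) := by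
  suffices h : toExtension b hsymm hinv ∘ₗ der Φ =
      TorsionExtension.der _ ∘ₗ toExtension b hsymm hinv from LinearMap.congr_fun h x
  refine ext_dmon Φ (fun i a => ?_) ?_
  · rw [LinearMap.comp_apply, LinearMap.comp_apply, der_dmon, toExtension_dmon, toExtension_dmon,
      der_dp]
  · rw [LinearMap.comp_apply, LinearMap.comp_apply, der_e, toExtension_e, map_zero, der_dq, dq_succ]
    exact ((congrArg (dp _ 0) SkewEnv.delta_e).trans (map_zero _)).symm

theorem toExtension_comm_dmon (n : ℕ) (a c : g) :
    toExtension b hsymm hinv (nprod (k := k) n (dmon Φ 0 a) (dmon Φ 0 c)) =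
      ConformalAlgebra.comm k n (toExtension b hsymm hinv (dmon Φ 0 a))
        (toExtension b hsymm hinv (dmon Φ 0 c)) := by
  have hβ : ∀ a c, (SkewEnv.torsionData b Φ hsymm hinv).β (FreeEnv.hat b a) (FreeEnv.hat b c) =
      SkewEnv.skew b Φ a c := fun a c =>
    (FreeEnv.beta_hat _ _ a _).trans (FreeEnv.betaRight_hat _ _ c a)
  have hm : ∀ a c, (SkewEnv.torsionData b Φ hsymm hinv).mul (FreeEnv.hat b a) (FreeEnv.hat b c) =
      FreeEnv.act b a (FreeEnv.hat b c) := fun a c => FreeEnv.mul_hat a _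
  have hδ : ∀ a c, (SkewEnv.torsionData b Φ hsymm hinv).δ (SkewEnv.skew b Φ a c) =
      SkewEnv.defect b a c := fun a c => SkewEnv.delta_skew a c
  rw [toExtension_dmon, toExtension_dmon, ConformalAlgebra.comm, rev_eq_sum (N := 2)
    fun j hj => nprod_dp_dp (by omega) _ _]
  simp only [Finset.sum_range_succ, Finset.range_zero, Finset.sum_empty, zero_add, add_zero,
    pow_zero, pow_one, Nat.factorial_zero, Nat.factorial_one, Nat.cast_one, div_one,
    Module.End.one_apply]
  rcases n with _ | _ | n
  · simp only [zero_add, nprod_zero_dmon, toExtension_dmon, nprod_zero_dp_dp, nprod_one_dp_dp,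
      D_dq, dq_succ, hβ, hm, hδ, SkewEnv.defect_apply, ← lie_skew a c, map_neg, map_sub]
    module
  · simp only [zero_add, nprod_one_dmon, map_smul, toExtension_e, nprod_one_dp_dp,
      nprod_dp_dp (T := SkewEnv.torsionData b Φ hsymm hinv) (n := 1 + 1) le_rfl, hβ, map_zero]
    rw [SkewEnv.skew_swap hsymm a c, map_add, map_neg, map_smul]
    module
  · rw [nprod_dmon_of_two_le (by omega), nprod_dp_dp (by omega), nprod_dp_dp (by omega),
      nprod_dp_dp (by omega)]
    simp

/-- Both sides are biadditive and sesquilinear, and vanish when an argument is a multiple of `e`;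
this leaves pairs of elements of `g`. -/
theorem toExtension_comm (n : ℕ) (x y : KacMoody Φ) :
    toExtension b hsymm hinv (nprod (k := k) n x y) =
      ConformalAlgebra.comm k n (toExtension b hsymm hinv x) (toExtension b hsymm hinv y) := by
  have he : ∀ c : k, D (k := k) (c • e Φ) = 0 := fun c => by
    rw [map_smul]
    exact (congrArg (c • ·) (der_e Φ)).trans (smul_zero c)
  have he' : ∀ c : k, D (k := k) (toExtension b hsymm hinv (c • e Φ)) = 0 := fun c => by
    rw [← toExtension_D, he, map_zero]
  induction x using induction_dmon generalizing n with
  | add x x' h h' => simp only [map_add, LinearMap.add_apply, h, h', comm_add_left]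
  | D x h => rw [nprod_D_left, toExtension_D, comm_D_left, map_neg, map_smul, h]
  | e c => rw [nprod_torsion_left (he c), comm_torsion_left (he' c), map_zero]
  | dmon a =>
  induction y using induction_dmon generalizing n with
  | add x x' h h' => simp only [map_add, h, h', comm_add_right]
  | D x h =>
    rw [nprod_D_right, toExtension_D, comm_D_right, map_add, map_smul, toExtension_D, h, h]
  | e c => rw [nprod_torsion_right (he c), comm_torsion_right (he' c), map_zero]
  | dmon c => exact toExtension_comm_dmon hsymm hinv n a c

theorem isEnvelopeMap_toExtension :
    IsEnvelopeMap k (Set.range (gen Φ b)) 2 (toExtension b hsymm hinv) := by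
  have h : ∀ x, IsDegreeZero (toExtension b hsymm hinv (gen Φ b x)) := by
    rintro (_ | a)
    · exact .inr ⟨_, toExtension_e hsymm hinv⟩
    · exact .inl ⟨_, toExtension_dmon hsymm hinv 0 (b a)⟩
  refine ⟨isAssociative, toExtension_D hsymm hinv, toExtension_comm hsymm hinv, ?_⟩
  rintro _ ⟨x, rfl⟩ _ ⟨y, rfl⟩ n hn
  exact (h x).nprod_of_two_le (h y) hn

end KacMoody

/-! ### Recovering the normal monomials from the torsion extension. -/

section NormalForms

open FreeWords RewritingRules ConformalAlgebra TorsionExtension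

variable {k : Type u} {g : Type v} {ι : Type w} [Field k] [LieRing g] [LieAlgebra k g]
  [LinearOrder ι] [WellFoundedLT ι]

theorem FreeEnv.exists_normalForm (b : Module.Basis ι k g) :
    ∃ nf : FreeEnv b →ₗ[k] (List ι × ι →₀ k), ∀ (u : List ι) (x : ι), u.Pairwise (· ≤ ·) →
      nf ((envRules b _).relations.mkQ (Finsupp.single (u, x) 1)) = Finsupp.single (u, x) 1 := by
  obtain ⟨nf, h⟩ := EnvModule.exists_normalForm (b := b) (X := ι) (mod := fun _ _ => False)
    (fun _ _ h => h.elim) (fun _ _ h => h.elim) (fun _ _ _ h => h.elim)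
    (fun _ _ _ _ _ _ _ h => h.elim)
  exact ⟨nf, fun u x hu => h _ (EnvModule.normal_of_sorted hu fun _ _ _ h => h.elim)⟩

theorem SkewEnv.exists_normalForm [CharZero k] (b : Module.Basis ι k g)
    {Φ : LinearMap.BilinForm k g} (hsymm : ∀ x y, Φ x y = Φ y x)
    (hinv : ∀ x y z : g, Φ ⁅x, y⁆ z = -Φ y ⁅x, z⁆) :
    ∃ nf : SkewEnv b Φ →ₗ[k] (List ι × SkewGen g ι →₀ k),
      nf (e b Φ) = Finsupp.single ([], .e) 1 ∧
      ∀ (u : List ι) (x y : ι) (h : x < y), u.Pairwise (· ≤ ·) → (∀ z ∈ u, z ≤ y) →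
        nf ((envRules b _).relations.mkQ (Finsupp.single (u, .pair x y h) 1)) =
          Finsupp.single (u, .pair x y h) 1 := by
  obtain ⟨nf, h⟩ := EnvModule.exists_normalForm (b := b) (mod := SkewGen.Rule b Φ)
    SkewGen.rule_leading SkewGen.rule_length SkewGen.rule_unique
    fun E u a c x f hca hf hE => SkewGen.local_overlap hinv hsymm u a c x f hca hf hE
  refine ⟨nf, h _ (EnvModule.normal_of_sorted .nil ?_), fun u x y hxy hu hy =>
    h _ (EnvModule.normal_of_sorted hu ?_)⟩
  · rintro u' w r ⟨⟩
    simp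
  · intro u' w r hr hu'
    cases hr with
    | pair a _ _ _ hya =>
      subst hu'
      -- The rule for `a (x ∧ y)` needs `y < a`, which the bound on the letters excludes.
      exact (hy a (by simp)).not_gt hya

namespace KacMoody

variable [CharZero k] (b : Module.Basis ι k g) {Φ : LinearMap.BilinForm k g}
  (hsymm : ∀ x y, Φ x y = Φ y x) (hinv : ∀ x y z : g, Φ ⁅x, y⁆ z = -Φ y ⁅x, z⁆)

omit [WellFoundedLT ι] in
theorem foldr_act_dp (u : List ι) (s : ℕ) (p : FreeEnv b) :
    (u.map (Gen.L 0)).foldr (fun c y => act Φ b (toExtension b hsymm hinv) c y) (dp _ s p) =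
      dp _ s (u.foldr (fun a q => FreeEnv.act b (b a) q) p) := by
  induction u with
  | nil => rfl
  | cons a u ih =>
    rw [List.map_cons, List.foldr_cons, List.foldr_cons, ih]
    change nprod (k := k) 0 (toExtension b hsymm hinv (dmon Φ 0 (b a))) _ = _
    rw [toExtension_dmon]
    refine (prod_dp_dp 0 0 s _ _).trans ?_
    simp only [coef]
    norm_num
    exact congrArg (dp _ s) (FreeEnv.mul_hat (b a) _)

omit [WellFoundedLT ι] in
theorem foldr_act_dq (u : List ι) (w : SkewEnv b Φ) :
    (u.map (Gen.L 0)).foldr (fun c y => act Φ b (toExtension b hsymm hinv) c y) (dq _ 0 w) =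
      dq _ 0 (u.foldr (fun a q => SkewEnv.act b Φ (b a) q) w) := by
  induction u with
  | nil => rfl
  | cons a u ih =>
    rw [List.map_cons, List.foldr_cons, List.foldr_cons, ih]
    change nprod (k := k) 0 (toExtension b hsymm hinv (dmon Φ 0 (b a))) _ = _
    rw [toExtension_dmon, nprod_zero_dp_dq]
    refine congrArg (dq _ 0) ((SkewEnv.beta_delta hsymm hinv _ _).trans ?_)
    rw [FreeEnv.pi_hat]

omit [WellFoundedLT ι] [CharZero k] in
theorem foldr_envModule_act {X : Type*} {mod : List ι × X → (List ι × X →₀ k) → Prop}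
    (u : List ι) (x : X) :
    u.foldr (fun a q => EnvModule.act b mod (b a) q) (EnvModule.gen b mod x) =
      (envRules b mod).relations.mkQ (Finsupp.single (u, x) 1) := by
  induction u with
  | nil => rfl
  | cons a u ih => rw [List.foldr_cons, ih, EnvModule.act_basis_mk]

/-- The monomial that corresponds to a monomial of the torsion extension. -/
def skewMonomial : List ι × SkewGen g ι → List (Gen ι) × WithBot ι
  | (u, .e) => (u.map (Gen.L 0), ⊥)
  | (u, .pair x y _) => (u.map (Gen.L 0) ++ [Gen.L 1 x], (y : WithBot ι))

/-- The normal forms can be recovered from the associative envelope. -/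
theorem exists_retraction :
    ∃ θ : TorsionExtension (SkewEnv.torsionData b Φ hsymm hinv) →ₗ[k]
        (List (Gen ι) × WithBot ι →₀ k),
      ∀ m, NormalForm m → θ (eval (act Φ b (toExtension b hsymm hinv))
        (fun x => toExtension b hsymm hinv (gen Φ b x)) (Finsupp.single m 1)) =
          Finsupp.single m 1 := by
  obtain ⟨nf, hnf⟩ := FreeEnv.exists_normalForm b
  obtain ⟨nf', hnfe, hnf'⟩ := SkewEnv.exists_normalForm b hsymm hinv
  -- The retraction takes normal forms in `P` and in `Q` and writes them back as words: `∂^s (u x)`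
  -- as `L_0^u ∂^s x`, and `u (x ∧ y)` as `L_0^u L_1^x y`.
  refine ⟨desc _ (fun s => Finsupp.lmapDomain k k (fun m : List ι × ι =>
    (m.1.map (Gen.L 0) ++ List.replicate s Gen.D, (m.2 : WithBot ι))) ∘ₗ nf)
    (Finsupp.lmapDomain k k (skewMonomial (g := g)) ∘ₗ nf'), ?_⟩
  intro m hm
  cases hm with
  | e =>
    rw [eval_single, one_smul]
    change desc _ _ _ (toExtension b hsymm hinv (e Φ)) = _
    rw [toExtension_e, desc_dq_zero, LinearMap.comp_apply, hnfe, Finsupp.lmapDomain_apply,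
      Finsupp.mapDomain_single]
    rfl
  | D u s x hu =>
    rw [eval_single, one_smul, List.foldr_append]
    have h : (List.replicate s Gen.D).foldr
        (fun c y => act Φ b (toExtension b hsymm hinv) c y)
        (toExtension b hsymm hinv (gen Φ b x)) = dp _ s (FreeEnv.hat b (b x)) := by
      induction s with
      | zero => exact toExtension_dmon hsymm hinv 0 (b x)
      | succ s ih =>
        rw [List.replicate_succ, List.foldr_cons, ih]
        exact D_dp s _
    rw [h, foldr_act_dp, FreeEnv.hat_basis, foldr_envModule_act, desc_dp, LinearMap.comp_apply,
      hnf u x hu, Finsupp.lmapDomain_apply, Finsupp.mapDomain_single]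
  | L1 u x y hu hxy hy =>
    rw [eval_single, one_smul, List.foldr_append]
    have h : [Gen.L 1 x].foldr (fun c y => act Φ b (toExtension b hsymm hinv) c y)
        (toExtension b hsymm hinv (gen Φ b y)) =
        dq _ 0 (EnvModule.gen b (SkewGen.Rule b Φ) (.pair x y hxy)) := by
      change nprod (k := k) 1 (toExtension b hsymm hinv (dmon Φ 0 (b x)))
        (toExtension b hsymm hinv (dmon Φ 0 (b y))) = _
      rw [toExtension_dmon, toExtension_dmon, nprod_one_dp_dp, ← SkewEnv.skew_basis_of_lt]
      exact congrArg (dq _ 0) ((FreeEnv.beta_hat _ _ (b x) _).trans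
        (FreeEnv.betaRight_hat _ _ (b y) (b x)))
    rw [h, foldr_act_dq, foldr_envModule_act, desc_dq_zero, LinearMap.comp_apply,
      hnf' u x y hxy hu hy, Finsupp.lmapDomain_apply, Finsupp.mapDomain_single]
    rfl

end KacMoody

end NormalForms

/-! ### Validity of the rules in every envelope. -/

namespace RewritingRules

variable {k B X : Type*} [Field k] {S : RewritingRules k B X} {M : Type*} [AddCommGroup M]
  [Module k M] {act : B → Module.End k M} {gen : X → M}

theorem eval_single_eq_prod (u : List B) (x : X) (c : k) :
    eval act gen (Finsupp.single (u, x) c) = c • (u.map act).prod (gen x) := by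
  rw [eval_single]
  congr 1
  induction u with
  | nil => rfl
  | cons a u ih => rw [List.foldr_cons, ih, List.map_cons, List.prod_cons, Module.End.mul_apply]

/-- The rewriting relations hold in a module in which the rules hold. -/
theorem eval_eq_of_rewrites
    (halg : ∀ w f, S.alg w f → ∀ y : M, (w.map act).prod y =
      Finsupp.linearCombination k (fun w' => (w'.map act).prod y) f)
    (hmod : ∀ m f, S.mod m f → eval act gen (Finsupp.single m 1) = eval act gen f)
    (m : List B × X) (r : List B × X →₀ k) (h : S.Rewrites m r) :
    eval act gen (Finsupp.single m 1) = eval act gen r := by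
  cases h with
  | alg h u v x =>
    rename_i w f
    have key : ∀ f : List B →₀ k, eval act gen (f.mapDomain fun w' => (u ++ w' ++ v, x)) =
        (u.map act).prod (Finsupp.linearCombination k
          (fun w' => (w'.map act).prod ((v.map act).prod (gen x))) f) := by
      intro f
      induction f using Finsupp.induction_linear with
      | zero => simp
      | add f f' h h' => rw [Finsupp.mapDomain_add, map_add, h, h', map_add, map_add]
      | single w c =>
        rw [Finsupp.mapDomain_single, eval_single_eq_prod, Finsupp.linearCombination_single,
          map_smul, List.map_append, List.map_append, List.prod_append, List.prod_append,
          Module.End.mul_apply, Module.End.mul_apply]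
    rw [key, ← halg w f h, eval_single_eq_prod, one_smul, List.map_append, List.map_append,
      List.prod_append, List.prod_append, Module.End.mul_apply, Module.End.mul_apply]
  | mod h u =>
    rename_i w x f
    have key : ∀ f : List B × X →₀ k, eval act gen (f.mapDomain fun m => (u ++ m.1, m.2)) =
        (u.map act).prod (eval act gen f) := by
      intro f
      induction f using Finsupp.induction_linear with
      | zero => simp
      | add f f' h h' => rw [Finsupp.mapDomain_add, map_add, h, h', map_add, map_add]
      | single m c =>
        obtain ⟨w, x⟩ := m
        rw [Finsupp.mapDomain_single, eval_single_eq_prod, eval_single_eq_prod, map_smul,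
          List.map_append, List.prod_append, Module.End.mul_apply]
    rw [key, ← hmod _ f h, eval_single_eq_prod, eval_single_eq_prod, one_smul, one_smul,
      List.map_append, List.prod_append, Module.End.mul_apply]

end RewritingRules

namespace KacMoody

open ConformalAlgebra RewritingRules

variable {k : Type u} {g : Type v} {ι : Type w} [Field k] [LieRing g] [LieAlgebra k g]
  {b : Module.Basis ι k g} {Φ : LinearMap.BilinForm k g}
  {U : Type*} [AddCommGroup U] [Module k U] [ConformalAlgebra k U] {τ : KacMoody Φ →ₗ[k] U}

theorem act_D : act Φ b τ .D = D (k := k) := rfl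

theorem act_L (n : ℕ) (a : ι) : act Φ b τ (.L n a) = nprod (k := k) n (τ (dmon Φ 0 (b a))) := rfl

theorem act_R (n : ℕ) (a : ι) : act Φ b τ (.R n a) = rev k n (τ (dmon Φ 0 (b a))) := rfl

theorem linearCombination_wd (u : List (Gen ι)) (x : U) :
    Finsupp.linearCombination k (fun w' => (w'.map (act Φ b τ)).prod x) (wd u) =
      (u.map (act Φ b τ)).prod x := by
  rw [wd, Finsupp.linearCombination_single, one_smul]

theorem linearCombination_genLin (n : ℕ) (y : g) (x : U) :
    Finsupp.linearCombination k (fun w' => (w'.map (act Φ b τ)).prod x) (genLin b n y) =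
      nprod (k := k) n (τ (dmon Φ 0 y)) x := by
  suffices h : Finsupp.linearCombination k (fun w' => (w'.map (act Φ b τ)).prod x) ∘ₗ
      Finsupp.lmapDomain k k (fun c => [Gen.L n c]) ∘ₗ b.repr.toLinearMap =
      (nprod (k := k) n).flip x ∘ₗ τ ∘ₗ dmon Φ 0 from LinearMap.congr_fun h y
  refine b.ext fun i => ?_
  simp [act_L]

theorem eval_mon (u : List (Gen ι)) (a : ι) :
    eval (act Φ b τ) (fun x => τ (gen Φ b x)) (mon u a) =
      (u.map (act Φ b τ)).prod (τ (dmon Φ 0 (b a))) := by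
  rw [mon, eval_single_eq_prod, one_smul]
  rfl

theorem eval_monE : eval (act Φ b τ) (fun x => τ (gen Φ b x)) monE = τ (e Φ) := by
  rw [monE, eval_single_eq_prod, one_smul]
  rfl

theorem eval_monLin (u : List (Gen ι)) (y : g) :
    eval (act Φ b τ) (fun x => τ (gen Φ b x)) (monLin b u y) =
      (u.map (act Φ b τ)).prod (τ (dmon Φ 0 y)) := by
  suffices h : eval (act Φ b τ) (fun x => τ (gen Φ b x)) ∘ₗ
      Finsupp.lmapDomain k k (fun c : ι => (u, (c : WithBot ι))) ∘ₗ b.repr.toLinearMap =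
      (u.map (act Φ b τ)).prod ∘ₗ τ ∘ₗ dmon Φ 0 from LinearMap.congr_fun h y
  refine b.ext fun i => ?_
  simp only [LinearMap.comp_apply, LinearEquiv.coe_coe, Module.Basis.repr_self,
    Finsupp.lmapDomain_apply, Finsupp.mapDomain_single]
  exact eval_mon u i

variable [LinearOrder ι] [CharZero k] (hτ : IsEnvelopeMap k (Set.range (gen Φ b)) 2 τ)
include hτ

theorem algRule_holds (w : List (Gen ι)) (f : List (Gen ι) →₀ k) (h : AlgRule b w f) (x : U) :
    (w.map (act Φ b τ)).prod x =
      Finsupp.linearCombination k (fun w' => (w'.map (act Φ b τ)).prod x) f := by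
  cases h with
  | D_L0 a =>
    rw [linearCombination_wd]
    simp [act_D, act_L, nprod_D_right]
  | D_L1 a =>
    rw [map_sub, linearCombination_wd, linearCombination_wd]
    simp [act_D, act_L, nprod_D_right]
  | L_D n hn a =>
    rw [map_add, map_smul, linearCombination_wd, linearCombination_wd]
    simp [act_D, act_L, nprod_D_right]
  | R_D n a =>
    rw [map_add, map_smul, linearCombination_wd, linearCombination_wd]
    simp [act_D, act_R, rev_D]
  | R_L m n a c =>
    rw [linearCombination_wd]
    simp [act_L, act_R, rev_nprod hτ.1]
  | L_L n m a c h =>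
    rw [map_add, linearCombination_wd, linearCombination_genLin]
    simpa [act_L] using nprod_comm hτ n m (b a) (b c) x

theorem modRule_holds (hinv : ∀ x y z : g, Φ ⁅x, y⁆ z = -Φ y ⁅x, z⁆) (m : List (Gen ι) × WithBot ι)
    (f : List (Gen ι) × WithBot ι →₀ k) (h : ModRule Φ b m f) :
    eval (act Φ b τ) (fun x => τ (gen Φ b x)) (Finsupp.single m 1) =
      eval (act Φ b τ) (fun x => τ (gen Φ b x)) f := by
  have hbot : ∀ u : List (Gen ι), eval (act Φ b τ) (fun x => τ (gen Φ b x))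
      (Finsupp.single (u, ⊥) 1) = (u.map (act Φ b τ)).prod (τ (e Φ)) := fun u => by
    rw [eval_single_eq_prod, one_smul]
    rfl
  have hcoe : ∀ (u : List (Gen ι)) (x : ι), eval (act Φ b τ) (fun x => τ (gen Φ b x))
      (Finsupp.single (u, (x : WithBot ι)) 1) =
        (u.map (act Φ b τ)).prod (τ (dmon Φ 0 (b x))) := fun u x => by
    rw [eval_single_eq_prod, one_smul]
    rfl
  have he := D_e_eq_zero hτ
  cases h with
  | D_e => simp [hbot, act_D, he]
  | L_e n x => simp [hbot, act_L, nprod_torsion_right he]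
  | R_e n x => simp [hbot, act_R, rev_torsion_left he]
  | L_loc n hn x y => simp [hcoe, act_L, nprod_eq_zero hτ hn]
  | R_loc n hn x y => simp [hcoe, act_R, rev_dmon_of_two_le hτ hn]
  | R1 x y =>
    rw [map_sub, map_smul, eval_mon, eval_monE, hcoe]
    simpa [act_L, act_R] using rev_one_dmon hτ (b x) (b y)
  | R0 x y =>
    rw [map_sub, eval_mon, eval_monLin, hcoe]
    simpa [act_L, act_R] using rev_zero_dmon hτ (b x) (b y)
  | L1_skew x y h =>
    rw [map_add, map_neg, map_smul, eval_mon, eval_monE, hcoe]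
    simpa [act_L] using nprod_one_swap hτ (b x) (b y)
  | L1_diag x =>
    rw [map_smul, eval_monE, hcoe]
    have h := nprod_one_swap hτ (b x) (b x)
    rw [eq_neg_add_iff_add_eq, ← two_smul k] at h
    rw [mul_smul, ← h, smul_smul]
    simp [act_L]
  | L1_D s hs x y =>
    rw [map_sub, map_sub, map_smul, eval_mon, eval_mon, eval_monLin, hcoe]
    simpa [act_L, act_D] using nprod_one_D_pow hτ hs (b x) (b y)
  | L1_L1 x y z h h' =>
    rw [map_zero, hcoe]
    simpa [act_L] using nprod_one_nprod_one hτ (b x) (b y) (b z)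
  | L0_L1 x y z h h' =>
    rw [map_add, map_add, map_add, map_add, map_sub, map_smul, eval_mon, eval_mon, eval_monLin,
      eval_monLin, eval_monLin, eval_monE, hcoe]
    simp only [List.map_cons, List.map_nil, List.prod_cons, List.prod_nil, mul_one, act_L,
      Module.End.mul_apply]
    have h1 : Φ ⁅b x, b y⁆ (b z) = Φ (b x) ⁅b y, b z⁆ := by
      rw [← lie_skew, map_neg, LinearMap.neg_apply, hinv, neg_neg]
    have h2 : Φ ⁅b x, b z⁆ (b y) = -Φ (b x) ⁅b y, b z⁆ := by
      rw [← lie_skew, map_neg, LinearMap.neg_apply, hinv, neg_neg, ← lie_skew, map_neg]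
    -- The differentiated identity differs from the rule by skew symmetry in some first products; by
    -- invariance the resulting multiples of `e` add up to `2 Φ (b x) ⁅b y, b z⁆`.
    rw [nprod_zero_nprod_one hτ, nprod_one_swap hτ (b x) (b z), nprod_one_swap hτ (b x) (b y),
      nprod_one_swap hτ ⁅b x, b y⁆, nprod_one_swap hτ ⁅b x, b z⁆, h1, h2, ← lie_skew (b z) (b y),
      ← lie_skew (b y) (b x)]
    simp only [map_add, map_neg, map_smul, nprod_torsion_right he, smul_zero]
    module

theorem eval_rewrites (hinv : ∀ x y z : g, Φ ⁅x, y⁆ z = -Φ y ⁅x, z⁆)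
    (m : List (Gen ι) × WithBot ι)
    (r : List (Gen ι) × WithBot ι →₀ k) (h : (rules Φ b).Rewrites m r) :
    eval (act Φ b τ) (fun x => τ (gen Φ b x)) (Finsupp.single m 1) =
      eval (act Φ b τ) (fun x => τ (gen Φ b x)) r :=
  eval_eq_of_rewrites (S := rules Φ b) (algRule_holds hτ) (modRule_holds hτ hinv) m r h

end KacMoody

/-! ### Generation of the universal envelope as a module. -/

namespace ConformalAlgebra

variable {k : Type*} {C : Type*} [Field k] [AddCommGroup C] [Module k C] [ConformalAlgebra k C]

theorem IsHom.map_rev {C' : Type*} [AddCommGroup C'] [Module k C'] [ConformalAlgebra k C']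
    {ψ : C →ₗ[k] C'} (hψ : IsHom k ψ) (n : ℕ) (v x : C) :
    ψ (rev k n v x) = rev k n (ψ v) (ψ x) := by
  have hD : ∀ s y, ψ (((D (k := k)) ^ s) y) = ((D (k := k)) ^ s) (ψ y) := by
    intro s y
    induction s with
    | zero => rfl
    | succ s ih =>
      rw [pow_succ', pow_succ', Module.End.mul_apply, Module.End.mul_apply, hψ.1, ih]
  obtain ⟨N, hN⟩ := locality (k := k) x v
  rw [rev_eq_sum (N := N) fun j hj => hN j (by omega), rev_eq_sum (N := N) fun j hj => by
    rw [← hψ.2, hN j (by omega), map_zero]]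
  simp only [map_sum, map_smul, hD, hψ.2]

/-- A subspace closed under the operations is a conformal algebra. -/
noncomputable abbrev ofSubmodule (M : Submodule k C) (hD : ∀ u ∈ M, D (k := k) u ∈ M)
    (hM : ∀ n, ∀ u ∈ M, ∀ v ∈ M, nprod (k := k) n u v ∈ M) : ConformalAlgebra k M where
  D := (D (k := k)).restrict hD
  nprod n := LinearMap.mk₂ k (fun u v => ⟨nprod (k := k) (C := C) n u v, hM n u u.2 v v.2⟩)
    (fun _ _ _ => Subtype.ext (by simp)) (fun _ _ _ => Subtype.ext (by simp))
    (fun _ _ _ => Subtype.ext (by simp)) (fun _ _ _ => Subtype.ext (by simp))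
  locality u v := by
    obtain ⟨N, hN⟩ := locality (k := k) (u : C) v
    exact ⟨N, fun n hn => Subtype.ext (hN n hn)⟩
  nprod_D_left n u v := Subtype.ext (nprod_D_left n (u : C) v)
  nprod_D_right n u v := Subtype.ext (nprod_D_right n (u : C) v)

end ConformalAlgebra

open ConformalAlgebra in
/-- A subalgebra that contains the image of the Lie conformal algebra is the whole envelope. -/
theorem IsUniversalEnvelope.eq_top {k : Type*} [Field k] {L : Type*} [AddCommGroup L] [Module k L]
    [ConformalAlgebra k L] {X : Set L} {N : ℕ} {U : Type w} [AddCommGroup U] [Module k U]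
    [ConformalAlgebra k U] {τ : L →ₗ[k] U} (h : IsUniversalEnvelope k X N τ)
    {M : Submodule k U} (hD : ∀ u ∈ M, D (k := k) u ∈ M)
    (hM : ∀ n, ∀ u ∈ M, ∀ v ∈ M, nprod (k := k) n u v ∈ M) (hτ : ∀ x, τ x ∈ M) : M = ⊤ := by
  let _ := ofSubmodule M hD hM
  have hsub : IsHom k M.subtype := ⟨fun _ => rfl, fun _ _ _ => rfl⟩
  have hE : IsEnvelopeMap k X N (τ.codRestrict M hτ) := by
    obtain ⟨h1, h2, h3, h4⟩ := h.isEnvelopeMap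
    refine ⟨fun n m a b c => Subtype.ext ?_, fun x => Subtype.ext (h2 x),
      fun n x y => Subtype.ext ?_, fun x hx y hy n hn => Subtype.ext (h4 x hx y hy n hn)⟩
    · exact (h1 n m a b c).trans (map_sum M.subtype (fun s =>
        (n.choose s : k) • nprod (k := k) (m + s) (nprod (k := k) (n - s) a b) c) _).symm
    · exact (h3 n x y).trans (congrArg (_ - ·) (hsub.map_rev n (τ.codRestrict M hτ x)
        (τ.codRestrict M hτ y)).symm)
  obtain ⟨ψ, ⟨hψ, hψτ⟩, -⟩ := h.universal M _ hE
  -- By uniqueness, the map to the subalgebra followed by the inclusion is the identity of `U`.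
  have hid := (h.universal U τ h.isEnvelopeMap).unique (y₁ := M.subtype ∘ₗ ψ) (y₂ := LinearMap.id)
    ⟨⟨fun x => congrArg M.subtype (hψ.1 x), fun n x y => congrArg M.subtype (hψ.2 n x y)⟩, by
      rw [LinearMap.comp_assoc, hψτ]
      rfl⟩
    ⟨⟨fun _ => rfl, fun _ _ _ => rfl⟩, rfl⟩
  exact eq_top_iff.2 fun u _ => by
    have : ((ψ u : M) : U) = u := LinearMap.congr_fun hid u
    exact this ▸ (ψ u).2

namespace KacMoody

open ConformalAlgebra RewritingRules

variable {k : Type u} {g : Type v} {ι : Type w} [Field k] [LieRing g] [LieAlgebra k g]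
  {b : Module.Basis ι k g} {Φ : LinearMap.BilinForm k g}

section Hom

variable {U C : Type*} [AddCommGroup U] [Module k U] [ConformalAlgebra k U] [AddCommGroup C]
  [Module k C] [ConformalAlgebra k C] {τ : KacMoody Φ →ₗ[k] U}

theorem map_eval {ψ : U →ₗ[k] C} (hψ : IsHom k ψ) (f : List (Gen ι) × WithBot ι →₀ k) :
    ψ (eval (act Φ b τ) (fun x => τ (gen Φ b x)) f) =
      eval (act Φ b (ψ ∘ₗ τ)) (fun x => (ψ ∘ₗ τ) (gen Φ b x)) f := by
  have hact : ∀ c x, ψ (act Φ b τ c x) = act Φ b (ψ ∘ₗ τ) c (ψ x) := by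
    rintro (_ | ⟨n, a⟩ | ⟨n, a⟩) x
    · exact hψ.1 x
    · exact hψ.2 n _ x
    · exact hψ.map_rev n _ x
  induction f using Finsupp.induction_linear with
  | zero => simp
  | add f f' h h' => simp only [map_add, h, h']
  | single m c =>
    obtain ⟨u, x⟩ := m
    rw [eval_single, eval_single, map_smul]
    congr 1
    induction u with
    | nil => rfl
    | cons a u ih => rw [List.foldr_cons, List.foldr_cons, hact, ih]

variable (b τ) in
/-- The submodule generated by the image of the generators. -/
noncomputable abbrev evalRange : Submodule k U :=
  LinearMap.range (eval (act Φ b τ) (fun x => τ (gen Φ b x)))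

theorem act_mem_evalRange (c : Gen ι) {u : U} (hu : u ∈ evalRange b τ) :
    act Φ b τ c u ∈ evalRange b τ := by
  obtain ⟨f, rfl⟩ := hu
  refine ⟨f.mapDomain fun m => (c :: m.1, m.2), ?_⟩
  induction f using Finsupp.induction_linear with
  | zero => simp
  | add f f' h h' => rw [Finsupp.mapDomain_add, map_add, map_add, map_add, h, h']
  | single m r =>
    obtain ⟨u, x⟩ := m
    rw [Finsupp.mapDomain_single, eval_single, eval_single, map_smul]
    rfl

theorem gen_mem_evalRange (x : WithBot ι) : τ (gen Φ b x) ∈ evalRange b τ :=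
  ⟨Finsupp.single ([], x) 1, by rw [eval_single, one_smul]; rfl⟩

theorem D_mem_evalRange {u : U} (hu : u ∈ evalRange b τ) : D (k := k) u ∈ evalRange b τ :=
  act_mem_evalRange .D hu

theorem map_mem_evalRange (hτ : ∀ x, τ (D (k := k) x) = D (k := k) (τ x)) (x : KacMoody Φ) :
    τ x ∈ evalRange b τ := by
  induction x using induction_dmon with
  | add x y h h' => rw [map_add]; exact add_mem h h'
  | D x h => rw [hτ]; exact D_mem_evalRange h
  | dmon a =>
    suffices h : (evalRange b τ).mkQ ∘ₗ τ ∘ₗ dmon Φ 0 = 0 from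
      (Submodule.Quotient.mk_eq_zero _).1 (LinearMap.congr_fun h a)
    exact b.ext fun i => (Submodule.Quotient.mk_eq_zero _).2 (gen_mem_evalRange (i : WithBot ι))
  | e c =>
    rw [map_smul]
    exact Submodule.smul_mem _ c (gen_mem_evalRange (⊥ : WithBot ι))

/-- The elements whose left multiplications preserve the range form a subalgebra, as `(u ₍ₘ₎ u') ₍ₙ₎
v` is a combination of terms `u ₍ᵢ₎ (u' ₍ⱼ₎ v)`. It contains the generators and is closed under
`act`, hence contains the whole range. -/
theorem nprod_mem_evalRange [CharZero k] (hτ : IsEnvelopeMap k (Set.range (gen Φ b)) 2 τ) (n : ℕ)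
    (u : U) (hu : u ∈ evalRange b τ) (v : U) (hv : v ∈ evalRange b τ) :
    nprod (k := k) n u v ∈ evalRange b τ := by
  let S : U → Prop := fun u => ∀ n, ∀ v ∈ evalRange b τ, nprod (k := k) n u v ∈ evalRange b τ
  have hgen : ∀ x, S (τ (gen Φ b x)) := by
    rintro (_ | a) n v hv
    · change nprod (k := k) n (τ (e Φ)) v ∈ _
      rw [nprod_torsion_left (D_e_eq_zero hτ)]
      exact zero_mem _
    · exact act_mem_evalRange (.L n a) hv
  have hD : ∀ u, S u → S (D (k := k) u) := fun u h n v hv => by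
    rw [nprod_D_left]
    exact neg_mem (Submodule.smul_mem _ _ (h _ v hv))
  have hn : ∀ m u u', S u → S u' → S (nprod (k := k) m u u') := fun m u u' h h' n v hv => by
    rw [nprod_nprod_left hτ.1]
    exact sum_mem fun t _ => Submodule.smul_mem _ _ (h _ _ (h' _ v hv))
  have hsmul : ∀ (c : k) u, S u → S (c • u) := fun c u h n v hv => by
    rw [map_smul]
    exact Submodule.smul_mem _ c (h n v hv)
  have hadd : ∀ u u', S u → S u' → S (u + u') := fun u u' h h' n v hv => by
    rw [map_add]
    exact add_mem (h n v hv) (h' n v hv)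
  have hact : ∀ c u, S u → S (act Φ b τ c u) := by
    rintro (_ | ⟨m, a⟩ | ⟨m, a⟩) u h
    · exact hD u h
    · exact hn m _ u (hgen (a : WithBot ι)) h
    · obtain ⟨N, hN⟩ := locality (k := k) u (τ (dmon Φ 0 (b a)))
      rw [act_R, rev_eq_sum (N := N) fun j hj => hN j (by omega)]
      refine Finset.sum_induction _ S hadd (fun n v _ => by simp) fun s _ => hsmul _ _ ?_
      induction s with
      | zero => exact hn _ u _ h (hgen (a : WithBot ι))
      | succ s _ =>
        -- The product index is frozen so that the induction runs over the power of `∂` alone.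
        generalize m + (s + 1) = j
        induction s + 1 with
        | zero => exact hn _ u _ h (hgen (a : WithBot ι))
        | succ t ih =>
          rw [pow_succ', Module.End.mul_apply]
          exact hD _ ih
  suffices h : S u from h n v hv
  obtain ⟨f, rfl⟩ := hu
  induction f using Finsupp.induction_linear with
  | zero => intro n v _; simp
  | add f f' h h' => rw [map_add]; exact hadd _ _ h h'
  | single m c =>
    obtain ⟨w, x⟩ := m
    rw [eval_single]
    refine hsmul _ _ ?_
    induction w with
    | nil => exact hgen x
    | cons a w ih => exact hact a _ ih

end Hom

end KacMoody

theorem mainTheorem4 {k : Type u} {g : Type v} {ι : Type w} [Field k] [CharZero k]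
    [LieRing g] [LieAlgebra k g] [LinearOrder ι] [WellFoundedLT ι] (b : Module.Basis ι k g)
    (Φ : LinearMap.BilinForm k g) (hsymm : Φ.IsSymm) (hinv : Φ.lieInvariant g)
    {U : Type (max u v w)} [AddCommGroup U] [Module k U] [ConformalAlgebra k U]
    (τ : KacMoody Φ →ₗ[k] U)
    (hU : IsUniversalEnvelope k (Set.range (KacMoody.gen Φ b)) 2 τ) :
    (KacMoody.rules Φ b).IsGroebnerShirshovBasis Gen.monLT (KacMoody.act Φ b τ)
      (fun x => τ (KacMoody.gen Φ b x)) := by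
  have hτ := hU.isEnvelopeMap
  have hs : ∀ x y, Φ x y = Φ y x := fun x y => hsymm.eq x y
  have hi : ∀ x y z : g, Φ ⁅x, y⁆ z = -Φ y ⁅x, z⁆ := hinv
  obtain ⟨θ, hθ⟩ := KacMoody.exists_retraction b hs hi
  -- The parameter `g` of `SkewGen` places the torsion extension in the universe `max u v w` of `U`,
  -- where universality applies.
  obtain ⟨ψ, ⟨hψ, hψτ⟩, -⟩ := hU.universal _ _ (KacMoody.isEnvelopeMap_toExtension (b := b) hs hi)
  refine RewritingRules.isGroebnerShirshovBasis_of_retraction Gen.monLT_wf Gen.monLT_trichotomous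
    (KacMoody.rules_leading b Φ)
    (hU.eq_top (fun _ => KacMoody.D_mem_evalRange) (KacMoody.nprod_mem_evalRange hτ)
      (KacMoody.map_mem_evalRange hτ.2.1))
    (KacMoody.eval_rewrites hτ hi) (θ ∘ₗ ψ) fun m hm => ?_
  rw [LinearMap.comp_apply, KacMoody.map_eval hψ, hψτ]
  exact hθ m (KacMoody.normalForm_of_normal b Φ hm)
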